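/- **Machines.** A catalytic Turing machine is a deterministic Turing machine with a read-only input tape holding $u\in\{0,1\}^n$, finitely many read-write work tapes over a finite alphabet, of which only the first $s(n)$ cells may be visited, a read-write catalytic tape with exactly $c(n)$ binary cells, and a write-only, left-to-right output tape; it halts by accepting or rejecting. It solves a problem with work space $s(n)$ and catalytic space $c(n)$ if for every $u\in\{0,1\}^n$ and every initial content $\tau\in\{0,1\}^{c(n)}$ of the catalytic tape it respects the space bound and halts with a correct result for $u$ and with $\tau$ restored on the catalytic tape. (If a problem has several correct results for $u$, the one returned may depend on $\tau$.) A problem is in $\mathsf{CL}$ if, for some constant $k$, it can be solved with work space $k(\lfloor\log_2 n\rfloor+1)$ and catalytic space $n^k$. A language is regarded as the problem of accepting exactly its elements; it is in $\mathsf{PSPACE}$ if it can be decided with work space $n^k+k$ for some $k$ and no catalytic space. **Problems.** Let $m:\mathbb N\to\mathbb N$ be bounded by a polynomial, and for every $x\in\{0,1\}^*$ let $R(x,\cdot)$ be a predicate on $\{0,1\}^{m(|x|)}$; call $y\in\{0,1\}^{m(|x|)}$ a witness of $x$ if $R(x,y)=1$. For $W:\{1,\dots,m(|x|)\}\to\mathbb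 N$ put $W(y)=\sum_{i:\,y_i=1}W(i)$. Fix a standard self-delimiting binary encoding of tuples, with numbers in binary. For each constant $c\ge 1$: * the *weighted decision problem* $\mathcal L_{w,c}$ is the language of all (encoded) triples $(x,W,w_0)$ with $W:\{1,\dots,m(|x|)\}\to[0,m(|x|)^c]$ and $w_0\in\mathbb N$ such that some witness $y$ of $x$ has $W(y)\le w_0$; * the *min-weight search problem* $\mathrm{Search}_c$ is: given an (encoded) pair $(x,W)$ with $W:\{1,\dots,m(|x|)\}\to[0,m(|x|)^c]$, accept and output some $y\in\arg\min_{y:\,R(x,y)=1}W(y)$ if $x$ has a witness, and reject if $x$ has no witness. Strings that encode no such pair are rejected. **Statement.** Suppose that the language $\{(x,y): R(x,y)=1\}$ is in $\mathsf{PSPACE}$ and that $\mathcal L_{w,c}\in\mathsf{CL}$ for every constant $c\ge 1$. Then $\mathrm{Search}_c\in\mathsf{CL}$ for every constant $c\ge 1$. -/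

import Mathlib

/-! Catalytic Turing machines, the classes `CL` and `PSPACE`, and the weighted decision and
min-weight search problems of a witness relation. -/

/-- Symbol under the head of a binary tape of fixed length with an end marker on each side. -/
inductive EndSymbol where
  | left : EndSymbol
  | bit : Bool → EndSymbol
  | right : EndSymbol

/-- A binary tape with contents `w` has its left end marker at position `0`, the cells at positions
`1, …, w.length`, and its right end marker at position `w.length + 1`. -/
def readTape (w : List Bool) : ℕ → EndSymbol
  | 0 => EndSymbol.left
  | i + 1 => if h : i < w.length then EndSymbol.bit w[i] else EndSymbol.right

/-- Overwrite the cell at the given position; the end markers cannot be overwritten. -/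
def writeTape (w : List Bool) (b : Bool) : ℕ → List Bool
  | 0 => w
  | i + 1 => w.set i b

/-- Head movements. -/
inductive HeadMove where
  | left : HeadMove
  | stay : HeadMove
  | right : HeadMove

/-- Move a head on a one-way infinite tape with positions `0, 1, 2, …`. -/
def HeadMove.apply : HeadMove → ℕ → ℕ
  | HeadMove.left, p => p - 1
  | HeadMove.stay, p => p
  | HeadMove.right, p => p + 1

/-- What a machine does in one step. -/
structure MachineAction (State Symbol : Type) (tapes : ℕ) where
  /-- the next state -/
  next : State
  /-- movement of the input head -/
  moveInput : HeadMove
  /-- the bit written on the catalytic tape -/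
  writeCatalytic : Bool
  /-- movement of the catalytic head -/
  moveCatalytic : HeadMove
  /-- the symbols written on the work tapes -/
  writeWork : Fin tapes → Symbol
  /-- movements of the work heads -/
  moveWork : Fin tapes → HeadMove
  /-- the bit appended to the output tape, if any -/
  emit : Option Bool

/-- A deterministic catalytic Turing machine: a read-only binary input tape, a read-write binary
catalytic tape, finitely many read-write work tapes over a finite alphabet, and a write-only output
tape whose head only moves to the right. -/
structure CatalyticMachine where
  /-- the states -/
  State : Type
  finite_state : Finite State
  /-- the work alphabet -/
  Symbol : Type
  finite_symbol : Finite Symbol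
  /-- the blank symbol of the work tapes -/
  blank : Symbol
  /-- the number of work tapes -/
  tapes : ℕ
  /-- the initial state -/
  start : State
  /-- `some true` for accepting states, `some false` for rejecting states, and `none` for the
  states in which the computation goes on -/
  verdict : State → Option Bool
  /-- the transition function: state, input symbol, catalytic symbol, work symbols -/
  transition : State → EndSymbol → EndSymbol → (Fin tapes → Symbol) →
    MachineAction State Symbol tapes

/-- Configurations of a catalytic machine. -/
structure MachineConfig (M : CatalyticMachine) where
  /-- the current state -/
  state : M.State
  /-- position of the input head -/
  inputPos : ℕ
  /-- contents of the catalytic tape -/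
  catalytic : List Bool
  /-- position of the catalytic head -/
  catalyticPos : ℕ
  /-- contents of the work tapes -/
  work : Fin M.tapes → ℕ → M.Symbol
  /-- positions of the work heads -/
  workPos : Fin M.tapes → ℕ
  /-- contents of the output tape -/
  output : List Bool

namespace CatalyticMachine

/-- The initial configuration with catalytic tape `τ`: the work tapes are blank. -/
def init (M : CatalyticMachine) (τ : List Bool) : MachineConfig M where
  state := M.start
  inputPos := 0
  catalytic := τ
  catalyticPos := 0
  work := fun _ _ => M.blank
  workPos := fun _ => 0
  output := []

/-- One step on input `x`. The input and catalytic heads cannot move beyond the end markers.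
A halted machine does not change its configuration. -/
def step (M : CatalyticMachine) (x : List Bool) (C : MachineConfig M) : MachineConfig M :=
  match M.verdict C.state with
  | some _ => C
  | none =>
    let a := M.transition C.state (readTape x C.inputPos)
      (readTape C.catalytic C.catalyticPos) (fun j => C.work j (C.workPos j))
    { state := a.next
      inputPos := min (a.moveInput.apply C.inputPos) (x.length + 1)
      catalytic := writeTape C.catalytic a.writeCatalytic C.catalyticPos
      catalyticPos := min (a.moveCatalytic.apply C.catalyticPos) (C.catalytic.length + 1)
      work := fun j => Function.update (C.work j) (C.workPos j) (a.writeWork j)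
      workPos := fun j => (a.moveWork j).apply (C.workPos j)
      output := C.output ++ a.emit.toList }

/-- The configuration after `t` steps on input `x` with initial catalytic tape `τ`. -/
def run (M : CatalyticMachine) (x τ : List Bool) (t : ℕ) : MachineConfig M :=
  (M.step x)^[t] (M.init τ)

end CatalyticMachine

/-- A computational problem `P`: on input `x`, halting with verdict `b` (`true` for accept, `false`
for reject) and output `y` is correct if and only if `P x b y`. -/
abbrev CompProblem := List Bool → Bool → List Bool → Prop

/-- The problems that can be solved with work space `s(n)` and catalytic space `c(n)`: on each input
`x` and each initial catalytic tape `τ` of length `c(|x|)`, the work heads stay within the first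
`s(|x|)` cells of their tapes, and the machine halts with a correct result and with `τ` restored. -/
def CSPACE (s c : ℕ → ℕ) : Set CompProblem :=
  {P | ∃ M : CatalyticMachine, ∀ x τ : List Bool, τ.length = c x.length →
    (∀ t j, (M.run x τ t).workPos j < s x.length) ∧
    ∃ t b, M.verdict (M.run x τ t).state = some b ∧
      P x b (M.run x τ t).output ∧ (M.run x τ t).catalytic = τ}

/-- Catalytic logspace: work space `O(log n)` and catalytic space `n ^ k`. -/
def CL : Set CompProblem :=
  {P | ∃ k : ℕ, P ∈ CSPACE (fun n => k * (Nat.log 2 n + 1)) (fun n => n ^ k)}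

/-- The problem of deciding a language: accept its elements, and reject all other strings. -/
def decisionProblem (A : Language Bool) : CompProblem :=
  fun x b _ => b = true ↔ x ∈ A

/-- The languages decidable in polynomial space by a machine whose catalytic tape has length zero,
i.e. by an ordinary Turing machine. -/
def PSPACE : Set (Language Bool) :=
  {A | ∃ k : ℕ, decisionProblem A ∈ CSPACE (fun n => n ^ k + k) (fun _ => 0)}

/-- Self-delimiting code of a finite sequence of strings: each bit `b` becomes `1b`, and each string
is closed by `00`. -/
def encodeStrings (l : List (List Bool)) : List Bool :=
  l.flatMap fun w => (w.flatMap fun b => [true, b]) ++ [false, false]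

section WitnessRelations

/-- The language of the pairs `(x, y)` with `R(x, y) = 1`. -/
def witnessLanguage (m : ℕ → ℕ) (R : (x : List Bool) → (Fin (m x.length) → Bool) → Prop) :
    Language Bool :=
  {u | ∃ x y, R x y ∧ u = encodeStrings [x, List.ofFn y]}

/-- `W(y)`, the sum of the weights `W(i)` of the positions `i` with `y_i = 1`. -/
def witnessWeight {m : ℕ} (W : Fin m → ℕ) (y : Fin m → Bool) : ℕ :=
  ∑ i, if y i = true then W i else 0

/-- Code of `(x, W)`, with the weights in binary. -/
def encodeSearchInstance (x : List Bool) {m : ℕ} (W : Fin m → ℕ) : List Bool :=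
  encodeStrings (x :: List.ofFn fun i => (W i).bits)

/-- Code of `(x, W, w₀)`, with the numbers in binary. -/
def encodeDecisionInstance (x : List Bool) {m : ℕ} (W : Fin m → ℕ) (w₀ : ℕ) : List Bool :=
  encodeStrings (x :: (List.ofFn fun i => (W i).bits) ++ [w₀.bits])

/-- The weighted decision problem for weights in `[0, m ^ c]`: the triples `(x, W, w₀)` such that
`x` has a witness of weight at most `w₀`. -/
def weightedDecision (m : ℕ → ℕ) (R : (x : List Bool) → (Fin (m x.length) → Bool) → Prop)
    (c : ℕ) : Language Bool :=
  {u | ∃ (x : List Bool) (W : Fin (m x.length) → ℕ) (w₀ : ℕ),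
    u = encodeDecisionInstance x W w₀ ∧ (∀ i, W i ≤ m x.length ^ c) ∧
    ∃ y, R x y ∧ witnessWeight W y ≤ w₀}

/-- `minWeightSearchSet m R x W` is the set of all minimum weight witnesses of `x`. -/
def minWeightSearchSet (m : ℕ → ℕ) (R : (x : List Bool) → (Fin (m x.length) → Bool) → Prop)
    (x : List Bool) (W : Fin (m x.length) → ℕ) : Set (Fin (m x.length) → Bool) :=
  {y | R x y ∧ ∀ z, R x z → witnessWeight W y ≤ witnessWeight W z}

/-- The min-weight search problem for weights in `[0, m ^ c]`: given `(x, W)`, accept with a minimum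
weight witness of `x` as output if `x` has a witness, and reject otherwise. Strings that do not
encode such an instance are rejected. -/
def minWeightSearch (m : ℕ → ℕ) (R : (x : List Bool) → (Fin (m x.length) → Bool) → Prop)
    (c : ℕ) : CompProblem :=
  fun u b out =>
    (b = true ∧ ∃ (x : List Bool) (W : Fin (m x.length) → ℕ),
      u = encodeSearchInstance x W ∧ (∀ i, W i ≤ m x.length ^ c) ∧
      ∃ y ∈ minWeightSearchSet m R x W, out = List.ofFn y) ∨
    (b = false ∧ ¬ ∃ (x : List Bool) (W : Fin (m x.length) → ℕ),
      u = encodeSearchInstance x W ∧ (∀ i, W i ≤ m x.length ^ c) ∧ ∃ y, R x y)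

end WitnessRelations

/-! If the minimizer were unique, its bits could be read off with a decision procedure: the bit at
`i` is 1 exactly when adding 1 to the weight at `i` raises the minimum. The optimum itself is
obtained by counting the thresholds that are refused. The task is therefore to make the minimizer
unique, with logarithmic work space and in a way that can be undone.

Let `M` be the number of weights and `q` the power of two `2 ^ size M`, which exceeds `M`. A stretch
of the catalytic tape is read as `M` numbers below `q`, one slot per position, and the weights
become `W i * (M * q + 1) + v i`, where `v i` is the number in slot `i`. The scale exceeds every sum
of perturbations, so each minimizer of the new weights minimizes `W`
(`minimizers_subset_of_perturbed`). The positions are then visited once. If some minimizer avoids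
`i`, slot `i` is raised by 1: the optimum stays, and exactly the minimizers avoiding `i` survive
(`minimizers_raise`). Otherwise all minimizers contain `i` and nothing is changed. In both cases the
minimizers agree at `i` from then on, so a single one is left at the end (`iterTape_raiseStep`).

No record of the raised positions is kept, since each step can be inverted from its result
(`lowerStep_raiseStep`). Going backwards, one asks whether some minimizer avoids `i` after the
weight at `i` is lowered by 1. If it had been raised, lowering gives back the old weights and the
answer is yes. If not, all minimizers contain `i`; making `i` cheaper cannot change this, and the
answer is no. Overflow of a slot is avoided by a shift `s` modulo `q`, kept on the work tapes, under
which no slot has the value `q - 1`. It exists by the pigeonhole principle because `M < q`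
(`exists_shift`).

For `M ≥ 2` the modified weights stay below `M ^ (c + 5)`, so the decision problem for the exponent
`c + 5` serves as oracle; `M ≤ 1` is treated directly. Queries are never written down, their bits
being recomputed on demand. The oracle machine works on an initial segment of the catalytic tape in
front of the slots and restores it after each query (`exists_oracle`). Its running time plays no
role, only its space does. One query with exponent `c` and a huge threshold tells whether the input
is an instance that has a witness (`valid_iff`).

To obtain an actual machine, the algorithm is expressed by a closure calculus. `LS`, `LSP`, `LSS`,
`LSF` and `Impl` stand for numbers, predicates, strings, finite-valued functions and tape
transformations computable with polynomially bounded registers. Such programs are compiled to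
counters on work tapes (`mem_CSPACE_of_prog`). -/

/-! ### Gadgets: finite control fragments with two exits -/

/-- Work symbols used by gadgets: `none` is blank, `some none` marks the left end of a tape, and
`some (some b)` is a binary digit. -/
abbrev Cell := Option (Option Bool)

/-- A machine configuration without its state. -/
@[ext] structure TapeState (r : ℕ) where
  inputPos : ℕ
  catalytic : List Bool
  catalyticPos : ℕ
  work : Fin r → ℕ → Cell
  workPos : Fin r → ℕ
  output : List Bool

/-- The effect of an action on the tapes. -/
def TapeState.apply {r : ℕ} {σ : Type} (x : List Bool) (a : MachineAction σ Cell r)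
    (c : TapeState r) : TapeState r where
  inputPos := min (a.moveInput.apply c.inputPos) (x.length + 1)
  catalytic := writeTape c.catalytic a.writeCatalytic c.catalyticPos
  catalyticPos := min (a.moveCatalytic.apply c.catalyticPos) (c.catalytic.length + 1)
  work := fun j => Function.update (c.work j) (c.workPos j) (a.writeWork j)
  workPos := fun j => (a.moveWork j).apply (c.workPos j)
  output := c.output ++ a.emit.toList

/-- A fragment of a machine that is left through one of two exits. -/
structure Gadget (r : ℕ) where
  State : Type
  finite_state : Finite State
  start : State
  act : State → EndSymbol → EndSymbol → (Fin r → Cell) → MachineAction (State ⊕ Bool) Cell r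

namespace Gadget

variable {r : ℕ}

def action (G : Gadget r) (x : List Bool) (q : G.State) (c : TapeState r) :
    MachineAction (G.State ⊕ Bool) Cell r :=
  G.act q (readTape x c.inputPos) (readTape c.catalytic c.catalyticPos)
    (fun j => c.work j (c.workPos j))

/-- One step of a gadget, with the work heads within the first `L` cells before the step. -/
def Step (G : Gadget r) (x : List Bool) (L : ℕ) (p p' : (G.State ⊕ Bool) × TapeState r) : Prop :=
  ∃ q, p.1 = Sum.inl q ∧ (∀ j, p.2.workPos j < L) ∧
    p' = ((G.action x q p.2).next, p.2.apply x (G.action x q p.2))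

def Reaches (G : Gadget r) (x : List Bool) (L : ℕ) :
    (G.State ⊕ Bool) × TapeState r → (G.State ⊕ Bool) × TapeState r → Prop :=
  Relation.ReflTransGen (G.Step x L)

def Exits (G : Gadget r) (x : List Bool) (L : ℕ) (c : TapeState r) (b : Bool) (c' : TapeState r) :
    Prop :=
  G.Reaches x L (Sum.inl G.start, c) (Sum.inr b, c')

/-- Gadgets wired together: `next l b` is where the exit `b` of the gadget `l` leads. -/
def flow {Λ : Type} [Finite Λ] (G : Λ → Gadget r) (l₀ : Λ) (next : Λ → Bool → Λ ⊕ Bool) :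
    Gadget r where
  State := Σ l, (G l).State
  finite_state := by
    have := fun l => (G l).finite_state
    infer_instance
  start := ⟨l₀, (G l₀).start⟩
  act := fun q e₁ e₂ w =>
    let a := (G q.1).act q.2 e₁ e₂ w
    { next := a.next.elim (fun q' => Sum.inl ⟨q.1, q'⟩)
        (fun b => (next q.1 b).map (fun l => ⟨l, (G l).start⟩) id)
      moveInput := a.moveInput
      writeCatalytic := a.writeCatalytic
      moveCatalytic := a.moveCatalytic
      writeWork := a.writeWork
      moveWork := a.moveWork
      emit := a.emit }

/-- The exit is redirected inside the very action that takes it. No step is inserted between two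
gadgets, and a run of a component is literally a run of the composite. -/
theorem Exits.flow {Λ : Type} [Finite Λ] {G : Λ → Gadget r} {l₀ : Λ}
    {next : Λ → Bool → Λ ⊕ Bool} {x : List Bool} {L : ℕ} {l : Λ} {c c' : TapeState r} {b : Bool}
    (h : (G l).Exits x L c b c') :
    (flow G l₀ next).Reaches x L (Sum.inl ⟨l, (G l).start⟩, c)
      ((next l b).map (fun l => ⟨l, (G l).start⟩) id, c') := by
  let φ : ((G l).State ⊕ Bool) → ((Gadget.flow G l₀ next).State ⊕ Bool) := fun s =>
    s.elim (fun q' => Sum.inl ⟨l, q'⟩) (fun b => (next l b).map (fun l => ⟨l, (G l).start⟩) id)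
  refine Relation.ReflTransGen.lift (p := (Gadget.flow G l₀ next).Step x L)
    (fun p : ((G l).State ⊕ Bool) × TapeState r => (φ p.1, p.2)) ?_ _ _ h
  rintro ⟨s, c⟩ p' ⟨q, hq, hb, rfl⟩
  obtain rfl : s = Sum.inl q := hq
  exact ⟨⟨l, q⟩, rfl, hb, rfl⟩

/-- A gadget as a machine, whose verdict is the exit taken. -/
def machine (G : Gadget r) : CatalyticMachine where
  State := G.State ⊕ Bool
  finite_state := by
    have := G.finite_state
    infer_instance
  Symbol := Cell
  finite_symbol := inferInstance
  blank := none
  tapes := r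
  start := Sum.inl G.start
  verdict := fun s => s.elim (fun _ => none) some
  transition := fun s e₁ e₂ w => match s with
    | Sum.inl q => G.act q e₁ e₂ w
    | Sum.inr b => ⟨Sum.inr b, .stay, false, .stay, w, fun _ => .stay, none⟩

def config (G : Gadget r) (p : (G.State ⊕ Bool) × TapeState r) : MachineConfig G.machine :=
  ⟨p.1, p.2.inputPos, p.2.catalytic, p.2.catalyticPos, p.2.work, p.2.workPos, p.2.output⟩

theorem step_config_exit (G : Gadget r) (x : List Bool) (b : Bool) (c : TapeState r) :
    G.machine.step x (G.config (Sum.inr b, c)) = G.config (Sum.inr b, c) := rfl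

theorem step_config {G : Gadget r} {x : List Bool} {L : ℕ}
    {p p' : (G.State ⊕ Bool) × TapeState r} (h : G.Step x L p p') :
    G.machine.step x (G.config p) = G.config p' := by
  obtain ⟨s, c⟩ := p
  obtain ⟨q, hq, -, rfl⟩ := h
  obtain rfl : s = Sum.inl q := hq
  rfl

/-- `Step` records the space bound only before each step, so the last configuration needs the
separate hypothesis `hc`. It is a fixed point of the machine, which extends the bound to all times.
-/
theorem Reaches.iterate {G : Gadget r} {x : List Bool} {L : ℕ}
    {p : (G.State ⊕ Bool) × TapeState r} {b : Bool} {c' : TapeState r}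
    (h : G.Reaches x L p (Sum.inr b, c')) (hc : ∀ j, c'.workPos j < L) :
    (∀ t j, ((G.machine.step x)^[t] (G.config p)).workPos j < L) ∧
      ∃ t, (G.machine.step x)^[t] (G.config p) = G.config (Sum.inr b, c') := by
  induction h using Relation.ReflTransGen.head_induction_on with
  | refl =>
    refine ⟨fun t => ?_, 0, rfl⟩
    rw [Function.iterate_fixed (G.step_config_exit x b c')]
    exact hc
  | head h _ ih =>
    refine ⟨fun t => ?_, ?_⟩
    · cases t with
      | zero => exact h.choose_spec.2.1
      | succ t =>
        rw [Function.iterate_succ_apply, step_config h]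
        exact ih.1 t
    · obtain ⟨t, ht⟩ := ih.2
      exact ⟨t + 1, by rw [Function.iterate_succ_apply, step_config h, ht]⟩

end Gadget

/-! ### Binary counters on work tapes -/

/-- Bit under the head, if any. -/
def EndSymbol.toBool : EndSymbol → Bool
  | EndSymbol.bit b => b
  | _ => false

/-- Every action has to write on the catalytic tape. Writing back the bit just read is how an action
leaves the tape alone; at the end markers any write is void. -/
theorem writeTape_readTape (w : List Bool) (p : ℕ) : writeTape w (readTape w p).toBool p = w := by
  cases p with
  | zero => rfl
  | succ i =>
    by_cases h : i < w.length
    · simp [writeTape, readTape, h, EndSymbol.toBool]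
    · simp only [writeTape]
      exact List.set_eq_of_length_le (by omega)

theorem length_writeTape (w : List Bool) (b : Bool) (p : ℕ) :
    (writeTape w b p).length = w.length := by
  cases p <;> simp [writeTape]

namespace TapeState

variable {r : ℕ}

/-- Replace the contents and the head position of one work tape. -/
def setTape (c : TapeState r) (j : Fin r) (t : ℕ → Cell) (p : ℕ) : TapeState r :=
  { c with work := Function.update c.work j t, workPos := Function.update c.workPos j p }

/-- The input and catalytic heads are between the end markers. -/
def Valid (c : TapeState r) (x : List Bool) : Prop :=
  c.inputPos ≤ x.length + 1 ∧ c.catalyticPos ≤ c.catalytic.length + 1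

theorem setTape_self (c : TapeState r) (j : Fin r) :
    c.setTape j (c.work j) (c.workPos j) = c := by
  ext <;> simp [setTape]

end TapeState

namespace Gadget

variable {r : ℕ}

/-- The gadget that runs a one-tape automaton on the work tape `j`. -/
def oneTape {Q : Type} [Finite Q] (j : Fin r) (q₀ : Q) (δ : Q → Cell → (Q ⊕ Bool) × Cell × HeadMove) :
    Gadget r where
  State := Q
  finite_state := inferInstance
  start := q₀
  act := fun q _ e w =>
    { next := (δ q (w j)).1
      moveInput := .stay
      writeCatalytic := e.toBool
      moveCatalytic := .stay
      writeWork := Function.update w j (δ q (w j)).2.1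
      moveWork := Function.update (fun _ => .stay) j (δ q (w j)).2.2
      emit := none }

/-- Steps of a one-tape automaton. -/
def OneStep {Q : Type} (δ : Q → Cell → (Q ⊕ Bool) × Cell × HeadMove) (L : ℕ)
    (p p' : (Q ⊕ Bool) × (ℕ → Cell) × ℕ) : Prop :=
  ∃ q, p.1 = Sum.inl q ∧ p.2.2 < L ∧
    p' = ((δ q (p.2.1 p.2.2)).1, Function.update p.2.1 p.2.2 (δ q (p.2.1 p.2.2)).2.1,
      (δ q (p.2.1 p.2.2)).2.2.apply p.2.2)

/-- `Valid` is needed because even a resting input or catalytic head is clipped to the end markers.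
-/
theorem oneTape_reaches {Q : Type} [Finite Q] {j : Fin r} {q₀ : Q}
    {δ : Q → Cell → (Q ⊕ Bool) × Cell × HeadMove} {x : List Bool} {L : ℕ}
    {p p' : (Q ⊕ Bool) × (ℕ → Cell) × ℕ} {c : TapeState r} (hv : c.Valid x)
    (hL : ∀ i, c.workPos i < L) (h : Relation.ReflTransGen (OneStep δ L) p p') :
    (oneTape j q₀ δ).Reaches x L (p.1, c.setTape j p.2.1 p.2.2)
      (p'.1, c.setTape j p'.2.1 p'.2.2) := by
  refine Relation.ReflTransGen.lift (p := (oneTape j q₀ δ).Step x L)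
    (fun p : (Q ⊕ Bool) × (ℕ → Cell) × ℕ => (p.1, c.setTape j p.2.1 p.2.2)) ?_ _ _ h
  rintro ⟨s, t, p⟩ _ ⟨q, hq, hp, rfl⟩
  obtain rfl : s = Sum.inl q := hq
  refine ⟨q, rfl, ?_, ?_⟩
  · intro i
    by_cases hi : i = j
    · subst hi; simpa [TapeState.setTape] using hp
    · simpa [TapeState.setTape, hi] using hL i
  · refine Prod.ext ?_ ?_
    · simp [action, oneTape, TapeState.setTape]
    · obtain ⟨h1, h2⟩ := hv
      ext1
      · simp [TapeState.apply, action, oneTape, TapeState.setTape, HeadMove.apply, h1]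
      · simp [TapeState.apply, action, oneTape, TapeState.setTape, writeTape_readTape]
      · simp [TapeState.apply, action, oneTape, TapeState.setTape, HeadMove.apply, h2]
      · funext i
        by_cases hi : i = j
        · subst hi; simp [TapeState.apply, action, oneTape, TapeState.setTape]
        · simp [TapeState.apply, action, oneTape, TapeState.setTape, hi]
      · funext i
        by_cases hi : i = j
        · subst hi; simp [TapeState.apply, action, oneTape, TapeState.setTape]
        · simp [TapeState.apply, action, oneTape, TapeState.setTape, hi, HeadMove.apply]
      · simp [TapeState.apply, action, oneTape, TapeState.setTape]

/-- The value of a list of binary digits, least significant digit first. -/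
def digitsValue : List Bool → ℕ
  | [] => 0
  | b :: t => b.toNat + 2 * digitsValue t

/-- A work tape with a mark followed by digits. -/
def counterTape (d : List Bool) : ℕ → Cell
  | 0 => some none
  | i + 1 => d[i]?.map some

theorem update_counterTape (pre t : List Bool) (a b : Bool) :
    Function.update (counterTape (pre ++ a :: t)) (pre.length + 1) (some (some b)) =
      counterTape (pre ++ b :: t) := by
  funext i
  rcases i with _ | i
  · simp [counterTape]
  · rcases lt_trichotomy i pre.length with h | h | h
    · rw [Function.update_of_ne (by omega)]
      simp [counterTape, List.getElem?_append_left h]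
    · subst h; simp [counterTape]
    · rw [Function.update_of_ne (by omega)]
      obtain ⟨k, rfl⟩ := Nat.exists_eq_add_of_lt h
      simp only [counterTape]
      rw [List.getElem?_append_right (by omega), List.getElem?_append_right (by omega)]
      simp [show pre.length + k + 1 - pre.length = k + 1 by omega]

theorem update_counterTape_end (pre : List Bool) (b : Bool) :
    Function.update (counterTape pre) (pre.length + 1) (some (some b)) =
      counterTape (pre ++ [b]) := by
  funext i
  rcases i with _ | i
  · simp [counterTape]
  · rcases lt_trichotomy i pre.length with h | h | h
    · rw [Function.update_of_ne (by omega)]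
      simp [counterTape, List.getElem?_append_left h]
    · subst h; simp [counterTape]
    · rw [Function.update_of_ne (by omega)]
      simp [counterTape, h.le]
      omega

/-- The automaton that goes right over the digits, rewriting each by `f` until `f` gives an answer,
and then returns to the mark. -/
def sweep (f : Option Bool → Option Bool × Option Bool) :
    Option (Option Bool) → Cell → ((Option (Option Bool)) ⊕ Bool) × Cell × HeadMove
  | none, a => (Sum.inl (some none), a, .right)
  | some none, a =>
    let o := f a.join
    match o.2 with
    | none => (Sum.inl (some none), o.1.map some, .right)
    | some b => (Sum.inl (some (some b)), o.1.map some, .left)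
  | some (some b), a =>
    if a = some none then (Sum.inr b, a, .stay) else (Sum.inl (some (some b)), a, .left)

/-- The effect of a sweep on the digits. -/
inductive Sweeps (f : Option Bool → Option Bool × Option Bool) : List Bool → List Bool → Bool → Prop
  | blank {b : Bool} : f none = (none, some b) → Sweeps f [] [] b
  | push {a b : Bool} : f none = (some a, some b) → Sweeps f [] [a] b
  | finish {a a' b : Bool} {t : List Bool} : f (some a) = (some a', some b) →
      Sweeps f (a :: t) (a' :: t) b
  | cont {a a' b : Bool} {t t' : List Bool} : f (some a) = (some a', none) → Sweeps f t t' b →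
      Sweeps f (a :: t) (a' :: t') b

theorem sweep_back (f : Option Bool → Option Bool × Option Bool) (L : ℕ) (d : List Bool) (b : Bool)
    (p : ℕ) (hp : p < L) :
    Relation.ReflTransGen (OneStep (sweep f) L) (Sum.inl (some (some b)), counterTape d, p)
      (Sum.inr b, counterTape d, 0) := by
  induction p with
  | zero =>
    refine Relation.ReflTransGen.single ⟨_, rfl, hp, ?_⟩
    simp [sweep, counterTape, HeadMove.apply]
  | succ p ih =>
    refine Relation.ReflTransGen.head ⟨_, rfl, hp, rfl⟩ ?_
    have : ¬ (counterTape d (p + 1) = some none) := by simp [counterTape]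
    simpa [sweep, this, HeadMove.apply] using ih (by omega)

/-- `pre` holds the digits already passed, which makes the induction go through. The bound on `L`
leaves room for the blank cell after the last digit, where a carry may be written. -/
theorem Sweeps.reaches_aux {f : Option Bool → Option Bool × Option Bool} {d d' : List Bool}
    {b : Bool} (h : Sweeps f d d' b) (L : ℕ) (pre : List Bool)
    (hL : pre.length + d.length + 1 < L) :
    Relation.ReflTransGen (OneStep (sweep f) L)
      (Sum.inl (some none), counterTape (pre ++ d), pre.length + 1)
      (Sum.inr b, counterTape (pre ++ d'), 0) := by
  induction h generalizing pre with
  | @blank b h =>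
    refine Relation.ReflTransGen.head ⟨_, rfl, by simp at *; omega, rfl⟩ ?_
    have e : counterTape (pre ++ []) (pre.length + 1) = none := by simp [counterTape]
    simp only [sweep, e, Option.join_none, h, HeadMove.apply, Option.map_none]
    rw [← e, Function.update_eq_self]
    exact sweep_back f L _ b _ (by omega)
  | @push a b h =>
    refine Relation.ReflTransGen.head ⟨_, rfl, by simp at *; omega, rfl⟩ ?_
    have e : counterTape (pre ++ []) (pre.length + 1) = none := by simp [counterTape]
    simp only [sweep, e, Option.join_none, h, HeadMove.apply, Option.map_some]
    rw [List.append_nil, update_counterTape_end]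
    exact sweep_back f L _ b _ (by omega)
  | @finish a a' b t h =>
    refine Relation.ReflTransGen.head ⟨_, rfl, by simp at *; omega, rfl⟩ ?_
    have e : counterTape (pre ++ a :: t) (pre.length + 1) = some (some a) := by simp [counterTape]
    simp only [sweep, e, Option.join_some, h, HeadMove.apply, Option.map_some]
    rw [update_counterTape]
    exact sweep_back f L _ b _ (by omega)
  | @cont a a' b t t' h _ ih =>
    refine Relation.ReflTransGen.head ⟨_, rfl, by simp at *; omega, rfl⟩ ?_
    have e : counterTape (pre ++ a :: t) (pre.length + 1) = some (some a) := by simp [counterTape]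
    simp only [sweep, e, Option.join_some, h, HeadMove.apply, Option.map_some]
    rw [update_counterTape]
    have := ih (pre ++ [a']) (by simp at *; omega)
    simpa using this

theorem Sweeps.reaches {f : Option Bool → Option Bool × Option Bool} {d d' : List Bool} {b : Bool}
    (h : Sweeps f d d' b) (L : ℕ) (hL : d.length + 1 < L) :
    Relation.ReflTransGen (OneStep (sweep f) L) (Sum.inl none, counterTape d, 0)
      (Sum.inr b, counterTape d', 0) := by
  refine Relation.ReflTransGen.head ⟨_, rfl, by simp at *; omega, rfl⟩ ?_
  have := h.reaches_aux L [] (by simpa using hL)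
  simpa [sweep, HeadMove.apply] using this

/-- The gadget of a sweep on the work tape `j`. -/
def sweepGadget (j : Fin r) (f : Option Bool → Option Bool × Option Bool) : Gadget r :=
  oneTape j none (sweep f)

theorem Sweeps.exits {f : Option Bool → Option Bool × Option Bool} {d d' : List Bool} {b : Bool}
    (h : Sweeps f d d' b) {j : Fin r} {x : List Bool} {L : ℕ} {c : TapeState r} (hv : c.Valid x)
    (hL : d.length + 1 < L) (ht : c.work j = counterTape d) (hp : ∀ i, c.workPos i = 0) :
    (sweepGadget j f).Exits x L c b (c.setTape j (counterTape d') 0) := by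
  have := oneTape_reaches (j := j) (q₀ := none) hv
    (fun i => by rw [hp i]; omega) (h.reaches L hL)
  rwa [← ht, ← hp j, TapeState.setTape_self, hp j] at this

def incDigit : Option Bool → Option Bool × Option Bool
  | some true => (some false, none)
  | _ => (some true, some true)

def decDigit : Option Bool → Option Bool × Option Bool
  | some true => (some false, some true)
  | some false => (some true, none)
  | none => (none, some true)

def testDigit : Option Bool → Option Bool × Option Bool
  | some true => (some true, some true)
  | some false => (some false, none)
  | none => (none, some false)

/-- Leading zeros are allowed, so length and value are only loosely tied. A counter gets longer only
when all its digits are 1, and then the new value is at least `2 ^ d.length`. Hence a bound on the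
values bounds the length. -/
theorem sweeps_inc (d : List Bool) : ∃ d', Sweeps incDigit d d' true ∧
    digitsValue d' = digitsValue d + 1 ∧
    (d'.length = d.length ∨ (d'.length = d.length + 1 ∧ 2 ^ d.length ≤ digitsValue d + 1)) := by
  induction d with
  | nil => exact ⟨[true], .push rfl, rfl, by simp [digitsValue]⟩
  | cons a t ih =>
    cases a with
    | false => exact ⟨true :: t, .finish rfl, by simp [digitsValue]; omega, by simp⟩
    | true =>
      obtain ⟨d', h1, h2, h3⟩ := ih
      refine ⟨false :: d', .cont rfl h1, by simp [digitsValue, h2]; omega, ?_⟩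
      simp only [List.length_cons, digitsValue, pow_succ, Bool.toNat_true]
      omega

theorem sweeps_dec (d : List Bool) (h : 0 < digitsValue d) : ∃ d', Sweeps decDigit d d' true ∧
    digitsValue d' = digitsValue d - 1 ∧ d'.length = d.length := by
  induction d with
  | nil => simp [digitsValue] at h
  | cons a t ih =>
    cases a with
    | true => exact ⟨false :: t, .finish rfl, by simp [digitsValue], by simp⟩
    | false =>
      simp only [digitsValue, Bool.toNat_false] at h ⊢
      obtain ⟨d', h1, h2, h3⟩ := ih (by omega)
      refine ⟨true :: d', .cont rfl h1, by simp [digitsValue, h2]; omega, by simp [h3]⟩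

theorem sweeps_test (d : List Bool) : Sweeps testDigit d d (decide (digitsValue d ≠ 0)) := by
  induction d with
  | nil => exact .blank rfl
  | cons a t ih =>
    cases a with
    | true =>
      have : decide (digitsValue (true :: t) ≠ 0) = true := by simp [digitsValue]
      rw [this]
      exact .finish rfl
    | false =>
      have : decide (digitsValue (false :: t) ≠ 0) = decide (digitsValue t ≠ 0) := by
        simp [digitsValue]
      rw [this]
      exact .cont rfl ih

end Gadget


/-! ### Register programs with bounded registers -/

/-- State of a register program: registers, positions of the input head (`false`) and of the
catalytic head (`true`), catalytic tape and output. -/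
@[ext] structure RegState where
  regs : ℕ → ℕ
  pos : Bool → ℕ
  tape : List Bool
  out : List Bool

/-- The tape under one of the two heads. -/
def RegState.content (x : List Bool) (s : RegState) (h : Bool) : List Bool :=
  if h then s.tape else x

inductive RegOp where
  | inc : ℕ → RegOp
  | dec : ℕ → RegOp
  | move : Bool → HeadMove → RegOp
  | write : Bool → RegOp
  | emit : Bool → RegOp

inductive RegTest where
  | nonzero : ℕ → RegTest
  | sees : Bool → (EndSymbol → Bool) → RegTest

inductive Prog where
  | op : RegOp → Prog
  | seq : Prog → Prog → Prog
  | ite : RegTest → Prog → Prog → Prog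
  | loop : RegTest → Prog → Prog

namespace RegOp

def apply (x : List Bool) (s : RegState) : RegOp → RegState
  | inc i => { s with regs := Function.update s.regs i (s.regs i + 1) }
  | dec i => { s with regs := Function.update s.regs i (s.regs i - 1) }
  | move h d =>
    { s with pos := Function.update s.pos h (min (d.apply (s.pos h)) ((s.content x h).length + 1)) }
  | write b => { s with tape := writeTape s.tape b (s.pos true) }
  | emit b => { s with out := s.out ++ [b] }

/-- Registers stay between `0` and `B`. -/
def Ok (B : ℕ) (s : RegState) : RegOp → Prop
  | inc i => s.regs i + 1 ≤ B
  | dec i => 0 < s.regs i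
  | _ => True

def width : RegOp → ℕ
  | inc i => i + 1
  | dec i => i + 1
  | _ => 0

end RegOp

namespace RegTest

def eval (x : List Bool) (s : RegState) : RegTest → Bool
  | nonzero i => decide (s.regs i ≠ 0)
  | sees h f => f (readTape (s.content x h) (s.pos h))

def width : RegTest → ℕ
  | nonzero i => i + 1
  | sees _ _ => 0

end RegTest

def Prog.width : Prog → ℕ
  | op o => o.width
  | seq p q => max p.width q.width
  | ite t p q => max t.width (max p.width q.width)
  | loop t p => max t.width p.width

/-- `Exec x B p s s'`: on input `x`, the program `p` leads from `s` to `s'` without a register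
exceeding `B`. -/
inductive Exec (x : List Bool) (B : ℕ) : Prog → RegState → RegState → Prop
  | op {o : RegOp} {s : RegState} : o.Ok B s → Exec x B (.op o) s (o.apply x s)
  | seq {p q : Prog} {s₁ s₂ s₃ : RegState} : Exec x B p s₁ s₂ → Exec x B q s₂ s₃ →
      Exec x B (.seq p q) s₁ s₃
  | iteTrue {t : RegTest} {p q : Prog} {s s' : RegState} : t.eval x s = true → Exec x B p s s' →
      Exec x B (.ite t p q) s s'
  | iteFalse {t : RegTest} {p q : Prog} {s s' : RegState} : t.eval x s = false → Exec x B q s s' →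
      Exec x B (.ite t p q) s s'
  | loopFalse {t : RegTest} {p : Prog} {s : RegState} : t.eval x s = false →
      Exec x B (.loop t p) s s
  | loopTrue {t : RegTest} {p : Prog} {s₁ s₂ s₃ : RegState} : t.eval x s₁ = true →
      Exec x B p s₁ s₂ → Exec x B (.loop t p) s₂ s₃ → Exec x B (.loop t p) s₁ s₃

theorem Exec.mono {x : List Bool} {B B' : ℕ} (hB : B ≤ B') {p : Prog} {s s' : RegState}
    (h : Exec x B p s s') : Exec x B' p s s' := by
  induction h with
  | @op o s h => exact .op (by cases o <;> simp only [RegOp.Ok] at * <;> omega)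
  | seq _ _ h1 h2 => exact .seq h1 h2
  | iteTrue h _ h1 => exact .iteTrue h h1
  | iteFalse h _ h1 => exact .iteFalse h h1
  | loopFalse h => exact .loopFalse h
  | loopTrue h _ _ h1 h2 => exact .loopTrue h h1 h2

/-! ### Compiling register programs into gadgets -/

namespace Gadget

variable {r : ℕ}

/-- A gadget that performs a single step on the input, catalytic and output tapes. -/
def single (f : EndSymbol → EndSymbol → Bool) (d₁ d₂ : HeadMove) (w e : Option Bool) :
    Gadget r where
  State := Unit
  finite_state := inferInstance
  start := ()
  act := fun _ a b u => ⟨Sum.inr (f a b), d₁, w.getD b.toBool, d₂, u, fun _ => .stay, e⟩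

theorem single_exits {f : EndSymbol → EndSymbol → Bool} {d₁ d₂ : HeadMove} {w e : Option Bool}
    {x : List Bool} {L : ℕ} {c : TapeState r} (hL : ∀ i, c.workPos i < L) :
    (single f d₁ d₂ w e).Exits x L c
      (f (readTape x c.inputPos) (readTape c.catalytic c.catalyticPos))
      { c with
        inputPos := min (d₁.apply c.inputPos) (x.length + 1)
        catalytic := writeTape c.catalytic
          (w.getD (readTape c.catalytic c.catalyticPos).toBool) c.catalyticPos
        catalyticPos := min (d₂.apply c.catalyticPos) (c.catalytic.length + 1)
        output := c.output ++ e.toList } := by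
  refine Relation.ReflTransGen.single ⟨(), rfl, hL, Prod.ext rfl ?_⟩
  ext1 <;> simp [TapeState.apply, action, single, HeadMove.apply]

def ofOp (r : ℕ) : RegOp → Gadget r
  | .inc i => if h : i < r then sweepGadget ⟨i, h⟩ incDigit else
      single (fun _ _ => true) .stay .stay none none
  | .dec i => if h : i < r then sweepGadget ⟨i, h⟩ decDigit else
      single (fun _ _ => true) .stay .stay none none
  | .move false d => single (fun _ _ => true) d .stay none none
  | .move true d => single (fun _ _ => true) .stay d none none
  | .write b => single (fun _ _ => true) .stay .stay (some b) none
  | .emit b => single (fun _ _ => true) .stay .stay none (some b)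

def ofTest (r : ℕ) : RegTest → Gadget r
  | .nonzero i => if h : i < r then sweepGadget ⟨i, h⟩ testDigit else
      single (fun _ _ => true) .stay .stay none none
  | .sees false f => single (fun a _ => f a) .stay .stay none none
  | .sees true f => single (fun _ a => f a) .stay .stay none none

/-- A tape configuration that represents the state of a register program, with counters of length at
most `L`. -/
structure Rep (x : List Bool) (L : ℕ) (s : RegState) (c : TapeState r) : Prop where
  inputPos : c.inputPos = s.pos false
  catalyticPos : c.catalyticPos = s.pos true
  catalytic : c.catalytic = s.tape
  output : c.output = s.out
  valid : c.Valid x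
  workPos : ∀ i, c.workPos i = 0
  work : ∀ i : Fin r, ∃ d, c.work i = counterTape d ∧ digitsValue d = s.regs i ∧ d.length ≤ L

theorem Rep.setTape {x : List Bool} {L : ℕ} {s : RegState} {c : TapeState r} (h : Rep x L s c)
    (j : Fin r) (d : List Bool) (hd : d.length ≤ L) :
    Rep x L { s with regs := Function.update s.regs j (digitsValue d) }
      (c.setTape j (counterTape d) 0) where
  inputPos := h.inputPos
  catalyticPos := h.catalyticPos
  catalytic := h.catalytic
  output := h.output
  valid := h.valid
  workPos := fun i => by
    by_cases hi : i = j
    · subst hi; simp [TapeState.setTape]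
    · simp [TapeState.setTape, hi, h.workPos]
  work := fun i => by
    by_cases hi : i = j
    · subst hi; exact ⟨d, by simp [TapeState.setTape], by simp, hd⟩
    · have hi' : (i : ℕ) ≠ j := fun e => hi (Fin.ext e)
      simpa [TapeState.setTape, hi, hi'] using h.work i

theorem Rep.ofOp {x : List Bool} {B L : ℕ} {s : RegState} {c : TapeState r} (h : Rep x L s c)
    (hB : B < 2 ^ L) {o : RegOp} (ho : o.Ok B s) (hw : o.width ≤ r) :
    ∃ c', (ofOp r o).Exits x (L + 2) c true c' ∧ Rep x L (o.apply x s) c' := by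
  have hp : ∀ i, c.workPos i < L + 2 := fun i => by rw [h.workPos]; omega
  cases o with
  | inc i =>
    have hi : i < r := hw
    obtain ⟨d, hd, hv, hl⟩ := h.work ⟨i, hi⟩
    obtain ⟨d', h1, h2, h3⟩ := sweeps_inc d
    refine ⟨_, by rw [Gadget.ofOp, dif_pos hi]; exact h1.exits h.valid (by omega) hd h.workPos, ?_⟩
    -- A counter that grows has old length below `L`, because `2 ^ d.length` is at most the new
    -- value, which is at most `B < 2 ^ L`.
    have : d'.length ≤ L := by
      rcases h3 with h3 | ⟨h3, h4⟩
      · omega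
      · have : 2 ^ d.length < 2 ^ L := by
          simp only [RegOp.Ok] at ho
          have : digitsValue d = s.regs i := hv
          omega
        have := (Nat.pow_lt_pow_iff_right (by norm_num : 1 < 2)).1 this
        omega
    have := h.setTape ⟨i, hi⟩ d' this
    rw [h2, hv] at this
    exact this
  | dec i =>
    have hi : i < r := hw
    obtain ⟨d, hd, hv, hl⟩ := h.work ⟨i, hi⟩
    obtain ⟨d', h1, h2, h3⟩ := sweeps_dec d (by rw [hv]; exact ho)
    refine ⟨_, by rw [Gadget.ofOp, dif_pos hi]; exact h1.exits h.valid (by omega) hd h.workPos, ?_⟩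
    have := h.setTape ⟨i, hi⟩ d' (by omega)
    rw [h2, hv] at this
    exact this
  | move b d =>
    obtain ⟨v1, v2⟩ := h.valid
    rw [h.inputPos] at v1
    rw [h.catalyticPos] at v2
    cases b with
    | false =>
      refine ⟨_, single_exits hp, ?_, ?_, ?_, ?_, ⟨?_, ?_⟩, h.workPos, h.work⟩
      · simp [RegOp.apply, RegState.content, h.inputPos]
      · simp [RegOp.apply, HeadMove.apply, v2, h.catalyticPos]
      · simp [RegOp.apply, writeTape_readTape, h.catalytic]
      · simp [RegOp.apply, h.output]
      · exact min_le_right _ _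
      · simp [length_writeTape, HeadMove.apply]
    | true =>
      refine ⟨_, single_exits hp, ?_, ?_, ?_, ?_, ⟨?_, ?_⟩, h.workPos, h.work⟩
      · simp [RegOp.apply, HeadMove.apply, v1, h.inputPos]
      · simp [RegOp.apply, RegState.content, h.catalyticPos, h.catalytic]
      · simp [RegOp.apply, writeTape_readTape, h.catalytic]
      · simp [RegOp.apply, h.output]
      · exact min_le_right _ _
      · simp [length_writeTape]
  | write b =>
    obtain ⟨v1, v2⟩ := h.valid
    rw [h.inputPos] at v1
    rw [h.catalyticPos] at v2
    refine ⟨_, single_exits hp, ?_, ?_, ?_, ?_, ⟨?_, ?_⟩, h.workPos, h.work⟩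
    · simp [RegOp.apply, HeadMove.apply, v1, h.inputPos]
    · simp [RegOp.apply, HeadMove.apply, v2, h.catalyticPos]
    · simp [RegOp.apply, h.catalytic, h.catalyticPos]
    · simp [RegOp.apply, h.output]
    · exact min_le_right _ _
    · simp [length_writeTape]
  | emit b =>
    obtain ⟨v1, v2⟩ := h.valid
    rw [h.inputPos] at v1
    rw [h.catalyticPos] at v2
    refine ⟨_, single_exits hp, ?_, ?_, ?_, ?_, ⟨?_, ?_⟩, h.workPos, h.work⟩
    · simp [RegOp.apply, HeadMove.apply, v1, h.inputPos]
    · simp [RegOp.apply, HeadMove.apply, v2, h.catalyticPos]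
    · simp [RegOp.apply, writeTape_readTape, h.catalytic]
    · simp [RegOp.apply, h.output]
    · exact min_le_right _ _
    · simp [length_writeTape]

theorem Rep.ofTest {x : List Bool} {L : ℕ} {s : RegState} {c : TapeState r} (h : Rep x L s c)
    {t : RegTest} (hw : t.width ≤ r) :
    ∃ c', (ofTest r t).Exits x (L + 2) c (t.eval x s) c' ∧ Rep x L s c' := by
  have hp : ∀ i, c.workPos i < L + 2 := fun i => by rw [h.workPos]; omega
  cases t with
  | nonzero i =>
    have hi : i < r := hw
    obtain ⟨d, hd, hv, hl⟩ := h.work ⟨i, hi⟩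
    refine ⟨c.setTape ⟨i, hi⟩ (counterTape d) 0, ?_, ?_⟩
    · have := (sweeps_test d).exits h.valid (show d.length + 1 < L + 2 by omega) hd h.workPos
      rw [Gadget.ofTest, dif_pos hi]
      rw [hv] at this
      exact this
    · have := h.setTape ⟨i, hi⟩ d hl
      simpa [hv] using this
  | sees b f =>
    obtain ⟨v1, v2⟩ := h.valid
    have key : ({ c with
        inputPos := min (HeadMove.stay.apply c.inputPos) (x.length + 1)
        catalytic := writeTape c.catalytic
          ((none : Option Bool).getD (readTape c.catalytic c.catalyticPos).toBool) c.catalyticPos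
        catalyticPos := min (HeadMove.stay.apply c.catalyticPos) (c.catalytic.length + 1)
        output := c.output ++ (none : Option Bool).toList } : TapeState r) = c := by
      ext1 <;> simp [HeadMove.apply, v1, v2, writeTape_readTape]
    cases b with
    | false =>
      have := single_exits (f := fun a _ => f a) (d₁ := .stay) (d₂ := .stay) (w := none) (e := none)
        (x := x) hp
      rw [key, h.inputPos] at this
      exact ⟨c, this, h⟩
    | true =>
      have := single_exits (f := fun _ a => f a) (d₁ := .stay) (d₂ := .stay) (w := none) (e := none)
        (x := x) hp
      rw [key, h.catalytic, h.catalyticPos] at this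
      exact ⟨c, this, h⟩

/-- The gadget of a program; the exit `true` is taken. -/
def ofProg (r : ℕ) : Prog → Gadget r
  | .op o => ofOp r o
  | .seq p q => flow (fun l : Bool => if l then ofProg r p else ofProg r q) true
      (fun l b => if l then Sum.inl false else Sum.inr b)
  | .ite t p q => flow
      (fun l : Option Bool => l.elim (ofTest r t) fun b => if b then ofProg r p else ofProg r q) none
      (fun l b => if l = none then Sum.inl (some b) else Sum.inr b)
  | .loop t p => flow (fun l : Bool => if l then ofTest r t else ofProg r p) true
      (fun l b => if l then (if b then Sum.inl false else Sum.inr true) else Sum.inl true)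

/-- The induction is over the execution and not over the program, so loops need no termination
measure. `L + 2` cells suffice for the mark, `L` digits and the blank cell that ends a sweep. -/
theorem Rep.ofProg {x : List Bool} {B L : ℕ} (hB : B < 2 ^ L) {p : Prog} {s s' : RegState}
    (he : Exec x B p s s') (hw : p.width ≤ r) {c : TapeState r} (h : Rep x L s c) :
    ∃ c', (ofProg r p).Exits x (L + 2) c true c' ∧ Rep x L s' c' := by
  induction he generalizing c with
  | op ho => exact h.ofOp hB ho hw
  | @seq p q s₁ s₂ s₃ _ _ ih1 ih2 =>
    obtain ⟨c1, e1, r1⟩ := ih1 (le_trans (le_max_left _ _) hw) h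
    obtain ⟨c2, e2, r2⟩ := ih2 (le_trans (le_max_right _ _) hw) r1
    let G := fun l : Bool => if l then Gadget.ofProg r p else Gadget.ofProg r q
    let N : Bool → Bool → Bool ⊕ Bool := fun l b => if l then Sum.inl false else Sum.inr b
    exact ⟨c2, (Exits.flow (G := G) (next := N) (l := true) e1).trans
      (Exits.flow (G := G) (l := false) e2), r2⟩
  | @iteTrue t p q s s' ht _ ih =>
    simp only [Prog.width, max_le_iff] at hw
    obtain ⟨c1, e1, r1⟩ := h.ofTest hw.1
    obtain ⟨c2, e2, r2⟩ := ih hw.2.1 r1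
    rw [ht] at e1
    let G := fun l : Option Bool =>
      l.elim (Gadget.ofTest r t) fun b => if b then Gadget.ofProg r p else Gadget.ofProg r q
    let N : Option Bool → Bool → Option Bool ⊕ Bool :=
      fun l b => if l = none then Sum.inl (some b) else Sum.inr b
    exact ⟨c2, (Exits.flow (G := G) (next := N) (l := none) e1).trans
      (Exits.flow (G := G) (l := some true) e2), r2⟩
  | @iteFalse t p q s s' ht _ ih =>
    simp only [Prog.width, max_le_iff] at hw
    obtain ⟨c1, e1, r1⟩ := h.ofTest hw.1
    obtain ⟨c2, e2, r2⟩ := ih hw.2.2 r1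
    rw [ht] at e1
    let G := fun l : Option Bool =>
      l.elim (Gadget.ofTest r t) fun b => if b then Gadget.ofProg r p else Gadget.ofProg r q
    let N : Option Bool → Bool → Option Bool ⊕ Bool :=
      fun l b => if l = none then Sum.inl (some b) else Sum.inr b
    exact ⟨c2, (Exits.flow (G := G) (next := N) (l := none) e1).trans
      (Exits.flow (G := G) (l := some false) e2), r2⟩
  | @loopFalse t p s ht =>
    simp only [Prog.width, max_le_iff] at hw
    obtain ⟨c1, e1, r1⟩ := h.ofTest hw.1
    rw [ht] at e1
    let G := fun l : Bool => if l then Gadget.ofTest r t else Gadget.ofProg r p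
    exact ⟨c1, Exits.flow (G := G) (l := true) e1, r1⟩
  | @loopTrue t p s₁ s₂ s₃ ht _ _ ih1 ih2 =>
    have hw' := hw
    simp only [Prog.width, max_le_iff] at hw
    obtain ⟨c1, e1, r1⟩ := h.ofTest hw.1
    obtain ⟨c2, e2, r2⟩ := ih1 hw.2 r1
    obtain ⟨c3, e3, r3⟩ := ih2 hw' r2
    rw [ht] at e1
    let G := fun l : Bool => if l then Gadget.ofTest r t else Gadget.ofProg r p
    let N : Bool → Bool → Bool ⊕ Bool :=
      fun l b => if l then (if b then Sum.inl false else Sum.inr true) else Sum.inl true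
    exact ⟨c3, ((Exits.flow (G := G) (next := N) (l := true) e1).trans
      (Exits.flow (G := G) (l := false) e2)).trans e3, r3⟩

/-- Write the left end marks of the work tapes. -/
def mark (r : ℕ) : Gadget r where
  State := Unit
  finite_state := inferInstance
  start := ()
  act := fun _ _ b _ => ⟨Sum.inr true, .stay, b.toBool, .stay, fun _ => some none, fun _ => .stay, none⟩

theorem mark_exits (x τ : List Bool) (L : ℕ) :
    ∃ c, (mark r).Exits x (L + 2) ⟨0, τ, 0, fun _ _ => none, fun _ => 0, []⟩ true c ∧
      Rep x L ⟨fun _ => 0, fun _ => 0, τ, []⟩ c := by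
  refine ⟨_, Relation.ReflTransGen.single ⟨(), rfl, fun _ => by simp, rfl⟩, ?_⟩
  constructor
  · simp [TapeState.apply, action, mark, HeadMove.apply]
  · simp [TapeState.apply, action, mark, HeadMove.apply]
  · exact writeTape_readTape τ 0
  · simp [TapeState.apply, action, mark]
  · constructor <;> simp [TapeState.apply, action, mark, HeadMove.apply]
  · simp [TapeState.apply, action, mark, HeadMove.apply]
  · refine fun i => ⟨[], ?_, rfl, by simp⟩
    funext k
    cases k <;> simp [TapeState.apply, action, mark, counterTape]

/-- The machine of a program whose verdict is given by the register `v`. -/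
def ofProgram (r : ℕ) (p : Prog) (v : ℕ) : Gadget r :=
  flow (fun l : Fin 3 => if l = 0 then mark r else if l = 1 then ofProg r p else
      ofTest r (.nonzero v)) 0
    (fun l b => if l = 0 then Sum.inl 1 else if l = 1 then Sum.inl 2 else Sum.inr b)

theorem ofProgram_exits {x τ : List Bool} {B L : ℕ} (hB : B < 2 ^ L) {p : Prog} {s' : RegState}
    {v : ℕ} (he : Exec x B p ⟨fun _ => 0, fun _ => 0, τ, []⟩ s') (hw : p.width ≤ r) (hv : v < r) :
    ∃ c, (ofProgram r p v).Exits x (L + 2) ⟨0, τ, 0, fun _ _ => none, fun _ => 0, []⟩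
      (decide (s'.regs v ≠ 0)) c ∧ Rep x L s' c := by
  obtain ⟨c1, e1, r1⟩ := mark_exits (r := r) x τ L
  obtain ⟨c2, e2, r2⟩ := r1.ofProg hB he hw
  obtain ⟨c3, e3, r3⟩ := r2.ofTest (t := .nonzero v) hv
  let G := fun l : Fin 3 => if l = 0 then mark r else if l = 1 then Gadget.ofProg r p else
      Gadget.ofTest r (.nonzero v)
  let N : Fin 3 → Bool → Fin 3 ⊕ Bool :=
    fun l b => if l = 0 then Sum.inl 1 else if l = 1 then Sum.inl 2 else Sum.inr b
  exact ⟨c3, ((Exits.flow (G := G) (next := N) (l := 0) e1).trans (Exits.flow (G := G) (l := 1) e2)).trans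
    (Exits.flow (G := G) (l := 2) e3), r3⟩

end Gadget

/-- A register program that solves a problem within polynomially bounded registers, leaving the
catalytic tape as it was, gives a machine. -/
theorem mem_CSPACE_of_prog {P : CompProblem} {p : Prog} {v : ℕ} {B L c : ℕ → ℕ}
    (hB : ∀ n, B n < 2 ^ L n)
    (h : ∀ x τ : List Bool, τ.length = c x.length → ∃ s',
      Exec x (B x.length) p ⟨fun _ => 0, fun _ => 0, τ, []⟩ s' ∧ s'.tape = τ ∧
        P x (decide (s'.regs v ≠ 0)) s'.out) :
    P ∈ CSPACE (fun n => L n + 2) c := by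
  let r := max p.width (v + 1)
  refine ⟨(Gadget.ofProgram r p v).machine, fun x τ hτ => ?_⟩
  obtain ⟨s', he, ht, hP⟩ := h x τ hτ
  obtain ⟨c, hc, hr⟩ := Gadget.ofProgram_exits (r := r) (hB x.length) he (le_max_left _ _)
    (show v + 1 ≤ r from le_max_right _ _)
  obtain ⟨h1, t, h2⟩ := Gadget.Reaches.iterate hc (fun j => by rw [hr.workPos]; omega)
  refine ⟨h1, t, decide (s'.regs v ≠ 0), ?_⟩
  have h2' : (Gadget.ofProgram r p v).machine.run x τ t = _ := h2
  rw [h2']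
  refine ⟨rfl, ?_, ?_⟩
  · change P x _ c.output
    rw [hr.output]; exact hP
  · exact hr.catalytic.trans ht


/-! ### Elementary programs -/

/-- Contents of the catalytic tape and of the output tape. -/
@[ext] structure Mem where
  tape : List Bool
  out : List Bool

def RegState.mem (s : RegState) : Mem := ⟨s.tape, s.out⟩

/-- Replace the contents of a register. -/
def RegState.setReg (s : RegState) (i v : ℕ) : RegState :=
  { s with regs := Function.update s.regs i v }

@[simp] theorem RegState.setReg_regs (s : RegState) (i v : ℕ) :
    (s.setReg i v).regs = Function.update s.regs i v := rfl

@[simp] theorem RegState.setReg_pos (s : RegState) (i v : ℕ) : (s.setReg i v).pos = s.pos := rfl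

@[simp] theorem RegState.setReg_tape (s : RegState) (i v : ℕ) : (s.setReg i v).tape = s.tape := rfl

@[simp] theorem RegState.setReg_out (s : RegState) (i v : ℕ) : (s.setReg i v).out = s.out := rfl

@[simp] theorem RegState.setReg_mem (s : RegState) (i v : ℕ) : (s.setReg i v).mem = s.mem := rfl

@[simp] theorem RegState.setReg_content (x : List Bool) (s : RegState) (i v : ℕ) (h : Bool) :
    (s.setReg i v).content x h = s.content x h := rfl

namespace Prog

def skip : Prog := .loop (.sees false fun _ => false) (.op (.emit false))

theorem exec_skip (x : List Bool) (B : ℕ) (s : RegState) : Exec x B skip s s := .loopFalse rfl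

def clear (i : ℕ) : Prog := .loop (.nonzero i) (.op (.dec i))

theorem exec_clear (x : List Bool) (B : ℕ) (i : ℕ) (s : RegState) :
    Exec x B (clear i) s (s.setReg i 0) := by
  obtain ⟨v, hv⟩ : ∃ v, v = s.regs i := ⟨_, rfl⟩
  induction v generalizing s with
  | zero =>
    have : s.setReg i 0 = s := by
      ext1 <;> simp [hv]
    rw [this]
    exact .loopFalse (by simp [RegTest.eval, ← hv])
  | succ v ih =>
    refine .loopTrue (by simp [RegTest.eval, ← hv]) (.op (by simp [RegOp.Ok, ← hv])) ?_
    have := ih (RegOp.apply x s (.dec i)) (by simp [RegOp.apply, ← hv])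
    simpa [RegOp.apply, RegState.setReg, clear] using this

/-- Add the register `src` to the register `dst`, clearing `src`. -/
def pour (dst src : ℕ) : Prog := .loop (.nonzero src) (.seq (.op (.dec src)) (.op (.inc dst)))

theorem exec_pour (x : List Bool) (B : ℕ) {dst src : ℕ} (hne : dst ≠ src) (s : RegState)
    (hB : s.regs dst + s.regs src ≤ B) :
    Exec x B (pour dst src) s ((s.setReg dst (s.regs dst + s.regs src)).setReg src 0) := by
  obtain ⟨v, hv⟩ : ∃ v, v = s.regs src := ⟨_, rfl⟩
  induction v generalizing s with
  | zero =>
    have : (s.setReg dst (s.regs dst + s.regs src)).setReg src 0 = s := by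
      ext1 <;> simp [← hv]
    rw [this]
    exact .loopFalse (by simp [RegTest.eval, ← hv])
  | succ v ih =>
    refine .loopTrue (by simp [RegTest.eval, ← hv]) (.seq (.op (by simp [RegOp.Ok, ← hv]))
      (.op (?_ : RegOp.Ok B (RegOp.apply x s (.dec src)) (.inc dst)))) ?_
    · simp [RegOp.Ok, RegOp.apply, hne]; omega
    · have := ih (RegOp.apply x (RegOp.apply x s (.dec src)) (.inc dst))
        (by simp [RegOp.apply, hne, hne.symm]; omega) (by simp [RegOp.apply, hne.symm, ← hv])
      change Exec x B (pour dst src) _ _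
      convert this using 1
      ext1
      · funext k
        by_cases h1 : k = src
        · subst h1; simp
        · by_cases h2 : k = dst
          · subst h2; simp [RegOp.apply, hne, hne.symm]; omega
          · simp [RegOp.apply, h1, h2]
      all_goals rfl

/-- Move the register `src` to the register `dst`. -/
def move (dst src : ℕ) : Prog := .seq (clear dst) (pour dst src)

theorem exec_move (x : List Bool) (B : ℕ) {dst src : ℕ} (hne : dst ≠ src) (s : RegState)
    (hB : s.regs src ≤ B) :
    Exec x B (move dst src) s ((s.setReg dst (s.regs src)).setReg src 0) := by
  refine .seq (exec_clear x B dst s) ?_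
  have := exec_pour x B hne (s.setReg dst 0) (by simpa [hne.symm] using hB)
  simpa [hne.symm, RegState.setReg] using this

/-- Copy the register `src` to the register `dst`, with the help of the register `tmp`. -/
def copy (dst src tmp : ℕ) : Prog :=
  .seq (clear dst) (.seq (clear tmp) (.seq (.loop (.nonzero src)
    (.seq (.op (.dec src)) (.seq (.op (.inc dst)) (.op (.inc tmp))))) (pour src tmp)))

theorem exec_copy_loop (x : List Bool) (B : ℕ) {dst src tmp : ℕ} (h1 : dst ≠ src) (h2 : tmp ≠ src)
    (h3 : dst ≠ tmp) (s : RegState) (hB1 : s.regs dst + s.regs src ≤ B)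
    (hB2 : s.regs tmp + s.regs src ≤ B) :
    Exec x B (.loop (.nonzero src)
      (.seq (.op (.dec src)) (.seq (.op (.inc dst)) (.op (.inc tmp))))) s
      (((s.setReg dst (s.regs dst + s.regs src)).setReg tmp (s.regs tmp + s.regs src)).setReg
        src 0) := by
  obtain ⟨v, hv⟩ : ∃ v, v = s.regs src := ⟨_, rfl⟩
  induction v generalizing s with
  | zero =>
    have : ((s.setReg dst (s.regs dst + s.regs src)).setReg tmp
        (s.regs tmp + s.regs src)).setReg src 0 = s := by
      ext1 <;> simp [← hv]
    rw [this]
    exact .loopFalse (by simp [RegTest.eval, ← hv])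
  | succ v ih =>
    refine .loopTrue (by simp [RegTest.eval, ← hv]) (.seq (.op (by simp [RegOp.Ok, ← hv]))
      (.seq (.op (?_ : RegOp.Ok B (RegOp.apply x s (.dec src)) (.inc dst)))
      (.op (?_ : RegOp.Ok B (RegOp.apply x (RegOp.apply x s (.dec src)) (.inc dst)) (.inc tmp))))) ?_
    · simp [RegOp.Ok, RegOp.apply, h1]; omega
    · simp [RegOp.Ok, RegOp.apply, h2, h3.symm]; omega
    · have := ih (RegOp.apply x (RegOp.apply x (RegOp.apply x s (.dec src)) (.inc dst)) (.inc tmp))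
        (by simp [RegOp.apply, h1, h1.symm, h2.symm, h3]; omega)
        (by simp [RegOp.apply, h2, h1.symm, h2.symm, h3.symm]; omega)
        (by simp [RegOp.apply, h1.symm, h2.symm, ← hv])
      convert this using 1
      ext1
      · funext k
        by_cases k1 : k = src
        · subst k1; simp
        · by_cases k2 : k = dst
          · subst k2; simp [RegOp.apply, h1, h1.symm, h2.symm, h3]; omega
          · by_cases k3 : k = tmp
            · subst k3; simp [RegOp.apply, h2, h1.symm, h2.symm, h3.symm]; omega
            · simp [RegOp.apply, k1, k2, k3]
      all_goals rfl

theorem exec_copy (x : List Bool) (B : ℕ) {dst src tmp : ℕ} (h1 : dst ≠ src) (h2 : tmp ≠ src)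
    (h3 : dst ≠ tmp) (s : RegState) (hB : s.regs src ≤ B) :
    Exec x B (copy dst src tmp) s ((s.setReg dst (s.regs src)).setReg tmp 0) := by
  refine .seq (exec_clear x B dst s) (.seq (exec_clear x B tmp _)
    (.seq (exec_copy_loop x B h1 h2 h3 _ ?_ ?_) ?_))
  · simpa [h1.symm, h2.symm, h3] using hB
  · simpa [h1.symm, h2.symm, h3] using hB
  · have hs := exec_pour x B h2.symm (((((s.setReg dst 0).setReg tmp 0).setReg dst
      (((s.setReg dst 0).setReg tmp 0).regs dst + ((s.setReg dst 0).setReg tmp 0).regs src)).setReg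
      tmp (((s.setReg dst 0).setReg tmp 0).regs tmp +
      ((s.setReg dst 0).setReg tmp 0).regs src)).setReg src 0)
      (by simpa [h1, h2, h1.symm, h2.symm, h3] using hB)
    convert hs using 1
    · ext1
      · funext k
        by_cases k1 : k = src
        · subst k1; simp [h1, h1.symm, h2.symm, h2, h3]
        · by_cases k2 : k = dst
          · subst k2; simp [h1, h1.symm, h2.symm, h3]
          · by_cases k3 : k = tmp
            · subst k3; simp
            · simp [k1, k2, k3]
      all_goals rfl

/-- Put a head at the position given by a register, clearing the register. -/
def seek (h : Bool) (i : ℕ) : Prog :=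
  .seq (.loop (.sees h fun e => match e with | .left => false | _ => true) (.op (.move h .left)))
    (.loop (.nonzero i) (.seq (.op (.dec i)) (.op (.move h .right))))

theorem exec_rewind (x : List Bool) (B : ℕ) (h : Bool) (s : RegState) :
    Exec x B (.loop (.sees h fun e => match e with | .left => false | _ => true)
      (.op (.move h .left))) s { s with pos := Function.update s.pos h 0 } := by
  obtain ⟨v, hv⟩ : ∃ v, v = s.pos h := ⟨_, rfl⟩
  induction v using Nat.strong_induction_on generalizing s with
  | _ v ih =>
    rcases v with _ | v
    · have : ({ s with pos := Function.update s.pos h 0 } : RegState) = s := by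
        ext1 <;> simp [hv]
      rw [this]
      exact .loopFalse (by simp [RegTest.eval, ← hv, readTape])
    · refine .loopTrue ?_ (.op trivial) ?_
      · simp only [RegTest.eval, ← hv, readTape]
        split_ifs <;> rfl
      · have := ih (min (HeadMove.left.apply (s.pos h)) ((s.content x h).length + 1))
          (by simp [HeadMove.apply, ← hv]) (RegOp.apply x s (.move h .left)) (by simp [RegOp.apply])
        simpa [RegOp.apply] using this

theorem exec_advance (x : List Bool) (B : ℕ) (h : Bool) (i : ℕ) (s : RegState)
    (hp : s.pos h ≤ (s.content x h).length + 1) :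
    Exec x B (.loop (.nonzero i) (.seq (.op (.dec i)) (.op (.move h .right)))) s
      { s with
        regs := Function.update s.regs i 0
        pos := Function.update s.pos h (min (s.pos h + s.regs i) ((s.content x h).length + 1)) } := by
  obtain ⟨v, hv⟩ : ∃ v, v = s.regs i := ⟨_, rfl⟩
  induction v generalizing s with
  | zero =>
    rw [← hv, add_zero, min_eq_left hp]
    have : ({ s with regs := Function.update s.regs i 0,
                     pos := Function.update s.pos h (s.pos h) } : RegState) = s := by
      ext1 <;> simp [hv]
    rw [this]
    exact .loopFalse (by simp [RegTest.eval, ← hv])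
  | succ v ih =>
    refine .loopTrue (by simp [RegTest.eval, ← hv]) (.seq (.op (by simp [RegOp.Ok, ← hv]))
      (.op trivial)) ?_
    have hc : (RegOp.apply x (RegOp.apply x s (.dec i)) (.move h .right)).content x h =
        s.content x h := rfl
    have hc' : (RegOp.apply x s (.dec i)).content x h = s.content x h := rfl
    have := ih (RegOp.apply x (RegOp.apply x s (.dec i)) (.move h .right))
      (by
        rw [hc, ← hc']
        simp only [RegOp.apply, Function.update_self]
        exact min_le_right _ _)
      (by simp [RegOp.apply, ← hv])
    rw [hc] at this
    convert this using 1
    ext1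
    · funext k
      by_cases h1 : k = i
      · subst h1; simp
      · simp [RegOp.apply, h1]
    · funext k
      by_cases h1 : k = h
      · subst h1
        simp only [RegOp.apply, HeadMove.apply, Function.update_self, ← hv] at hc' ⊢
        rw [hc']
        omega
      · simp [RegOp.apply, h1]
    all_goals rfl

theorem exec_seek (x : List Bool) (B : ℕ) (h : Bool) (i : ℕ) (s : RegState) :
    Exec x B (seek h i) s
      { s with
        regs := Function.update s.regs i 0
        pos := Function.update s.pos h (min (s.regs i) ((s.content x h).length + 1)) } := by
  refine .seq (exec_rewind x B h s) ?_
  have := exec_advance x B h i { s with pos := Function.update s.pos h 0 } (by simp)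
  simpa [RegState.content] using this

end Prog


/-! ### Computations in a context of polynomially bounded variables -/

/-- A context: an input, the writable tapes, and a fixed number of variables. -/
class Ctx (α : Type) where
  inp : α → List Bool
  mem : α → Mem
  setMem : α → Mem → α
  dim : ℕ
  reg : α → ℕ → ℕ
  size : α → ℕ
  inp_setMem : ∀ a m, inp (setMem a m) = inp a
  mem_setMem : ∀ a m, mem (setMem a m) = m
  reg_setMem : ∀ a m i, reg (setMem a m) i = reg a i
  size_setMem : ∀ a m, size (setMem a m) = size a
  setMem_mem : ∀ a, setMem a (mem a) = a
  setMem_setMem : ∀ a m m', setMem (setMem a m) m' = setMem a m'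
  two_le_size : ∀ a, 2 ≤ size a
  inp_le_size : ∀ a, (inp a).length ≤ size a
  reg_le_size : ∀ a i, i < dim → reg a i ≤ size a

/-- The context without variables. -/
structure Env where
  inp : List Bool
  mem : Mem

instance : Ctx Env where
  inp e := e.inp
  mem e := e.mem
  setMem e m := ⟨e.inp, m⟩
  dim := 0
  reg _ _ := 0
  size e := e.inp.length + 2
  inp_setMem _ _ := rfl
  mem_setMem _ _ := rfl
  reg_setMem _ _ _ := rfl
  size_setMem _ _ := rfl
  setMem_mem _ := rfl
  setMem_setMem _ _ _ := rfl
  two_le_size _ := by omega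
  inp_le_size _ := by omega
  reg_le_size _ _ h := by omega

section Contexts

variable {α β : Type} [Ctx α] [Ctx β]

open Ctx

/-- The new variable counts towards the size. A bound polynomial in the extended context is then
polynomial in the old one as soon as the value of the variable is. -/
instance : Ctx (α × ℕ) where
  inp a := inp a.1
  mem a := mem a.1
  setMem a m := (setMem a.1 m, a.2)
  dim := dim α + 1
  reg a i := if i < dim α then reg a.1 i else a.2
  size a := size a.1 + a.2
  inp_setMem _ _ := inp_setMem _ _
  mem_setMem _ _ := mem_setMem _ _
  reg_setMem _ _ _ := by simp [reg_setMem]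
  size_setMem _ _ := by simp [size_setMem]
  setMem_mem _ := by simp [setMem_mem]
  setMem_setMem _ _ _ := by simp [setMem_setMem]
  two_le_size a := (two_le_size a.1).trans (by omega)
  inp_le_size a := (inp_le_size a.1).trans (by omega)
  reg_le_size a i h := by
    split_ifs with hi
    · exact (reg_le_size a.1 i hi).trans (by omega)
    · omega

@[simp] theorem inp_prod (a : α) (v : ℕ) : inp (a, v) = inp a := rfl
@[simp] theorem mem_prod (a : α) (v : ℕ) : mem (a, v) = mem a := rfl
@[simp] theorem setMem_prod (a : α) (v : ℕ) (m : Mem) : setMem (a, v) m = (setMem a m, v) := rfl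
@[simp] theorem size_prod (a : α) (v : ℕ) : size (a, v) = size a + v := rfl
attribute [simp] inp_setMem mem_setMem reg_setMem size_setMem setMem_mem setMem_setMem

/-- Bounded by a power of the size of the context. -/
def PolyBdd (f : α → ℕ) : Prop := ∃ k, ∀ a, f a ≤ size a ^ k

theorem PolyBdd.mono {f g : α → ℕ} (hg : PolyBdd g) (h : ∀ a, f a ≤ g a) : PolyBdd f :=
  hg.imp fun _ hk a => (h a).trans (hk a)

theorem polyBdd_size : PolyBdd (fun a : α => size a) := ⟨1, fun a => by simp⟩

theorem polyBdd_const (c : ℕ) : PolyBdd (fun _ : α => c) :=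
  ⟨c, fun a => (Nat.lt_two_pow_self (n := c)).le.trans (Nat.pow_le_pow_left (two_le_size a) c)⟩

/-- One more factor of the size absorbs the sum because sizes are at least 2, which is the purpose
of `two_le_size`. -/
theorem PolyBdd.add {f g : α → ℕ} (hf : PolyBdd f) (hg : PolyBdd g) :
    PolyBdd (fun a => f a + g a) := by
  obtain ⟨k, hk⟩ := hf
  obtain ⟨l, hl⟩ := hg
  refine ⟨max k l + 1, fun a => ?_⟩
  have h2 := two_le_size a
  have h1 : f a ≤ size a ^ max k l :=
    (hk a).trans (Nat.pow_le_pow_right (by omega) (le_max_left _ _))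
  have h3 : g a ≤ size a ^ max k l :=
    (hl a).trans (Nat.pow_le_pow_right (by omega) (le_max_right _ _))
  rw [pow_succ]
  nlinarith [Nat.mul_le_mul_left (size a ^ max k l) h2]

theorem PolyBdd.mul {f g : α → ℕ} (hf : PolyBdd f) (hg : PolyBdd g) :
    PolyBdd (fun a => f a * g a) := by
  obtain ⟨k, hk⟩ := hf
  obtain ⟨l, hl⟩ := hg
  exact ⟨k + l, fun a => by rw [pow_add]; exact Nat.mul_le_mul (hk a) (hl a)⟩

theorem PolyBdd.pow {f : α → ℕ} (hf : PolyBdd f) (c : ℕ) : PolyBdd (fun a => f a ^ c) := by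
  obtain ⟨k, hk⟩ := hf
  exact ⟨k * c, fun a => by rw [pow_mul]; exact Nat.pow_le_pow_left (hk a) c⟩

theorem PolyBdd.comp {f : β → ℕ} (hf : PolyBdd f) {T : α → β} (hT : PolyBdd fun a => size (T a)) :
    PolyBdd (fun a => f (T a)) := by
  obtain ⟨k, hk⟩ := hf
  exact (hT.pow k).mono fun a => hk (T a)

/-- The registers `loc i` hold the variables of the context, and the tapes are as in the context. -/
def Holds (a : α) (loc : ℕ → ℕ) (s : RegState) : Prop :=
  s.mem = mem a ∧ ∀ i < dim α, s.regs (loc i) = reg a i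

/-- The program leads to the tapes and the value `r`, which is put into the register `b`, and keeps
the registers below `b`. -/
def Runs (p : Prog) (x : List Bool) (B b : ℕ) (s : RegState) (r : Mem × ℕ) : Prop :=
  ∃ s', Exec x B p s s' ∧ (∀ i < b, s'.regs i = s.regs i) ∧ s'.mem = r.1 ∧ s'.regs b = r.2

/-- `F` is computed, with its effect on the tapes, by programs with polynomially bounded registers,
wherever the variables are and wherever the result has to be put. -/
def Impl (F : α → Mem × ℕ) : Prop :=
  ∃ B : α → ℕ, PolyBdd B ∧ (∀ a, (F a).2 ≤ B a) ∧ ∀ (loc : ℕ → ℕ) (b : ℕ),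
    (∀ i < dim α, loc i < b) → ∃ p, ∀ a s, Holds a loc s → Runs p (inp a) (B a) b s (F a)

/-- Functions computed without a net effect on the tapes. -/
def LS (f : α → ℕ) : Prop := Impl fun a => (mem a, f a)

/-- Transformations of the variables computed without a net effect on the tapes. -/
def CMap (T : α → β) : Prop :=
  (∀ a, inp (T a) = inp a ∧ mem (T a) = mem a) ∧
  ∃ B : α → ℕ, PolyBdd B ∧ (∀ a, size (T a) ≤ B a) ∧ ∀ (loc : ℕ → ℕ) (b : ℕ),
    (∀ i < dim α, loc i < b) → ∃ (loc' : ℕ → ℕ) (b' : ℕ), b < b' ∧ (∀ i < dim β, loc' i < b') ∧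
      ∃ p, ∀ a s, Holds a loc s → ∃ s', Exec (inp a) (B a) p s s' ∧
        (∀ i < b, s'.regs i = s.regs i) ∧ Holds (T a) loc' s'

theorem LS.polyBdd {f : α → ℕ} (hf : LS f) : PolyBdd f := by
  obtain ⟨B, hB, h, -⟩ := hf
  exact hB.mono h

theorem Impl.congr {F G : α → Mem × ℕ} (hF : Impl F) (h : ∀ a, G a = F a) : Impl G := by
  rwa [show G = F from funext h]

theorem LS.congr {f g : α → ℕ} (hf : LS f) (h : ∀ a, g a = f a) : LS g := by
  rwa [show g = f from funext h]

theorem Holds.of_agree {a : α} {loc : ℕ → ℕ} {s s' : RegState} {b : ℕ} (h : Holds a loc s)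
    (hl : ∀ i < dim α, loc i < b) (hr : ∀ i < b, s'.regs i = s.regs i) (m : Mem)
    (hm : s'.mem = m) : Holds (setMem a m) loc s' :=
  ⟨by simpa using hm, fun i hi => by rw [hr _ (hl i hi), h.2 i hi, reg_setMem]⟩

theorem Holds.of_agree' {a : α} {loc : ℕ → ℕ} {s s' : RegState} {b : ℕ} (h : Holds a loc s)
    (hl : ∀ i < dim α, loc i < b) (hr : ∀ i < b, s'.regs i = s.regs i)
    (hm : s'.mem = mem a) : Holds a loc s' :=
  ⟨hm, fun i hi => by rw [hr _ (hl i hi), h.2 i hi]⟩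

/-- Locations of the variables after a new variable is added. -/
def snocLoc (d : ℕ) (loc : ℕ → ℕ) (b : ℕ) : ℕ → ℕ := fun i => if i < d then loc i else b

theorem Holds.snoc {a : α} {loc : ℕ → ℕ} {s : RegState} (h : Holds a loc s) {b v : ℕ}
    (hb : s.regs b = v) : Holds (a, v) (snocLoc (dim α) loc b) s := by
  refine ⟨h.1, fun i hi => ?_⟩
  by_cases hd : i < dim α
  · simpa [snocLoc, hd, reg] using h.2 i hd
  · simpa [snocLoc, hd, reg] using hb

theorem snocLoc_lt {loc : ℕ → ℕ} {b c : ℕ} (hl : ∀ i < dim α, loc i < b) (hb : b ≤ c) :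
    ∀ i < dim (α × ℕ), snocLoc (dim α) loc c i < c + 1 := by
  intro i _
  unfold snocLoc
  split_ifs with h
  · have := hl i h; omega
  · omega

theorem Runs.of_move {p : Prog} {x : List Bool} {B b c : ℕ} {s s' : RegState} {r : Mem × ℕ}
    (e : Exec x B p s s') (k : ∀ i < b, s'.regs i = s.regs i) (hm : s'.mem = r.1)
    (hv : s'.regs c = r.2) (hbc : b < c) (hr : r.2 ≤ B) : Runs (.seq p (.move b c)) x B b s r := by
  refine ⟨_, .seq e (Prog.exec_move x B (by omega) s' (by omega)), ?_, by simpa using hm, ?_⟩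
  · intro i hi
    rw [← k i hi]
    simp [show i ≠ c by omega, show i ≠ b by omega]
  · simp [show b ≠ c by omega, hv]

theorem Runs.mono {p : Prog} {x : List Bool} {B B' b : ℕ} {s : RegState} {r : Mem × ℕ}
    (h : Runs p x B b s r) (hB : B ≤ B') : Runs p x B' b s r := by
  obtain ⟨s1, e1, h1⟩ := h
  exact ⟨s1, e1.mono hB, h1⟩

/-- Compute a value and use it as a new variable. -/
theorem Impl.bind {F : α → Mem × ℕ} {G : α × ℕ → Mem × ℕ} (hF : Impl F) (hG : Impl G) :
    Impl (fun a => G (setMem a (F a).1, (F a).2)) := by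
  obtain ⟨B1, p1, r1, h1⟩ := hF
  obtain ⟨B2, p2, r2, h2⟩ := hG
  refine ⟨fun a => B1 a + B2 (setMem a (F a).1, (F a).2), p1.add (p2.comp ?_), ?_, ?_⟩
  · refine (polyBdd_size.add p1).mono fun a => ?_
    simpa using r1 a
  · exact fun a => (r2 _).trans (Nat.le_add_left _ _)
  · intro loc b hl
    -- Register `b` is kept free for the final result. The intermediate value lives in `b + 1`, and
    -- the value of `G` is produced in `b + 2`.
    obtain ⟨q1, h1⟩ := h1 loc (b + 1) (fun i hi => (hl i hi).trans (by omega))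
    obtain ⟨q2, h2⟩ := h2 (snocLoc (dim α) loc (b + 1)) (b + 2) (snocLoc_lt hl (by omega))
    refine ⟨.seq (.seq q1 q2) (.move b (b + 2)), fun a s hs => ?_⟩
    obtain ⟨s1, e1, k1, m1, v1⟩ := h1 a s hs
    obtain ⟨s2, e2, k2, m2, v2⟩ := h2 (setMem a (F a).1, (F a).2) s1
      ((hs.of_agree hl (fun i hi => k1 i (by omega)) _ m1).snoc v1)
    simp only [inp_prod, inp_setMem] at e2
    exact Runs.of_move (.seq (e1.mono (Nat.le_add_right _ _)) (e2.mono (Nat.le_add_left _ _)))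
      (fun i hi => by rw [k2 i (by omega), k1 i (by omega)]) m2 v2 (by omega)
      ((r2 _).trans (Nat.le_add_left _ _))

theorem CMap.id : CMap (fun a : α => a) :=
  ⟨fun _ => ⟨rfl, rfl⟩, fun a => size a, polyBdd_size, fun _ => le_rfl, fun loc b hl =>
    ⟨loc, b + 1, by omega, fun i hi => (hl i hi).trans (by omega), .skip, fun a s hs =>
      ⟨s, Prog.exec_skip _ _ s, fun _ _ => rfl, hs⟩⟩⟩

theorem CMap.wk {T : α → β} (hT : CMap T) : CMap (fun x : α × ℕ => T x.1) := by
  obtain ⟨h1, B, hB, r, h⟩ := hT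
  refine ⟨fun x => h1 x.1, fun x => B x.1, hB.comp (polyBdd_size.mono fun x => ?_),
    fun x => r x.1, fun loc b hl => ?_⟩
  · show size x.1 ≤ size x.1 + x.2
    omega
  · obtain ⟨loc', b', hb, hl', p, hp⟩ := h loc b (fun i hi => hl i (Nat.lt_succ_of_lt hi))
    refine ⟨loc', b', hb, hl', p, fun a s hs => hp a.1 s ⟨hs.1, fun i hi => ?_⟩⟩
    have := hs.2 i (Nat.lt_succ_of_lt hi)
    rw [this]
    simp [reg, hi]

theorem CMap.pair {T : α → β} {f : α → ℕ} (hT : CMap T) (hf : LS f) :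
    CMap (fun a => (T a, f a)) := by
  obtain ⟨h1, B1, p1, r1, q1⟩ := hT
  obtain ⟨B2, p2, r2, q2⟩ := hf
  refine ⟨fun a => h1 a, fun a => B1 a + B2 a, p1.add p2, fun a => ?_, fun loc b hl => ?_⟩
  · exact Nat.add_le_add (r1 a) (r2 a)
  · obtain ⟨loc', b', hb, hl', p, hp⟩ := q1 loc b hl
    obtain ⟨q, hq⟩ := q2 loc b' (fun i hi => (hl i hi).trans hb)
    refine ⟨snocLoc (dim β) loc' b', b' + 1, by omega, snocLoc_lt hl' le_rfl, .seq p q,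
      fun a s hs => ?_⟩
    obtain ⟨s1, e1, k1, m1⟩ := hp a s hs
    have hm1 : s1.mem = mem a := m1.1.trans (h1 a).2
    obtain ⟨s2, e2, k2, m2, v2⟩ := hq a s1 (hs.of_agree' hl k1 hm1)
    refine ⟨s2, .seq (e1.mono (Nat.le_add_right _ _)) (e2.mono (Nat.le_add_left _ _)), fun i hi => ?_, ?_⟩
    · rw [k2 i (by omega), k1 i hi]
    · exact (m1.of_agree' hl' k2 (m2.trans (h1 a).2.symm)).snoc v2

/-- Variables are addressed by their place in a nested pair, so forgetting, reordering and
recomputing them are all instances of this substitution. -/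
theorem Impl.comp {F : β → Mem × ℕ} {T : α → β} (hF : Impl F) (hT : CMap T) :
    Impl (fun a => F (T a)) := by
  obtain ⟨h1, B1, p1, r1, q1⟩ := hT
  obtain ⟨B2, p2, r2, q2⟩ := hF
  refine ⟨fun a => B1 a + B2 (T a), p1.add (p2.comp (p1.mono r1)), fun a => ?_, fun loc b hl => ?_⟩
  · exact (r2 _).trans (Nat.le_add_left _ _)
  · obtain ⟨loc', b', hb, hl', p, hp⟩ := q1 loc b hl
    obtain ⟨q, hq⟩ := q2 loc' b' hl'
    refine ⟨.seq (.seq p q) (.move b b'), fun a s hs => ?_⟩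
    obtain ⟨s1, e1, k1, m1⟩ := hp a s hs
    obtain ⟨s2, e2, k2, m2, v2⟩ := hq (T a) s1 m1
    rw [(h1 a).1] at e2
    exact Runs.of_move (.seq (e1.mono (Nat.le_add_right _ _)) (e2.mono (Nat.le_add_left _ _)))
      (fun i hi => by rw [k2 i (by omega), k1 i hi]) m2 v2 hb
      ((r2 _).trans (Nat.le_add_left _ _))

theorem LS.comp {f : β → ℕ} {T : α → β} (hf : LS f) (hT : CMap T) : LS (fun a => f (T a)) :=
  (Impl.comp hf hT).congr fun a => by rw [(hT.1 a).2]

theorem LS.wk {f : α → ℕ} (hf : LS f) : LS (fun x : α × ℕ => f x.1) := LS.comp hf CMap.id.wk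

theorem Impl.wk {F : α → Mem × ℕ} (hF : Impl F) : Impl (fun x : α × ℕ => F x.1) :=
  Impl.comp hF CMap.id.wk

end Contexts


/-! ### Variables, branching, and access to the tapes -/

section Primitives

variable {α β : Type} [Ctx α] [Ctx β]

open Ctx

theorem Holds.top {a : α} {v : ℕ} {loc : ℕ → ℕ} {s : RegState} (h : Holds (a, v) loc s) :
    s.regs (loc (dim α)) = v := by
  have := h.2 (dim α) (Nat.lt_succ_self _)
  simpa [reg] using this

theorem Holds.init {a : α} {v : ℕ} {loc : ℕ → ℕ} {s : RegState} (h : Holds (a, v) loc s) :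
    Holds a loc s := by
  refine ⟨h.1, fun i hi => ?_⟩
  have := h.2 i (Nat.lt_succ_of_lt hi)
  simpa [reg, hi] using this

theorem LS.var : LS (fun x : α × ℕ => x.2) := by
  refine ⟨fun x => size x, polyBdd_size, fun x => Nat.le_add_left _ _, fun loc b hl => ?_⟩
  have hd : loc (dim α) < b := hl _ (Nat.lt_succ_self _)
  refine ⟨.copy b (loc (dim α)) (b + 1), fun x s hs => ?_⟩
  refine ⟨_, Prog.exec_copy _ _ (by omega) (by omega) (by omega) s ?_, ?_, hs.1, ?_⟩
  · rw [hs.top]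
    exact Nat.le_add_left _ _
  · intro i hi
    simp [show i ≠ b by omega, show i ≠ b + 1 by omega]
  · simp [hs.top]

theorem LS.bind {f : α → ℕ} {G : α × ℕ → Mem × ℕ} (hf : LS f) (hG : Impl G) :
    Impl (fun a => G (a, f a)) :=
  (Impl.bind hf hG).congr fun a => by simp

theorem LS.bind' {f : α → ℕ} {g : α × ℕ → ℕ} (hf : LS f) (hg : LS g) : LS (fun a => g (a, f a)) :=
  LS.bind hf hg

theorem LS.zero : LS (fun _ : α => 0) := by
  refine ⟨fun _ => 0, polyBdd_const 0, fun x => le_rfl, fun loc b hl => ?_⟩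
  refine ⟨.clear b, fun x s hs => ⟨_, Prog.exec_clear _ _ _ _, fun i hi => ?_, hs.1, by simp⟩⟩
  simp [show i ≠ b by omega]

theorem LS.succ {f : α → ℕ} (hf : LS f) : LS (fun a => f a + 1) := by
  refine LS.bind' (g := fun x => x.2 + 1) hf ?_
  obtain ⟨B, hB, r, h⟩ := LS.var (α := α)
  refine ⟨fun x => B x + 1, hB.add (polyBdd_const 1), fun x => Nat.add_le_add_right (r x) 1,
    fun loc b hl => ?_⟩
  obtain ⟨p, hp⟩ := h loc b hl
  refine ⟨.seq p (.op (.inc b)), fun x s hs => ?_⟩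
  obtain ⟨s1, e1, k1, m1, v1⟩ := hp x s hs
  refine ⟨_, .seq (e1.mono (Nat.le_add_right _ _)) (.op ?_), fun i hi => ?_, m1, ?_⟩
  · simp only [RegOp.Ok, v1]
    exact Nat.add_le_add_right (r x) 1
  · rw [← k1 i hi]
    simp [RegOp.apply, show i ≠ b by omega]
  · simp [RegOp.apply, v1]

theorem LS.pred {f : α → ℕ} (hf : LS f) : LS (fun a => f a - 1) := by
  refine LS.bind' (g := fun x => x.2 - 1) hf ?_
  obtain ⟨B, hB, r, h⟩ := LS.var (α := α)
  refine ⟨B, hB, fun x => (Nat.sub_le _ _).trans (r x), fun loc b hl => ?_⟩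
  obtain ⟨p, hp⟩ := h loc b hl
  refine ⟨.seq p (.ite (.nonzero b) (.op (.dec b)) .skip), fun x s hs => ?_⟩
  obtain ⟨s1, e1, k1, m1, v1⟩ := hp x s hs
  by_cases h0 : x.2 = 0
  · refine ⟨s1, .seq e1 (.iteFalse ?_ (Prog.exec_skip _ _ _)), k1, m1, ?_⟩
    · simp [RegTest.eval, v1, h0]
    · simp [v1, h0]
  · refine ⟨_, .seq e1 (.iteTrue ?_ (.op ?_)), fun i hi => ?_, m1, ?_⟩
    · simp [RegTest.eval, v1, h0]
    · simp only [RegOp.Ok, v1]; omega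
    · rw [← k1 i hi]
      simp [RegOp.apply, show i ≠ b by omega]
    · simp [RegOp.apply, v1]

theorem LS.const (c : ℕ) : LS (fun _ : α => c) := by
  induction c with
  | zero => exact LS.zero
  | succ c ih => exact ih.succ

theorem Impl.ite {F G : α → Mem × ℕ} {c : α → ℕ} (hc : LS c) (hF : Impl F) (hG : Impl G) :
    Impl (fun a => if c a ≠ 0 then F a else G a) := by
  obtain ⟨B1, p1, r1, h1⟩ := hc
  obtain ⟨B2, p2, r2, h2⟩ := hF
  obtain ⟨B3, p3, r3, h3⟩ := hG
  refine ⟨fun a => B1 a + (B2 a + B3 a), p1.add (p2.add p3), fun a => ?_, fun loc b hl => ?_⟩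
  · have := r2 a
    have := r3 a
    dsimp only
    split_ifs <;> omega
  · obtain ⟨q1, h1⟩ := h1 loc b hl
    obtain ⟨q2, h2⟩ := h2 loc b hl
    obtain ⟨q3, h3⟩ := h3 loc b hl
    refine ⟨.seq q1 (.ite (.nonzero b) q2 q3), fun a s hs => ?_⟩
    obtain ⟨s1, e1, k1, m1, v1⟩ := h1 a s hs
    have hs1 := hs.of_agree' hl k1 m1
    by_cases h0 : c a ≠ 0
    · obtain ⟨s2, e2, k2, m2, v2⟩ := h2 a s1 hs1
      refine ⟨s2, .seq (e1.mono (Nat.le_add_right _ _)) (.iteTrue ?_ (e2.mono ((Nat.le_add_right _ _).trans (Nat.le_add_left _ _)))),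
        fun i hi => by rw [k2 i hi, k1 i hi], ?_, ?_⟩
      · simp [RegTest.eval, v1, h0]
      · simpa [h0] using m2
      · simpa [h0] using v2
    · obtain ⟨s2, e2, k2, m2, v2⟩ := h3 a s1 hs1
      refine ⟨s2, .seq (e1.mono (Nat.le_add_right _ _)) (.iteFalse ?_ (e2.mono ((Nat.le_add_left _ _).trans (Nat.le_add_left _ _)))),
        fun i hi => by rw [k2 i hi, k1 i hi], ?_, ?_⟩
      · simpa [RegTest.eval, v1] using h0
      · simpa [h0] using m2
      · simpa [h0] using v2

theorem LS.ite {f g c : α → ℕ} (hc : LS c) (hf : LS f) (hg : LS g) :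
    LS (fun a => if c a ≠ 0 then f a else g a) :=
  (Impl.ite hc hf hg).congr fun a => by by_cases h : c a = 0 <;> simp [h]

/-- The tape under one of the two heads. -/
def Ctx.content (a : α) (h : Bool) : List Bool := if h then (mem a).tape else inp a

theorem Holds.content_eq {a : α} {loc : ℕ → ℕ} {s : RegState} (h : Holds a loc s) (b : Bool) :
    s.content (inp a) b = content a b := by
  have := congrArg Mem.tape h.1
  simp only [RegState.mem] at this
  simp [RegState.content, Ctx.content, this]

/-- A head sent beyond the right end marker is stopped there, where it sees the same symbol. The
address of a cell therefore needs no range check. -/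
theorem readTape_min (w : List Bool) (p : ℕ) : readTape w (min (p + 1) (w.length + 1)) =
    readTape w (p + 1) := by
  by_cases h : p < w.length
  · rw [min_eq_left (by omega)]
  · rw [min_eq_right (by omega)]
    simp [readTape, h]

theorem writeTape_min (w : List Bool) (b : Bool) (p : ℕ) :
    writeTape w b (min (p + 1) (w.length + 1)) = writeTape w b (p + 1) := by
  by_cases h : p < w.length
  · rw [min_eq_left (by omega)]
  · rw [min_eq_right (by omega)]
    simp only [writeTape]
    rw [List.set_eq_of_length_le le_rfl, List.set_eq_of_length_le (by omega)]

/-- Put a head at the cell whose index is in the register `v`, and clear the register `b`. -/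
def Prog.seekCell (h : Bool) (v b : ℕ) : Prog :=
  .seq (.copy (b + 1) v (b + 2)) (.seq (.op (.inc (b + 1))) (.seq (.seek h (b + 1)) (.clear b)))

theorem Holds.exec_seek {α : Type} [Ctx α] {a : α} {v : ℕ} {loc : ℕ → ℕ} {s : RegState}
    (hs : Holds (a, v) loc s) {b : ℕ} (hl : ∀ i < dim (α × ℕ), loc i < b) (h : Bool) :
    ∃ s', Exec (inp a) (size (a, v) + 1) (.seekCell h (loc (dim α)) b) s s' ∧
      (∀ i < b, s'.regs i = s.regs i) ∧ s'.regs b = 0 ∧ s'.mem = s.mem ∧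
      s'.pos h = min (v + 1) ((content a h).length + 1) := by
  have hd : loc (dim α) < b := hl _ (Nat.lt_succ_self _)
  refine ⟨_, .seq (Prog.exec_copy _ _ (by omega) (by omega) (by omega) s ?_) (.seq (.op ?_)
    (.seq (Prog.exec_seek _ _ _ _ _) (Prog.exec_clear _ _ _ _))), fun i hi => ?_, ?_, rfl, ?_⟩
  · rw [hs.top, size_prod]; omega
  · simp [RegOp.Ok, hs.top]
  · simp [show i ≠ b by omega, show i ≠ b + 1 by omega, show i ≠ b + 2 by omega, RegOp.apply]
  · simp
  · have : ∀ s' : RegState, s'.tape = s.tape → s'.content (inp a) h = content a h := by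
      intro s' h'
      rw [← hs.init.content_eq h]
      simp [RegState.content, h']
    simp only [RegState.setReg_pos, Function.update_self]
    rw [this (RegOp.apply (inp a) ((s.setReg (b + 1) (s.regs (loc (dim α)))).setReg (b + 2) 0)
      (RegOp.inc (b + 1))) rfl]
    simp [RegOp.apply, hs.top]

theorem LS.read (h : Bool) (f : EndSymbol → Bool) :
    LS (fun x : α × ℕ => if f (readTape (content x.1 h) (x.2 + 1)) then 1 else 0) := by
  refine ⟨fun x => size x + 1, polyBdd_size.add (polyBdd_const 1), fun x => ?_, fun loc b hl => ?_⟩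
  · dsimp only
    split_ifs <;> omega
  · refine ⟨.seq (.seekCell h (loc (dim α)) b) (.ite (.sees h f) (.op (.inc b)) .skip), fun x s hs => ?_⟩
    obtain ⟨s1, e1, k1, z1, m1, v1⟩ := hs.exec_seek hl h
    have ht : (RegTest.sees h f).eval (inp x.1) s1 = f (readTape (content x.1 h) (x.2 + 1)) := by
      have : s1.content (inp x.1) h = content x.1 h := by
        rw [← hs.init.content_eq h]
        have := congrArg Mem.tape m1
        simp only [RegState.mem] at this
        simp [RegState.content, this]
      rw [RegTest.eval, v1, this, readTape_min]
    by_cases hf : f (readTape (content x.1 h) (x.2 + 1)) = true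
    · refine ⟨_, .seq e1 (.iteTrue (ht.trans hf) (.op ?_)), fun i hi => ?_, m1.trans hs.1, ?_⟩
      · simp [RegOp.Ok, z1]
      · rw [← k1 i hi]
        simp [RegOp.apply, show i ≠ b by omega]
      · simp [RegOp.apply, z1, hf]
    · refine ⟨_, .seq e1 (.iteFalse ?_ (Prog.exec_skip _ _ _)), k1, m1.trans hs.1, ?_⟩
      · exact ht.trans (by simpa using hf)
      · simp [z1, hf]

theorem Impl.write_aux : Impl (fun x : (α × ℕ) × ℕ =>
    ((⟨writeTape (mem x).tape (decide (x.1.2 ≠ 0)) (x.2 + 1), (mem x).out⟩ : Mem), 0)) := by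
  refine ⟨fun x => size x + 1, polyBdd_size.add (polyBdd_const 1), fun x => Nat.zero_le _,
    fun loc b hl => ?_⟩
  refine ⟨.seq (.seekCell true (loc (dim (α × ℕ))) b) (.ite (.nonzero (loc (dim α))) (.op (.write true)) (.op (.write false))),
    fun x s hs => ?_⟩
  obtain ⟨s1, e1, k1, z1, m1, v1⟩ := hs.exec_seek hl true
  have hv : s1.regs (loc (dim α)) = x.1.2 := by
    rw [k1 _ (hl _ (Nat.lt_succ_of_lt (Nat.lt_succ_self _))), hs.init.top]
  have hm : s1.mem = mem x.1 := m1.trans hs.1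
  have ht : s1.tape = (mem x.1).tape := congrArg Mem.tape hm
  have ho : s1.out = (mem x.1).out := congrArg Mem.out hm
  have hw : ∀ c, writeTape s1.tape c (s1.pos true) = writeTape (mem x.1).tape c (x.2 + 1) := by
    intro c
    rw [v1, ht]
    exact writeTape_min _ _ _
  by_cases h0 : x.1.2 = 0
  · refine ⟨_, .seq e1 (.iteFalse ?_ (.op trivial)), k1, ?_, z1⟩
    · simp [RegTest.eval, hv, h0]
    · simp only [RegOp.apply, RegState.mem, hw, ho, h0]
      rfl
  · refine ⟨_, .seq e1 (.iteTrue ?_ (.op trivial)), k1, ?_, z1⟩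
    · simp [RegTest.eval, hv, h0]
    · simp only [RegOp.apply, RegState.mem, hw, ho]
      simp [h0]
      constructor <;> rfl

/-- Write a bit on the catalytic tape. -/
theorem Impl.write {f g : α → ℕ} (hf : LS f) (hg : LS g) : Impl (fun a =>
    ((⟨(mem a).tape.set (f a) (decide (g a ≠ 0)), (mem a).out⟩ : Mem), 0)) :=
  LS.bind hg (LS.bind hf.wk Impl.write_aux)

/-- Emit a bit. -/
theorem Impl.emit {g : α → ℕ} (hg : LS g) : Impl (fun a =>
    ((⟨(mem a).tape, (mem a).out ++ [decide (g a ≠ 0)]⟩ : Mem), 0)) := by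
  refine LS.bind (G := fun x => (⟨(mem x).tape, (mem x).out ++ [decide (x.2 ≠ 0)]⟩, 0)) hg ?_
  refine ⟨fun x => 0, polyBdd_const 0, fun x => Nat.zero_le _, fun loc b hl => ?_⟩
  refine ⟨.seq (.clear b) (.ite (.nonzero (loc (dim α))) (.op (.emit true)) (.op (.emit false))),
    fun x s hs => ?_⟩
  have hd : loc (dim α) < b := hl _ (Nat.lt_succ_self _)
  have ht : s.tape = (mem x).tape := congrArg Mem.tape hs.1
  have ho : s.out = (mem x).out := congrArg Mem.out hs.1
  by_cases h0 : x.2 = 0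
  · refine ⟨_, .seq (Prog.exec_clear _ _ _ _) (.iteFalse ?_ (.op trivial)), fun i hi => ?_, ?_, ?_⟩
    · simp [RegTest.eval, hs.top, h0, show loc (dim α) ≠ b by omega]
    · simp [RegOp.apply, show i ≠ b by omega]
    · simp [RegOp.apply, RegState.mem, ht, ho, h0]
    · simp [RegOp.apply]
  · refine ⟨_, .seq (Prog.exec_clear _ _ _ _) (.iteTrue ?_ (.op trivial)), fun i hi => ?_, ?_, ?_⟩
    · simp [RegTest.eval, hs.top, h0, show loc (dim α) ≠ b by omega]
    · simp [RegOp.apply, show i ≠ b by omega]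
    · simp [RegOp.apply, RegState.mem, ht, ho, h0]
    · simp [RegOp.apply]

end Primitives


/-! ### Loops and bounded recursion -/

section Loops

variable {α : Type} [Ctx α]

open Ctx

/-- The context of a loop body, with two loop variables. -/
def loopCtx (a : α) (σ : Mem × ℕ × ℕ) : (α × ℕ) × ℕ := ((setMem a σ.1, σ.2.1), σ.2.2)

@[simp] theorem inp_loopCtx (a : α) (σ : Mem × ℕ × ℕ) : inp (loopCtx a σ) = inp a := by
  simp [loopCtx]

@[simp] theorem mem_loopCtx (a : α) (σ : Mem × ℕ × ℕ) : mem (loopCtx a σ) = σ.1 := by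
  simp [loopCtx]

/-- One round of a loop. -/
def loopStep (G : (α × ℕ) × ℕ → Mem × ℕ) (e : (α × ℕ) × ℕ → ℕ) (a : α) (σ : Mem × ℕ × ℕ) :
    Mem × ℕ × ℕ :=
  ((G (loopCtx a σ)).1, (G (loopCtx a σ)).2, e (loopCtx a σ))

/-- The state after `j` rounds of a loop. -/
def loopState (G : (α × ℕ) × ℕ → Mem × ℕ) (e : (α × ℕ) × ℕ → ℕ) (f g : α → ℕ) (a : α) (j : ℕ) :
    Mem × ℕ × ℕ :=
  (loopStep G e a)^[j] (mem a, f a, g a)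

theorem loopState_succ (G : (α × ℕ) × ℕ → Mem × ℕ) (e : (α × ℕ) × ℕ → ℕ) (f g : α → ℕ) (a : α)
    (j : ℕ) : loopState G e f g a (j + 1) = loopStep G e a (loopState G e f g a j) :=
  Function.iterate_succ_apply' _ _ _

/-- The number of rounds `N` is neither computed nor bounded; only the two loop variables have to
stay polynomial. This matters for the simulation of catalytic machines, whose running time is not
controlled. -/
theorem Impl.while {G : (α × ℕ) × ℕ → Mem × ℕ} {e h : (α × ℕ) × ℕ → ℕ} {f g : α → ℕ}
    (hG : Impl G) (he : LS e) (hh : LS h) (hf : LS f) (hg : LS g) (N C : α → ℕ) (hC : PolyBdd C)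
    (h1 : ∀ a, ∀ j < N a, h (loopCtx a (loopState G e f g a j)) ≠ 0)
    (h0 : ∀ a, h (loopCtx a (loopState G e f g a (N a))) = 0)
    (hb : ∀ a, ∀ j ≤ N a, (loopState G e f g a j).2.1 ≤ C a ∧ (loopState G e f g a j).2.2 ≤ C a) :
    Impl (fun a => ((loopState G e f g a (N a)).1, (loopState G e f g a (N a)).2.1)) := by
  obtain ⟨BG, ⟨kG, pG⟩, rG, qG⟩ := hG
  obtain ⟨Be, ⟨ke, pe⟩, re, qe⟩ := he
  obtain ⟨Bh, ⟨kh, ph⟩, rh, qh⟩ := hh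
  obtain ⟨Bf, pf, rf, qf⟩ := hf
  obtain ⟨Bg, pg, rg, qg⟩ := hg
  have pS : PolyBdd (fun a => size a + C a + C a) := (polyBdd_size.add hC).add hC
  obtain ⟨B, hB⟩ : ∃ B : α → ℕ, B = fun a => Bf a + (Bg a + (C a + ((size a + C a + C a) ^ kG +
    ((size a + C a + C a) ^ ke + (size a + C a + C a) ^ kh)))) := ⟨_, rfl⟩
  have hS : ∀ a, ∀ j ≤ N a, size (loopCtx a (loopState G e f g a j)) ≤ size a + C a + C a := by
    intro a j hj
    have := hb a j hj
    simp only [loopCtx, size_prod, size_setMem]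
    omega
  have bG : ∀ a, ∀ j ≤ N a, BG (loopCtx a (loopState G e f g a j)) ≤ B a := fun a j hj =>
    ((pG _).trans (Nat.pow_le_pow_left (hS a j hj) kG)).trans (by simp only [hB]; omega)
  have be : ∀ a, ∀ j ≤ N a, Be (loopCtx a (loopState G e f g a j)) ≤ B a := fun a j hj =>
    ((pe _).trans (Nat.pow_le_pow_left (hS a j hj) ke)).trans (by simp only [hB]; omega)
  have bh : ∀ a, ∀ j ≤ N a, Bh (loopCtx a (loopState G e f g a j)) ≤ B a := fun a j hj =>
    ((ph _).trans (Nat.pow_le_pow_left (hS a j hj) kh)).trans (by simp only [hB]; omega)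
  have bC : ∀ a, C a ≤ B a := fun a => by simp only [hB]; omega
  have bf : ∀ a, Bf a ≤ B a := fun a => by simp only [hB]; omega
  have bg : ∀ a, Bg a ≤ B a := fun a => by simp only [hB]; omega
  refine ⟨B, ?_, fun a => (hb a _ le_rfl).1.trans (bC a), fun loc b hl => ?_⟩
  · rw [hB]
    exact pf.add (pg.add (hC.add ((pS.pow kG).add ((pS.pow ke).add (pS.pow kh)))))
  have hl2 := snocLoc_lt (snocLoc_lt hl le_rfl) le_rfl
  obtain ⟨qf, hf⟩ := qf loc b hl
  obtain ⟨qg, hg⟩ := qg loc (b + 1) (fun i hi => (hl i hi).trans (by omega))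
  obtain ⟨qh, hh⟩ := qh _ (b + 2) hl2
  obtain ⟨qe, he⟩ := qe _ (b + 3) (fun i hi => (hl2 i hi).trans (by omega))
  obtain ⟨qG, hG⟩ := qG _ (b + 4) (fun i hi => (hl2 i hi).trans (by omega))
  refine ⟨.seq qf (.seq qg (.seq qh (.loop (.nonzero (b + 2))
    (.seq qe (.seq qG (.seq (.move b (b + 4)) (.seq (.move (b + 1) (b + 3)) qh))))))),
    fun a s hs => ?_⟩
  have hold : ∀ (σ : Mem × ℕ × ℕ) (s' : RegState), (∀ i < b, s'.regs i = s.regs i) →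
      s'.mem = σ.1 → s'.regs b = σ.2.1 → s'.regs (b + 1) = σ.2.2 →
      Holds (loopCtx a σ) (snocLoc (dim (α × ℕ)) (snocLoc (dim α) loc b) (b + 1)) s' :=
    fun σ s' k m v w => ((hs.of_agree hl k _ m).snoc v).snoc w
  -- Induction on the number `m` of rounds that are left.
  have loop : ∀ m ≤ N a, ∀ s1 : RegState, (∀ i < b, s1.regs i = s.regs i) →
      s1.mem = (loopState G e f g a (N a - m)).1 → s1.regs b = (loopState G e f g a (N a - m)).2.1 →
      s1.regs (b + 1) = (loopState G e f g a (N a - m)).2.2 →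
      s1.regs (b + 2) = h (loopCtx a (loopState G e f g a (N a - m))) →
      ∃ s', Exec (inp a) (B a) (.loop (.nonzero (b + 2))
        (.seq qe (.seq qG (.seq (.move b (b + 4)) (.seq (.move (b + 1) (b + 3)) qh))))) s1 s' ∧
        (∀ i < b, s'.regs i = s.regs i) ∧ s'.mem = (loopState G e f g a (N a)).1 ∧
        s'.regs b = (loopState G e f g a (N a)).2.1 := by
    intro m
    induction m with
    | zero =>
      intro _ s1 k m v w z
      refine ⟨s1, .loopFalse ?_, k, m, v⟩
      rw [Nat.sub_zero, h0] at z
      simp [RegTest.eval, z]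
    | succ m ih =>
      intro hm s1 k m1 v w z
      obtain ⟨j, hj⟩ : ∃ j, j = N a - (m + 1) := ⟨_, rfl⟩
      have hj1 : N a - m = j + 1 := by omega
      rw [← hj] at m1 v w z
      rw [hj1] at ih
      have hs1 := hold _ s1 k m1 v w
      obtain ⟨s2, e2, k2, m2, v2⟩ := he _ s1 hs1
      have hs2 := hold (loopState G e f g a j) s2 (fun i hi => by rw [k2 i (by omega), k i hi])
        (m2.trans (mem_loopCtx _ _)) (by rw [k2 _ (by omega), v]) (by rw [k2 _ (by omega), w])
      obtain ⟨s3, e3, k3, m3, v3⟩ := hG _ s2 hs2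
      have e4 := Prog.exec_move (inp a) (B a) (show b ≠ b + 4 by omega) s3
        (by rw [v3]; exact (rG _).trans (bG a j (by omega)))
      have w3 : s3.regs (b + 3) = e (loopCtx a (loopState G e f g a j)) := by
        rw [k3 _ (by omega), v2]
      have e5 := Prog.exec_move (inp a) (B a) (show b + 1 ≠ b + 3 by omega)
        ((s3.setReg b (s3.regs (b + 4))).setReg (b + 4) 0)
        (by simpa [w3] using (re _).trans (be a j (by omega)))
      obtain ⟨s5, hs5⟩ : ∃ s5, s5 = (((s3.setReg b (s3.regs (b + 4))).setReg (b + 4) 0).setReg (b + 1)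
        (((s3.setReg b (s3.regs (b + 4))).setReg (b + 4) 0).regs (b + 3))).setReg (b + 3) 0 :=
        ⟨_, rfl⟩
      rw [← hs5] at e5
      have k5 : ∀ i < b, s5.regs i = s.regs i := by
        intro i hi
        rw [← k i hi, ← k2 i (by omega), ← k3 i (by omega), hs5]
        simp [show i ≠ b by omega, show i ≠ b + 1 by omega, show i ≠ b + 3 by omega,
          show i ≠ b + 4 by omega]
      have m5 : s5.mem = (loopState G e f g a (j + 1)).1 := by
        rw [loopState_succ, hs5]; exact m3
      have v5 : s5.regs b = (loopState G e f g a (j + 1)).2.1 := by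
        rw [loopState_succ, hs5]
        simpa [loopStep] using v3
      have w5 : s5.regs (b + 1) = (loopState G e f g a (j + 1)).2.2 := by
        rw [loopState_succ, hs5]
        simpa [loopStep] using w3
      obtain ⟨s6, e6, k6, m6, v6⟩ := hh _ s5 (hold _ s5 k5 m5 v5 w5)
      obtain ⟨s7, e7, r7⟩ := ih (by omega) s6 (fun i hi => by rw [k6 i (by omega), k5 i hi])
        (m6.trans (mem_loopCtx _ _)) (by rw [k6 _ (by omega), v5]) (by rw [k6 _ (by omega), w5]) v6
      rw [inp_loopCtx] at e2 e3 e6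
      refine ⟨s7, .loopTrue ?_ (.seq (e2.mono ?_) (.seq (e3.mono ?_) (.seq e4 (.seq e5
        (e6.mono ?_))))) e7, r7⟩
      · have := h1 a j (by omega)
        simp [RegTest.eval, z, this]
      · exact be a j (by omega)
      · exact bG a j (by omega)
      · exact bh a (j + 1) (by omega)
  obtain ⟨s1, e1, k1, m1, v1⟩ := hf a s hs
  obtain ⟨s2, e2, k2, m2, v2⟩ := hg a s1 (hs.of_agree' hl k1 m1)
  have k2' : ∀ i < b, s2.regs i = s.regs i := fun i hi => by rw [k2 i (by omega), k1 i hi]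
  have v2' : s2.regs b = f a := by rw [k2 _ (by omega), v1]
  obtain ⟨s3, e3, k3, m3, v3⟩ := hh _ s2 (hold (loopState G e f g a 0) s2 k2' m2 v2' v2)
  obtain ⟨s4, e4, r4⟩ := loop (N a) le_rfl s3 (fun i hi => by rw [k3 i (by omega), k2' i hi])
    (by rw [m3, Nat.sub_self]; exact mem_loopCtx _ _)
    (by rw [k3 _ (by omega), v2', Nat.sub_self]; rfl)
    (by rw [k3 _ (by omega), v2, Nat.sub_self]; rfl) (by rw [v3, Nat.sub_self])
  rw [inp_loopCtx] at e3
  exact ⟨s4, .seq (e1.mono (bf a)) (.seq (e2.mono (bg a)) (.seq (e3.mono (bh a 0 (Nat.zero_le _)))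
    e4)), r4⟩

theorem LS.sub {f g : α → ℕ} (hf : LS f) (hg : LS g) : LS (fun a => f a - g a) := by
  have hp : LS (fun y : (α × ℕ) × ℕ => y.1.2 - 1) := LS.var.wk.pred
  have hd : LS (fun y : (α × ℕ) × ℕ => y.2) := LS.var
  have key : ∀ a j, loopState (fun y : (α × ℕ) × ℕ => (mem y, y.1.2 - 1)) (fun y => y.2 - 1) f g a j =
      (mem a, f a - j, g a - j) := by
    intro a j
    induction j with
    | zero => rfl
    | succ j ih =>
      rw [loopState_succ, ih]
      simp [loopStep, loopCtx, Nat.sub_sub]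
  refine (Impl.while hp hd.pred hd hf hg g (fun a => f a + g a) (hf.polyBdd.add hg.polyBdd)
    ?_ ?_ ?_).congr ?_
  · intro a j hj
    rw [key]
    simp only [loopCtx]
    omega
  · intro a
    rw [key]
    simp [loopCtx]
  · intro a j hj
    rw [key]
    constructor <;> dsimp only <;> omega
  · intro a
    rw [key]

/-- A loop over `0, …, n - 1` with an accumulator. -/
def forLoop (G : (α × ℕ) × ℕ → Mem × ℕ) (a : α) (c : ℕ) : ℕ → Mem × ℕ
  | 0 => (mem a, c)
  | j + 1 => G ((setMem a (forLoop G a c j).1, j), (forLoop G a c j).2)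

/-- A while loop whose second variable holds the number of rounds left. The total is stored in a
variable at the start, because `n` may depend on the tape that the body changes; the index of a
round is the total minus the rounds left. -/
theorem Impl.for {G : (α × ℕ) × ℕ → Mem × ℕ} {f n : α → ℕ} (hG : Impl G) (hf : LS f) (hn : LS n)
    (C : α → ℕ) (hC : PolyBdd C) (hb : ∀ a, ∀ j ≤ n a, (forLoop G a (f a) j).2 ≤ C a) :
    Impl (fun a => forLoop G a (f a) (n a)) := by
  have hG' : Impl (fun y : ((α × ℕ) × ℕ) × ℕ => G ((y.1.1.1, y.1.1.2 - y.2), y.1.2)) :=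
    Impl.comp hG ((CMap.id.wk.wk.wk.pair (LS.var.wk.wk.sub LS.var)).pair LS.var.wk)
  have hd : LS (fun y : ((α × ℕ) × ℕ) × ℕ => y.2) := LS.var
  -- `Impl.while` must hold for every value of the stored variable, while `hb` reaches only up to
  -- `n`. Hence the guard: no round is performed unless the variable equals `n`.
  have hg : LS (fun y : α × ℕ => if y.2 - n y.1 ≠ 0 then 0 else if n y.1 - y.2 ≠ 0 then 0 else y.2) :=
    LS.ite (LS.var.sub hn.wk) LS.zero (LS.ite (hn.wk.sub LS.var) LS.zero LS.var)
  obtain ⟨g, hg'⟩ : ∃ g : α × ℕ → ℕ, g = fun y : α × ℕ =>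
    if y.2 - n y.1 ≠ 0 then 0 else if n y.1 - y.2 ≠ 0 then 0 else y.2 := ⟨_, rfl⟩
  have g1 : ∀ y : α × ℕ, g y ≤ n y.1 := by
    intro y; rw [hg']; dsimp only; split_ifs <;> omega
  have g2 : ∀ y : α × ℕ, g y ≤ y.2 := by
    intro y; rw [hg']; dsimp only; split_ifs <;> omega
  have g4 : ∀ y : α × ℕ, g y = 0 ∨ g y = y.2 := by
    intro y; rw [hg']; dsimp only; split_ifs <;> omega
  have g3 : ∀ a, g (a, n a) = n a := by
    intro a; rw [hg']; simp
  rw [← hg'] at hg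
  have key : ∀ (y : α × ℕ) (j : ℕ), j ≤ g y →
      loopState (fun y : ((α × ℕ) × ℕ) × ℕ => G ((y.1.1.1, y.1.1.2 - y.2), y.1.2)) (fun y => y.2 - 1)
      (fun y => f y.1) g y j =
      ((forLoop G y.1 (f y.1) j).1, (forLoop G y.1 (f y.1) j).2, g y - j) := by
    intro y j
    induction j with
    | zero => exact fun _ => rfl
    | succ j ih =>
      intro hj
      rw [loopState_succ, ih (by omega)]
      obtain ⟨a, m⟩ := y
      have h4 := g4 (a, m)
      have h5 : m - (g (a, m) - j) = j := by
        rcases h4 with h4 | h4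
        · omega
        · simp only at h4; omega
      simp only [loopStep, loopCtx, setMem_prod, forLoop, h5, Nat.sub_sub]
  have := Impl.while hG' hd.pred hd hf.wk hg g (fun y => C y.1 + y.2)
    ((hC.comp (polyBdd_size.mono fun y => Nat.le_add_right _ _)).add LS.var.polyBdd) ?_ ?_ ?_
  · refine (LS.bind hn this).congr fun a => ?_
    rw [key _ _ le_rfl, g3]
  · intro a j hj
    rw [key _ _ hj.le]
    simp only [loopCtx]
    omega
  · intro a
    rw [key _ _ le_rfl]
    simp [loopCtx]
  · intro a j hj
    rw [key _ _ hj]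
    have := hb a.1 j (hj.trans (g1 a))
    have := g2 a
    constructor <;> dsimp only <;> omega

/-- Bounded primitive recursion. -/
theorem LS.rec {f n : α → ℕ} {g : (α × ℕ) × ℕ → ℕ} (hg : LS g) (hf : LS f) (hn : LS n)
    (C : α → ℕ) (hC : PolyBdd C)
    (hb : ∀ a, ∀ j ≤ n a, Nat.rec (f a) (fun j c => g ((a, j), c)) j ≤ C a) :
    LS (fun a => Nat.rec (f a) (fun j c => g ((a, j), c)) (n a)) := by
  have key : ∀ a j, forLoop (fun y => (mem y, g y)) a (f a) j =
      (mem a, Nat.rec (f a) (fun j c => g ((a, j), c)) j) := by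
    intro a j
    induction j with
    | zero => rfl
    | succ j ih => simp [forLoop, ih]
  refine (Impl.for (G := fun y => (mem y, g y)) hg hf hn C hC ?_).congr fun a => (key a _).symm
  intro a j hj
  rw [key]
  exact hb a j hj

end Loops


/-! ### Arithmetic and predicates with polynomially bounded registers -/

section Arithmetic

variable {α β : Type} [Ctx α] [Ctx β]

open Ctx

/-- Predicates decided without a net effect on the tapes. -/
def LSP (p : α → Prop) : Prop := ∃ f : α → ℕ, LS f ∧ ∀ a, p a ↔ f a ≠ 0

theorem LSP.congr {p q : α → Prop} (hp : LSP p) (h : ∀ a, q a ↔ p a) : LSP q :=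
  let ⟨f, hf, h1⟩ := hp
  ⟨f, hf, fun a => (h a).trans (h1 a)⟩

theorem LSP.comp {p : β → Prop} {T : α → β} (hp : LSP p) (hT : CMap T) : LSP (fun a => p (T a)) :=
  let ⟨_, hf, h⟩ := hp
  ⟨_, hf.comp hT, fun a => h (T a)⟩

theorem LSP.wk {p : α → Prop} (hp : LSP p) : LSP (fun x : α × ℕ => p x.1) := LSP.comp hp CMap.id.wk

theorem LSP.ne_zero {f : α → ℕ} (hf : LS f) : LSP (fun a => f a ≠ 0) := ⟨f, hf, fun _ => Iff.rfl⟩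

theorem LSP.ite {p : α → Prop} [DecidablePred p] (hp : LSP p) {f g : α → ℕ} (hf : LS f)
    (hg : LS g) : LS (fun a => if p a then f a else g a) := by
  obtain ⟨c, hc, h⟩ := hp
  exact (LS.ite hc hf hg).congr fun a => by simp only [h a]

theorem Impl.iteP {p : α → Prop} [DecidablePred p] (hp : LSP p) {F G : α → Mem × ℕ} (hF : Impl F)
    (hG : Impl G) : Impl (fun a => if p a then F a else G a) := by
  obtain ⟨c, hc, h⟩ := hp
  exact (Impl.ite hc hF hG).congr fun a => by simp only [h a]

theorem LSP.not {p : α → Prop} (hp : LSP p) : LSP (fun a => ¬ p a) := by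
  obtain ⟨f, hf, h⟩ := hp
  refine ⟨_, LS.ite hf LS.zero (LS.const 1), fun a => ?_⟩
  have := h a
  split_ifs <;> simp_all

theorem LSP.and {p q : α → Prop} (hp : LSP p) (hq : LSP q) : LSP (fun a => p a ∧ q a) := by
  obtain ⟨f, hf, h⟩ := hp
  obtain ⟨g, hg, h'⟩ := hq
  refine ⟨_, LS.ite hf hg LS.zero, fun a => ?_⟩
  have := h a
  have := h' a
  split_ifs <;> simp_all

theorem LSP.or {p q : α → Prop} (hp : LSP p) (hq : LSP q) : LSP (fun a => p a ∨ q a) :=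
  (hp.not.and hq.not).not.congr fun a => by tauto

theorem LSP.const (p : Prop) : LSP (fun _ : α => p) := by
  by_cases h : p
  · exact ⟨_, LS.const 1, fun a => by simp [h]⟩
  · exact ⟨_, LS.const 0, fun a => by simp [h]⟩

theorem LSP.lt {f g : α → ℕ} (hf : LS f) (hg : LS g) : LSP (fun a => f a < g a) :=
  (LSP.ne_zero (hg.sub hf)).congr fun a => by omega

theorem LSP.le {f g : α → ℕ} (hf : LS f) (hg : LS g) : LSP (fun a => f a ≤ g a) :=
  (LSP.lt hg hf).not.congr fun a => by omega

theorem LSP.eq {f g : α → ℕ} (hf : LS f) (hg : LS g) : LSP (fun a => f a = g a) :=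
  ((LSP.le hf hg).and (LSP.le hg hf)).congr fun a => by omega

theorem LS.add {f g : α → ℕ} (hf : LS f) (hg : LS g) : LS (fun a => f a + g a) := by
  have key : ∀ a j, (Nat.rec (f a) (fun _ c => c + 1) j : ℕ) = f a + j := by
    intro a j
    induction j with
    | zero => rfl
    | succ j ih => simp only [ih]; rfl
  refine (LS.rec (g := fun x => x.2 + 1) (LS.var (α := α × ℕ)).succ hf hg (fun a => f a + g a)
    (hf.polyBdd.add hg.polyBdd) ?_).congr fun a => (key a _).symm
  intro a j hj
  rw [key]
  omega

theorem LS.sum {f : α × ℕ → ℕ} {n : α → ℕ} (hf : LS f) (hn : LS n) :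
    LS (fun a => ∑ j ∈ Finset.range (n a), f (a, j)) := by
  have key : ∀ a j, (Nat.rec 0 (fun j c => c + f (a, j)) j : ℕ) =
      ∑ j ∈ Finset.range j, f (a, j) := by
    intro a j
    induction j with
    | zero => rfl
    | succ j ih => rw [Finset.sum_range_succ, ← ih]
  obtain ⟨k, hk⟩ := hf.polyBdd
  refine (LS.rec (g := fun x => x.2 + f x.1) (LS.var.add hf.wk) LS.zero hn
    (fun a => n a * (size a + n a) ^ k)
    (hn.polyBdd.mul ((polyBdd_size.add hn.polyBdd).pow k)) ?_).congr fun a => (key a _).symm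
  intro a j hj
  rw [key]
  refine (Finset.sum_le_card_nsmul _ _ ((size a + n a) ^ k) fun i hi => ?_).trans ?_
  · refine (hk _).trans (Nat.pow_le_pow_left ?_ k)
    have := Finset.mem_range.1 hi
    rw [size_prod]
    omega
  · rw [Finset.card_range, smul_eq_mul]
    exact Nat.mul_le_mul_right _ hj

theorem LS.mul {f g : α → ℕ} (hf : LS f) (hg : LS g) : LS (fun a => f a * g a) :=
  (LS.sum hf.wk hg).congr fun a => by simp [mul_comm]

theorem LS.pow_const {f : α → ℕ} (hf : LS f) (c : ℕ) : LS (fun a => f a ^ c) := by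
  induction c with
  | zero => exact (LS.const 1).congr fun a => by simp
  | succ c ih => exact (ih.mul hf).congr fun a => by simp [pow_succ]

theorem LSP.exists_lt {p : α × ℕ → Prop} {n : α → ℕ} (hp : LSP p) (hn : LS n) :
    LSP (fun a => ∃ j < n a, p (a, j)) := by
  obtain ⟨f, hf, h⟩ := hp
  refine ⟨_, LS.sum hf hn, fun a => ?_⟩
  simp only [h, ne_eq, Finset.sum_eq_zero_iff, Finset.mem_range, not_forall, exists_prop]

theorem LSP.forall_lt {p : α × ℕ → Prop} {n : α → ℕ} (hp : LSP p) (hn : LS n) :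
    LSP (fun a => ∀ j < n a, p (a, j)) :=
  (LSP.exists_lt hp.not hn).not.congr fun a => by simp

theorem LS.min {f g : α → ℕ} (hf : LS f) (hg : LS g) : LS (fun a => min (f a) (g a)) :=
  ((LSP.le hf hg).ite hf hg).congr fun a => by rw [min_def]

/-- The quotient counts the positive multiples of `b` up to `a`, which turns division into a bounded
sum. -/
theorem Nat.div_eq_sum (a b : ℕ) (hb : 0 < b) :
    a / b = ∑ j ∈ Finset.range a, if (j + 1) * b ≤ a then 1 else 0 := by
  rw [Finset.sum_ite]
  simp only [Finset.sum_const_zero, add_zero, Finset.sum_const, smul_eq_mul, mul_one]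
  have : (Finset.range a).filter (fun j => (j + 1) * b ≤ a) = Finset.range (a / b) := by
    ext j
    simp only [Finset.mem_filter, Finset.mem_range]
    rw [← Nat.le_div_iff_mul_le hb]
    have := Nat.div_le_self a b
    omega
  rw [this, Finset.card_range]

theorem LS.div {f g : α → ℕ} (hf : LS f) (hg : LS g) : LS (fun a => f a / g a) := by
  have h : LS (fun a => if g a = 0 then 0 else
      ∑ j ∈ Finset.range (f a), if (j + 1) * g a ≤ f a then 1 else 0) :=
    (LSP.eq hg LS.zero).ite LS.zero (LS.sum (f := fun x => if (x.2 + 1) * g x.1 ≤ f x.1 then 1 else 0)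
      ((LSP.le (LS.var.succ.mul hg.wk) hf.wk).ite (LS.const 1) LS.zero) hf)
  refine h.congr fun a => ?_
  by_cases h0 : g a = 0
  · simp [h0]
  · rw [if_neg h0, Nat.div_eq_sum _ _ (Nat.pos_of_ne_zero h0)]

theorem LS.mod {f g : α → ℕ} (hf : LS f) (hg : LS g) : LS (fun a => f a % g a) :=
  (hf.sub (hg.mul (hf.div hg))).congr fun a => by
    have := Nat.div_add_mod (f a) (g a)
    omega

/-- Powers cut off at a bound. -/
theorem LS.pow_min {f g c : α → ℕ} (hf : LS f) (hg : LS g) (hc : LS c) :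
    LS (fun a => Min.min (f a ^ g a) (c a)) := by
  have key : ∀ a j, (Nat.rec (Min.min 1 (c a)) (fun _ d => Min.min (d * f a) (c a)) j : ℕ) =
      Min.min (f a ^ j) (c a) := by
    intro a j
    induction j with
    | zero => rfl
    | succ j ih =>
      simp only [ih, pow_succ]
      rcases Nat.eq_zero_or_pos (f a) with h | h
      · simp [h]
      · rcases le_total (f a ^ j) (c a) with h1 | h1
        · rw [min_eq_left h1]
        · rw [min_eq_right h1, min_eq_right (Nat.le_mul_of_pos_right _ h),
            min_eq_right (h1.trans (Nat.le_mul_of_pos_right _ h))]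
  refine (LS.rec (g := fun x => Min.min (x.2 * f x.1.1) (c x.1.1))
    ((LS.var.mul hf.wk.wk).min hc.wk.wk) ((LS.const 1).min hc) hg c hc.polyBdd ?_).congr
    fun a => (key a _).symm
  intro a j hj
  rw [key]
  exact min_le_right _ _

/-- Once the power exceeds `c` both quotients vanish. Digits can thus be extracted without ever
holding a power larger than `c + 1`. -/
theorem Nat.div_pow_min (c b i : ℕ) : c / Min.min (b ^ i) (c + 1) = c / b ^ i := by
  rcases le_total (b ^ i) (c + 1) with h | h
  · rw [min_eq_left h]
  · rw [min_eq_right h, Nat.div_eq_of_lt (by omega), Nat.div_eq_of_lt (by omega)]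

/-- The digit of `c` at position `i` in base `b`. -/
def Nat.digitAt (b c i : ℕ) : ℕ := c / b ^ i % b

theorem LS.digitAt {b c i : α → ℕ} (hb : LS b) (hc : LS c) (hi : LS i) :
    LS (fun a => Nat.digitAt (b a) (c a) (i a)) :=
  ((hc.div (LS.pow_min hb hi hc.succ)).mod hb).congr fun a => by
    rw [Nat.digitAt, Nat.div_pow_min]

theorem LSP.testBit {c i : α → ℕ} (hc : LS c) (hi : LS i) :
    LSP (fun a => (c a).testBit (i a) = true) :=
  (LSP.eq (LS.digitAt (LS.const 2) hc hi) (LS.const 1)).congr fun a => by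
    rw [Nat.digitAt, Nat.testBit_eq_decide_div_mod_eq, decide_eq_true_eq]

theorem Nat.size_eq_sum (v : ℕ) :
    Nat.size v = ∑ k ∈ Finset.range v, if Min.min (2 ^ k) (v + 1) ≤ v then 1 else 0 := by
  rw [Finset.sum_ite]
  simp only [Finset.sum_const_zero, add_zero, Finset.sum_const, smul_eq_mul, mul_one]
  have : (Finset.range v).filter (fun k => Min.min (2 ^ k) (v + 1) ≤ v) =
      Finset.range (Nat.size v) := by
    ext k
    simp only [Finset.mem_filter, Finset.mem_range]
    have h1 : Nat.size v ≤ v := Nat.size_le.2 Nat.lt_two_pow_self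
    have h2 := Nat.lt_size (m := k) (n := v)
    omega
  rw [this, Finset.card_range]

theorem LS.natSize {f : α → ℕ} (hf : LS f) : LS (fun a => Nat.size (f a)) :=
  (LS.sum (f := fun x => if Min.min (2 ^ x.2) (f x.1 + 1) ≤ f x.1 then 1 else 0)
    ((LSP.le (LS.pow_min (LS.const 2) LS.var hf.wk.succ) hf.wk).ite (LS.const 1) LS.zero) hf).congr
    fun _ => Nat.size_eq_sum _

theorem LSP.read (h : Bool) (f : EndSymbol → Bool) :
    LSP (fun x : α × ℕ => f (readTape (content x.1 h) (x.2 + 1)) = true) :=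
  ⟨_, LS.read h f, fun x => by simp⟩

theorem readTape_succ_eq_right (w : List Bool) (p : ℕ) :
    (match readTape w (p + 1) with | .right => false | _ => true) = true ↔ p < w.length := by
  by_cases h : p < w.length <;> simp [readTape, h]

theorem readTape_succ_toBool (w : List Bool) (p : ℕ) :
    (readTape w (p + 1)).toBool = true ↔ w[p]? = some true := by
  by_cases h : p < w.length <;> simp [readTape, h, EndSymbol.toBool]

theorem LSP.lt_content (h : Bool) : LSP (fun x : α × ℕ => x.2 < (content x.1 h).length) :=
  (LSP.read h fun e => match e with | .right => false | _ => true).congr fun _ =>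
    (readTape_succ_eq_right _ _).symm

theorem LSP.content_bit (h : Bool) : LSP (fun x : α × ℕ => (content x.1 h)[x.2]? = some true) :=
  (LSP.read h EndSymbol.toBool).congr fun _ => (readTape_succ_toBool _ _).symm

/-- No variable bounds the length beforehand, so bounded sums are not available. A while loop scans
for the right end marker, and `inp_le_size` bounds its counter. -/
theorem LS.inp_length : LS (fun a : α => (inp a).length) := by
  obtain ⟨h, hh, h1⟩ : LSP (fun y : (α × ℕ) × ℕ => y.1.2 < (inp y.1.1).length) :=
    LSP.wk (LSP.lt_content (α := α) false)
  have hG : LS (fun y : (α × ℕ) × ℕ => y.1.2 + 1) := LS.var.wk.succ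
  have key : ∀ (a : α) j, loopState (fun y : (α × ℕ) × ℕ => (mem y, y.1.2 + 1)) (fun _ => 0)
      (fun _ => 0) (fun _ => 0) a j = (mem a, j, 0) := by
    intro a j
    induction j with
    | zero => rfl
    | succ j ih => rw [loopState_succ, ih]; simp [loopStep, loopCtx]
  refine (Impl.while hG LS.zero hh LS.zero LS.zero (fun a : α => (inp a).length) (fun a => size a)
    polyBdd_size ?_ ?_ ?_).congr ?_
  · intro a j hj
    rw [key, ← h1]
    simpa [loopCtx] using hj
  · intro a
    rw [key]
    by_contra h0
    have := (h1 _).2 h0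
    simp [loopCtx] at this
  · intro a j hj
    rw [key]
    exact ⟨hj.trans (inp_le_size a), Nat.zero_le _⟩
  · intro a
    rw [key]

end Arithmetic


/-! ### Binary expansions and codes of strings -/

theorem Nat.length_bits (v : ℕ) : v.bits.length = Nat.size v := Nat.size_eq_bits_len v

theorem Nat.getElem?_bits (v k : ℕ) : v.bits[k]? = some true ↔ v.testBit k = true := by
  induction k generalizing v with
  | zero =>
    rcases Nat.eq_zero_or_pos v with rfl | h
    · simp
    · obtain ⟨b, n, rfl⟩ : ∃ b n, v = Nat.bit b n := ⟨v.bodd, v.div2, (Nat.bit_bodd_div2 v).symm⟩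
      rw [Nat.bits_append_bit n b (by rintro rfl; cases b <;> simp_all), Nat.testBit_bit_zero]
      simp
  | succ k ih =>
    rcases Nat.eq_zero_or_pos v with rfl | h
    · simp
    · obtain ⟨b, n, rfl⟩ : ∃ b n, v = Nat.bit b n := ⟨v.bodd, v.div2, (Nat.bit_bodd_div2 v).symm⟩
      rw [Nat.bits_append_bit n b (by rintro rfl; cases b <;> simp_all), Nat.testBit_bit_succ, ← ih]
      simp

/-- Self-delimiting code of a single string. -/
def encodeString (w : List Bool) : List Bool := (w.flatMap fun b => [true, b]) ++ [false, false]

theorem encodeStrings_eq (l : List (List Bool)) : encodeStrings l = l.flatMap encodeString := rfl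

theorem encodeStrings_append (l l' : List (List Bool)) :
    encodeStrings (l ++ l') = encodeStrings l ++ encodeStrings l' := by
  simp [encodeStrings_eq]

theorem encodeStrings_cons (w : List Bool) (l : List (List Bool)) :
    encodeStrings (w :: l) = encodeString w ++ encodeStrings l := by
  simp [encodeStrings_eq]

theorem List.flatMap_eq_range {γ δ : Type} (l : List γ) (g : γ → List δ) (F : ℕ → List δ)
    (h : ∀ k (hk : k < l.length), F k = g l[k]) :
    l.flatMap g = (List.range l.length).flatMap F := by
  induction l using List.reverseRecOn with
  | nil => simp
  | append_singleton l c ih =>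
    rw [List.flatMap_append, List.length_append, List.length_singleton, List.range_succ,
      List.flatMap_append, ih fun k hk => by
        rw [h k (by simp; omega), List.getElem_append_left hk]]
    simp [h l.length (by simp)]

/-! ### Strings given by their length and their bits -/

section Strings

variable {α β : Type} [Ctx α] [Ctx β]

open Ctx

/-- Strings whose length and bits can be computed without a net effect on the tapes. -/
structure LSS (F : α → List Bool) : Prop where
  length : LS (fun a => (F a).length)
  bit : LSP (fun x : α × ℕ => (F x.1)[x.2]? = some true)

theorem LSS.congr {F G : α → List Bool} (hF : LSS F) (h : ∀ a, G a = F a) : LSS G := by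
  rwa [show G = F from funext h]

theorem LSS.comp {F : β → List Bool} {T : α → β} (hF : LSS F) (hT : CMap T) :
    LSS (fun a => F (T a)) :=
  ⟨hF.length.comp hT, LSP.comp (T := fun x : α × ℕ => (T x.1, x.2)) hF.bit (hT.wk.pair LS.var)⟩

theorem LSS.wk {F : α → List Bool} (hF : LSS F) : LSS (fun x : α × ℕ => F x.1) :=
  hF.comp CMap.id.wk

theorem LSS.getElem {F : α → List Bool} (hF : LSS F) {k : α → ℕ} (hk : LS k) :
    LSP (fun a => (F a)[k a]? = some true) :=
  LSP.comp (T := fun a => (a, k a)) hF.bit (CMap.id.pair hk)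

theorem LSS.nil : LSS (fun _ : α => []) :=
  ⟨LS.zero, (LSP.const False).congr fun _ => by simp⟩

theorem LSS.append {F G : α → List Bool} (hF : LSS F) (hG : LSS G) :
    LSS (fun a => F a ++ G a) := by
  refine ⟨(hF.length.add hG.length).congr fun a => by simp, ?_⟩
  refine (((LSP.lt LS.var hF.length.wk).and hF.bit).or ((LSP.lt LS.var hF.length.wk).not.and
    (hG.wk.getElem (LS.var.sub hF.length.wk)))).congr fun x => ?_
  by_cases h : x.2 < (F x.1).length
  · simp [h, List.getElem?_append_left h]
  · simp [h, List.getElem?_append_right (not_lt.1 h)]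

theorem LSS.singleton {p : α → Prop} [DecidablePred p] (hp : LSP p) :
    LSS (fun a => [decide (p a)]) := by
  refine ⟨LS.const 1, (hp.wk.and (LSP.eq LS.var LS.zero)).congr fun x => ?_⟩
  rcases x with ⟨a, _ | k⟩ <;> simp

theorem LSS.const (w : List Bool) : LSS (fun _ : α => w) := by
  induction w with
  | nil => exact LSS.nil
  | cons b w ih => exact ((LSS.singleton (LSP.const (b = true))).append ih).congr fun _ => by simp

theorem LSS.ite {p : α → Prop} [DecidablePred p] (hp : LSP p) {F G : α → List Bool} (hF : LSS F)
    (hG : LSS G) : LSS (fun a => if p a then F a else G a) := by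
  refine ⟨(hp.ite hF.length hG.length).congr fun a => by split_ifs <;> rfl, ?_⟩
  refine ((hp.wk.and hF.bit).or (hp.wk.not.and hG.bit)).congr fun x => ?_
  by_cases h : p x.1 <;> simp [h]

theorem length_flatMap_range (n : ℕ) (G : ℕ → List Bool) :
    ((List.range n).flatMap G).length = ∑ j ∈ Finset.range n, (G j).length := by
  induction n with
  | zero => simp
  | succ n ih => rw [List.range_succ, List.flatMap_append, List.length_append, ih,
      Finset.sum_range_succ]; simp

/-- Cell `k` lies in the block `j` for which the blocks before it have total length at most `k` and
the remainder still falls inside `G j`. An earlier block cannot pass the second test. -/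
theorem getElem?_flatMap_range (n : ℕ) (G : ℕ → List Bool) (k : ℕ) :
    ((List.range n).flatMap G)[k]? = some true ↔ ∃ j < n,
      ∑ i ∈ Finset.range j, (G i).length ≤ k ∧
        (G j)[k - ∑ i ∈ Finset.range j, (G i).length]? = some true := by
  induction n with
  | zero => simp
  | succ n ih =>
    rw [List.range_succ, List.flatMap_append]
    by_cases hk : k < ((List.range n).flatMap G).length
    · rw [List.getElem?_append_left hk, ih]
      rw [length_flatMap_range] at hk
      constructor
      · rintro ⟨j, hj, h⟩
        exact ⟨j, by omega, h⟩
      · rintro ⟨j, hj, h⟩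
        refine ⟨j, ?_, h⟩
        by_contra h'
        obtain rfl : j = n := by omega
        omega
    · rw [List.getElem?_append_right (not_lt.1 hk), length_flatMap_range]
      rw [length_flatMap_range] at hk
      constructor
      · intro h
        exact ⟨n, by omega, by omega, by simpa using h⟩
      · rintro ⟨j, hj, h1, h2⟩
        rcases Nat.lt_succ_iff_lt_or_eq.1 hj with h | rfl
        · obtain ⟨h3, -⟩ := List.getElem?_eq_some_iff.1 h2
          have : ∑ i ∈ Finset.range (j + 1), (G i).length ≤ ∑ i ∈ Finset.range n, (G i).length :=
            Finset.sum_le_sum_of_subset (Finset.range_mono h)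
          rw [Finset.sum_range_succ] at this
          omega
        · simpa using h2

/-- The string may be much longer than the work space and is never stored. Each bit is located anew
through the prefix sums of the block lengths. -/
theorem LSS.flatMap {G : α × ℕ → List Bool} {n : α → ℕ} (hG : LSS G) (hn : LS n) :
    LSS (fun a => (List.range (n a)).flatMap fun j => G (a, j)) := by
  refine ⟨(LS.sum hG.length hn).congr fun a => length_flatMap_range _ _, ?_⟩
  have hS : LS (fun x : (α × ℕ) × ℕ => ∑ i ∈ Finset.range x.2, (G (x.1.1, i)).length) :=
    LS.sum (f := fun y : ((α × ℕ) × ℕ) × ℕ => (G (y.1.1.1, y.2)).length)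
      (hG.length.comp (CMap.id.wk.wk.wk.pair LS.var)) LS.var
  refine (LSP.exists_lt (p := fun x : (α × ℕ) × ℕ =>
    ∑ i ∈ Finset.range x.2, (G (x.1.1, i)).length ≤ x.1.2 ∧
      (G (x.1.1, x.2))[x.1.2 - ∑ i ∈ Finset.range x.2, (G (x.1.1, i)).length]? = some true)
    ((LSP.le hS LS.var.wk).and
      (LSS.getElem (hG.comp (CMap.id.wk.wk.pair LS.var)) (LS.var.wk.sub hS))) hn.wk).congr
    fun x => getElem?_flatMap_range _ _ _

theorem LSS.bits {f : α → ℕ} (hf : LS f) : LSS (fun a => (f a).bits) :=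
  ⟨hf.natSize.congr fun _ => Nat.length_bits _,
    (LSP.testBit hf.wk LS.var).congr fun _ => Nat.getElem?_bits _ _⟩

theorem LSS.encodeString {F : α → List Bool} (hF : LSS F) :
    LSS (fun a => encodeString (F a)) := by
  refine ((LSS.flatMap (G := fun x : α × ℕ => [true, decide ((F x.1)[x.2]? = some true)])
    (((LSS.const [true]).append (LSS.singleton hF.bit)).congr fun _ => rfl) hF.length).append
    (LSS.const [false, false])).congr fun a => ?_
  rw [_root_.encodeString, List.flatMap_eq_range]
  intro k hk
  simp [hk]

theorem LSS.inp : LSS (fun a : α => inp a) := ⟨LS.inp_length, LSP.content_bit (α := α) false⟩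

/-- Equality of strings. -/
theorem LSS.eq {F G : α → List Bool} (hF : LSS F) (hG : LSS G) : LSP (fun a => F a = G a) := by
  refine ((LSP.eq hF.length hG.length).and (LSP.forall_lt (p := fun x : α × ℕ =>
    ((F x.1)[x.2]? = some true ∧ (G x.1)[x.2]? = some true) ∨
    (¬ (F x.1)[x.2]? = some true ∧ ¬ (G x.1)[x.2]? = some true))
    ((hF.bit.and hG.bit).or (hF.bit.not.and hG.bit.not)) hF.length)).congr fun a => ?_
  constructor
  · intro h
    refine ⟨congrArg _ h, fun j _ => ?_⟩
    dsimp only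
    rw [h]
    tauto
  · rintro ⟨h1, h2⟩
    refine List.ext_getElem h1 fun i hi hi' => ?_
    have := h2 i hi
    simp only [List.getElem?_eq_getElem hi, List.getElem?_eq_getElem hi', Option.some.injEq] at this
    cases h3 : (F a)[i] <;> cases h4 : (G a)[i] <;> simp_all

end Strings


/-! ### Finite-valued functions, codings and digits -/

section FiniteValued

variable {α : Type} [Ctx α]

open Ctx

theorem LS.finset_sum {ι : Type} (s : Finset ι) {f : ι → α → ℕ} (hf : ∀ i, LS (f i)) :
    LS (fun a => ∑ i ∈ s, f i a) := by
  classical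
  induction s using Finset.induction_on with
  | empty => exact LS.zero.congr fun a => by simp
  | insert i s hi ih => exact ((hf i).add ih).congr fun a => by rw [Finset.sum_insert hi]

theorem LSP.exists_finite {ι : Type} [Finite ι] {p : ι → α → Prop} (hp : ∀ i, LSP (p i)) :
    LSP (fun a => ∃ i, p i a) := by
  have := Fintype.ofFinite ι
  choose f hf h using hp
  refine ⟨_, LS.finset_sum Finset.univ hf, fun a => ?_⟩
  simp [h, Finset.sum_eq_zero_iff]

theorem LSP.forall_finite {ι : Type} [Finite ι] {p : ι → α → Prop} (hp : ∀ i, LSP (p i)) :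
    LSP (fun a => ∀ i, p i a) :=
  (LSP.exists_finite fun i => (hp i).not).not.congr fun a => by simp

/-- Functions with values in a finite type computed without a net effect on the tapes. -/
def LSF {T : Type} (g : α → T) : Prop := ∀ t, LSP (fun a => g a = t)

theorem LSF.map {T U : Type} [Finite T] {g : α → T} (hg : LSF g) (f : T → U) :
    LSF (fun a => f (g a)) := fun u =>
  (LSP.exists_finite (ι := T) (p := fun t a => g a = t ∧ f t = u)
    fun t => (hg t).and (LSP.const _)).congr fun a => by simp

theorem LSF.prod {T U : Type} {g : α → T} {h : α → U} (hg : LSF g) (hh : LSF h) :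
    LSF (fun a => (g a, h a)) := fun u =>
  ((hg u.1).and (hh u.2)).congr fun a => by rw [Prod.ext_iff]

theorem LSF.pi {ι T : Type} [Finite ι] {g : α → ι → T} (hg : ∀ i, LSF fun a => g a i) : LSF g :=
  fun u => (LSP.forall_finite fun i => hg i (u i)).congr fun a => by rw [funext_iff]

theorem LSF.nat {T : Type} [Finite T] {g : α → T} (hg : LSF g) (f : T → ℕ) :
    LS (fun a => f (g a)) := by
  classical
  have := Fintype.ofFinite T
  refine (LS.finset_sum Finset.univ (f := fun t a => if g a = t then f t else 0)
    fun t => (hg t).ite (LS.const _) LS.zero).congr fun a => by simp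

/-- A function that is constant from `N` on is a finite case distinction after its argument is cut
off at `N`. -/
theorem LSF.of_nat {T : Type} {d : ℕ → T} {N : ℕ} (hd : ∀ n, N ≤ n → d n = d N) {g : α → ℕ}
    (hg : LS g) : LSF (fun a => d (g a)) := fun t =>
  (LSP.exists_finite (ι := Fin (N + 1)) (p := fun i a => min (g a) N = i ∧ d i = t)
    fun i => (LSP.eq (hg.min (LS.const N)) (LS.const _)).and (LSP.const _)).congr fun a => by
      have h : d (g a) = d (min (g a) N) := by
        rcases le_total (g a) N with h | h
        · rw [min_eq_left h]
        · rw [min_eq_right h, hd _ h]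
      constructor
      · intro h1
        exact ⟨⟨min (g a) N, by omega⟩, rfl, h.symm.trans h1⟩
      · rintro ⟨i, h1, h2⟩
        exact h.trans (by rw [h1, h2])

instance : Finite EndSymbol :=
  Finite.of_surjective
    (fun o : Option (Option Bool) => match o with
      | none => EndSymbol.left
      | some none => EndSymbol.right
      | some (some b) => EndSymbol.bit b)
    (fun e => by
      cases e with
      | left => exact ⟨none, rfl⟩
      | right => exact ⟨some none, rfl⟩
      | bit b => exact ⟨some (some b), rfl⟩)

theorem readTape_eq_left (w : List Bool) (p : ℕ) : readTape w p = .left ↔ p = 0 := by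
  rcases p with _ | i
  · simp [readTape]
  · by_cases h : i < w.length <;> simp [readTape, h]

theorem readTape_eq_right (w : List Bool) (p : ℕ) :
    readTape w p = .right ↔ p ≠ 0 ∧ ¬ p - 1 < w.length := by
  rcases p with _ | i
  · simp [readTape]
  · by_cases h : i < w.length <;> simp [readTape, h]

theorem readTape_eq_true (w : List Bool) (p : ℕ) :
    readTape w p = .bit true ↔ p ≠ 0 ∧ w[p - 1]? = some true := by
  rcases p with _ | i
  · simp [readTape]
  · by_cases h : i < w.length <;> simp [readTape, h]

theorem readTape_eq_false (w : List Bool) (p : ℕ) :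
    readTape w p = .bit false ↔ p ≠ 0 ∧ p - 1 < w.length ∧ ¬ w[p - 1]? = some true := by
  rcases p with _ | i
  · simp [readTape]
  · by_cases h : i < w.length <;> simp [readTape, h]

theorem LSF.readTape {F : α → List Bool} (hF : LSS F) {p : α → ℕ} (hp : LS p) :
    LSF (fun a => readTape (F a) (p a)) := by
  have h0 : LSP (fun a => p a = 0) := LSP.eq hp LS.zero
  have hlt : LSP (fun a => p a - 1 < (F a).length) := LSP.lt hp.pred hF.length
  have hb : LSP (fun a => (F a)[p a - 1]? = some true) := hF.getElem hp.pred
  intro t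
  match t with
  | .left => exact h0.congr fun a => readTape_eq_left _ _
  | .bit true => exact (h0.not.and hb).congr fun a => readTape_eq_true _ _
  | .bit false => exact (h0.not.and (hlt.and hb.not)).congr fun a => readTape_eq_false _ _
  | .right => exact (h0.not.and hlt.not).congr fun a => readTape_eq_right _ _

theorem LS.headMove {g : α → HeadMove} (hg : LSF g) {p : α → ℕ} (hp : LS p) :
    LS (fun a => (g a).apply (p a)) := by
  classical
  refine ((hg .left).ite hp.pred ((hg .stay).ite hp hp.succ)).congr fun a => ?_
  cases g a <;> simp [HeadMove.apply]

/-- The tape length is not bounded by the size of the context and so need not fit into a register.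
Only a prefix of computable length is treated as a string. -/
theorem LSS.take_tape {c : α → ℕ} (hc : LS c) : LSS (fun a => (mem a).tape.take (c a)) := by
  have h1 : LSP (fun x : α × ℕ => x.2 < (mem x.1).tape.length) := LSP.lt_content true
  have h2 : LSP (fun x : α × ℕ => (mem x.1).tape[x.2]? = some true) := LSP.content_bit true
  classical
  refine ⟨(LS.sum (h1.ite (LS.const 1) LS.zero) hc).congr fun a => ?_,
    ((LSP.lt LS.var hc.wk).and h2).congr fun x => ?_⟩
  · simp only [List.length_take]
    rw [Finset.sum_ite]
    simp only [Finset.sum_const_zero, add_zero, Finset.sum_const, smul_eq_mul, mul_one]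
    have : (Finset.range (c a)).filter (fun j => j < (mem a).tape.length) =
        Finset.range (min (c a) (mem a).tape.length) := by
      ext j; simp
    rw [this, Finset.card_range]
  · by_cases h : x.2 < c x.1 <;> simp [h]

theorem LSP.le_tape_length {c : α → ℕ} (hc : LS c) : LSP (fun a => c a ≤ (mem a).tape.length) :=
  (LSP.eq (LSS.take_tape hc).length hc).congr fun a => by simp

end FiniteValued

/-- A numbering of a type. -/
structure Coding (T : Type) (t₀ : T) where
  bound : ℕ
  code : T → ℕ
  decode : ℕ → T
  decode_code : ∀ t, decode (code t) = t
  code_lt : ∀ t, code t < bound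
  code_base : code t₀ = 0
  decode_eq : ∀ n, bound ≤ n → decode n = decode bound

/-- A transposition moves `t₀` to 0, so that the start state and the blank get the code 0. Decoding
is constant beyond the bound, as `LSF.of_nat` requires. -/
theorem Coding.nonempty (T : Type) [Finite T] (t₀ : T) : Nonempty (Coding T t₀) := by
  classical
  obtain ⟨n, ⟨e⟩⟩ := Finite.exists_equiv_fin T
  have hn : 0 < n := (e t₀).pos
  let f : T ≃ Fin n := e.trans (Equiv.swap (e t₀) ⟨0, hn⟩)
  exact ⟨{
    bound := n
    code := fun t => f t
    decode := fun i => if h : i < n then f.symm ⟨i, h⟩ else t₀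
    decode_code := fun t => by simp
    code_lt := fun t => (f t).2
    code_base := by simp [f]
    decode_eq := fun i hi => by simp [not_lt.2 hi] }⟩

/-- The number with the digits `v 0, …, v (s - 1)` in base `b`. -/
def Nat.pack (b s : ℕ) (v : ℕ → ℕ) : ℕ := ∑ i ∈ Finset.range s, v i * b ^ i

theorem Nat.pack_succ (b s : ℕ) (v : ℕ → ℕ) :
    Nat.pack b (s + 1) v = Nat.pack b s v + v s * b ^ s := Finset.sum_range_succ _ _

theorem Nat.pack_congr {b s : ℕ} {v w : ℕ → ℕ} (h : ∀ i < s, v i = w i) :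
    Nat.pack b s v = Nat.pack b s w :=
  Finset.sum_congr rfl fun i hi => by rw [h i (Finset.mem_range.1 hi)]

theorem Nat.pack_lt {b s : ℕ} {v : ℕ → ℕ} (h : ∀ i < s, v i < b) : Nat.pack b s v < b ^ s := by
  induction s with
  | zero => simp [Nat.pack]
  | succ s ih =>
    rw [Nat.pack_succ, pow_succ]
    have h1 := ih fun i hi => h i (by omega)
    have h2 : (v s + 1) * b ^ s ≤ b * b ^ s := Nat.mul_le_mul_right _ (h s (by omega))
    nlinarith

theorem Nat.digitAt_pack {b s : ℕ} {v : ℕ → ℕ} (h : ∀ i < s, v i < b) {i : ℕ} (hi : i < s) :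
    Nat.digitAt b (Nat.pack b s v) i = v i := by
  induction s with
  | zero => omega
  | succ s ih =>
    have hb : 0 < b := (Nat.zero_le _).trans_lt (h i hi)
    rw [Nat.pack_succ, Nat.digitAt]
    rcases Nat.lt_succ_iff_lt_or_eq.1 hi with h1 | rfl
    · obtain ⟨k, rfl⟩ := Nat.exists_eq_add_of_lt h1
      rw [← ih (fun j hj => h j (by omega)) h1, Nat.digitAt,
        show v (i + k + 1) * b ^ (i + k + 1) = b ^ i * (b * (v (i + k + 1) * b ^ k)) by ring,
        Nat.add_mul_div_left _ _ (pow_pos hb i), Nat.add_mul_mod_self_left]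
    · rw [Nat.add_mul_div_right _ _ (pow_pos hb i),
        Nat.div_eq_of_lt (Nat.pack_lt fun j hj => h j (by omega)), zero_add,
        Nat.mod_eq_of_lt (h i (by omega))]

theorem Nat.pack_zero (b s : ℕ) : Nat.pack b s (fun _ => 0) = 0 := by simp [Nat.pack]

theorem Nat.log_two_eq_size_sub_one (n : ℕ) : Nat.log 2 n = Nat.size n - 1 := by
  rcases Nat.eq_zero_or_pos n with rfl | h
  · simp
  · rw [Nat.log_eq_iff (Or.inr ⟨by norm_num, h.ne'⟩)]
    have h1 : 0 < Nat.size n := Nat.size_pos.2 h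
    constructor
    · exact Nat.lt_size.1 (by omega)
    · rw [Nat.sub_add_cancel h1]
      exact Nat.lt_size_self n


/-! ### Simulation of a machine with the variables of a context -/

namespace Simulation

open Ctx

variable {M : CatalyticMachine} (S : Coding M.State M.start) (Y : Coding M.Symbol M.blank) (k : ℕ)

/-- Base of the numbers that encode work tapes. -/
def base : ℕ := 2 ^ Y.bound

/-- Work space on inputs of length `n`. -/
def space (n : ℕ) : ℕ := k * (Nat.log 2 n + 1)

/-- Bound on the numbers that encode work tapes. -/
def cap (n : ℕ) : ℕ := (2 * n + 2) ^ (Y.bound * k)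

/-- Base of the numbers that encode configurations. -/
def bigBase (n : ℕ) : ℕ := cap Y k n + (n + 2) + (n ^ k + 2) + S.bound + space k n + 1

/-- Logarithmic space enters here: the contents of a work tape, read as one number, stay polynomial
in `n`. The base is a power of two so that `2 ^ (log n + 1) ≤ 2 * n + 2` can be used directly. -/
theorem base_pow_le (n : ℕ) : base Y ^ space k n ≤ cap Y k n := by
  have h : 2 ^ (Nat.log 2 n + 1) ≤ 2 * n + 2 := by
    rcases Nat.eq_zero_or_pos n with rfl | hn
    · simp
    · have := Nat.pow_log_le_self 2 hn.ne'
      rw [pow_succ]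
      omega
  rw [base, space, cap, ← pow_mul, show Y.bound * (k * (Nat.log 2 n + 1)) =
    (Nat.log 2 n + 1) * (Y.bound * k) by ring, pow_mul]
  exact Nat.pow_le_pow_left h _

theorem code_lt_base (y : M.Symbol) : Y.code y < base Y :=
  (Y.code_lt y).trans Nat.lt_two_pow_self

/-- What determines the next action of a machine. -/
abbrev Observation (M : CatalyticMachine) : Type :=
  M.State × EndSymbol × EndSymbol × (Fin M.tapes → M.Symbol)

def Observation.action (o : Observation M) : MachineAction M.State M.Symbol M.tapes :=
  M.transition o.1 o.2.1 o.2.2.1 o.2.2.2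

/-- The observation made in the configuration encoded by `c`. -/
def observe (X tape : List Bool) (c : ℕ) : Observation M :=
  (S.decode (Nat.digitAt (bigBase S Y k X.length) c 0),
    readTape X (Nat.digitAt (bigBase S Y k X.length) c 1),
    readTape (tape.take (X.length ^ k)) (Nat.digitAt (bigBase S Y k X.length) c 2),
    fun j => Y.decode (Nat.digitAt (base Y) (Nat.digitAt (bigBase S Y k X.length) c (3 + j))
      (Nat.digitAt (bigBase S Y k X.length) c (3 + M.tapes + j))))

/-- Digits of the next configuration. -/
def nextDigit (X tape : List Bool) (c i : ℕ) : ℕ :=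
  if i = 0 then S.code (observe S Y k X tape c).action.next
  else if i = 1 then
    min ((observe S Y k X tape c).action.moveInput.apply
      (Nat.digitAt (bigBase S Y k X.length) c 1)) (X.length + 1)
  else if i = 2 then
    min ((observe S Y k X tape c).action.moveCatalytic.apply
      (Nat.digitAt (bigBase S Y k X.length) c 2)) (X.length ^ k + 1)
  else if h : i - 3 < M.tapes then
    Nat.pack (base Y) (space k X.length) (fun p =>
      if p = Nat.digitAt (bigBase S Y k X.length) c (3 + M.tapes + (i - 3)) then
        Y.code ((observe S Y k X tape c).action.writeWork ⟨i - 3, h⟩)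
      else Nat.digitAt (base Y) (Nat.digitAt (bigBase S Y k X.length) c i) p)
  else if h : i - 3 - M.tapes < M.tapes then
    ((observe S Y k X tape c).action.moveWork ⟨i - 3 - M.tapes, h⟩).apply
      (Nat.digitAt (bigBase S Y k X.length) c i)
  else 0

/-- The code comprises everything but the catalytic and output tapes. The catalytic contents remain
on the real tape, where `newMem` updates them; output is irrelevant for a decision problem. -/
def next (X tape : List Bool) (c : ℕ) : ℕ :=
  Nat.pack (bigBase S Y k X.length) (3 + 2 * M.tapes) (nextDigit S Y k X tape c)

/-! ### Computing the next configuration with polynomially bounded registers -/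

section Computability

variable {α : Type} [Ctx α]

theorem ls_space {X : α → List Bool} (hX : LSS X) : LS (fun a => space k (X a).length) :=
  ((LS.const k).mul (hX.length.natSize.pred.succ)).congr fun a => by
    rw [space, Nat.log_two_eq_size_sub_one]

theorem ls_cap {X : α → List Bool} (hX : LSS X) : LS (fun a => cap Y k (X a).length) :=
  (((LS.const 2).mul hX.length).add (LS.const 2)).pow_const _

theorem ls_bigBase {X : α → List Bool} (hX : LSS X) : LS (fun a => bigBase S Y k (X a).length) :=
  (((((ls_cap Y k hX).add (hX.length.add (LS.const 2))).add
    ((hX.length.pow_const k).add (LS.const 2))).add (LS.const S.bound)).add (ls_space k hX)).succ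

theorem ls_digit {X : α → List Bool} (hX : LSS X) {c : α → ℕ} (hc : LS c) (i : ℕ) :
    LS (fun a => Nat.digitAt (bigBase S Y k (X a).length) (c a) i) :=
  LS.digitAt (ls_bigBase S Y k hX) hc (LS.const i)

theorem lsf_observe {X : α → List Bool} (hX : LSS X) {c : α → ℕ} (hc : LS c) :
    LSF (fun a => observe S Y k (X a) (mem a).tape (c a)) := by
  refine LSF.prod (LSF.of_nat S.decode_eq (ls_digit S Y k hX hc 0)) (LSF.prod
    (LSF.readTape hX (ls_digit S Y k hX hc 1)) (LSF.prod
    (LSF.readTape (LSS.take_tape (hX.length.pow_const k)) (ls_digit S Y k hX hc 2))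
    (LSF.pi fun j => LSF.of_nat Y.decode_eq (LS.digitAt (LS.const _)
      (ls_digit S Y k hX hc _) (ls_digit S Y k hX hc _)))))

theorem ls_nextDigit {X : α → List Bool} (hX : LSS X) {c : α → ℕ} (hc : LS c) (i : ℕ) :
    LS (fun a => nextDigit S Y k (X a) (mem a).tape (c a) i) := by
  have := M.finite_state
  have := M.finite_symbol
  have ho := lsf_observe S Y k hX hc
  unfold nextDigit
  by_cases h0 : i = 0
  · simp only [h0, if_true]
    exact ho.nat fun o => S.code o.action.next
  by_cases h1 : i = 1
  · simp only [h1, if_true, one_ne_zero, if_false]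
    exact (LS.headMove (ho.map fun o => o.action.moveInput) (ls_digit S Y k hX hc 1)).min
      hX.length.succ
  by_cases h2 : i = 2
  · simp only [h2, if_true, two_ne_zero, if_false, show ¬ (2 = 1) by norm_num]
    exact (LS.headMove (ho.map fun o => o.action.moveCatalytic) (ls_digit S Y k hX hc 2)).min
      (hX.length.pow_const k).succ
  by_cases h3 : i - 3 < M.tapes
  · simp only [h0, h1, h2, h3, if_false, dif_pos]
    have hw : LS fun a => Y.code ((observe S Y k (X a) (mem a).tape (c a)).action.writeWork
        ⟨i - 3, h3⟩) := ho.nat fun o => Y.code (o.action.writeWork ⟨i - 3, h3⟩)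
    -- The powers are cut off at `cap` so that they stay bounded for all arguments. By `base_pow_le`
    -- the cutoff is inactive for the positions that occur in the sum.
    refine (LS.sum (f := fun x : α × ℕ =>
      (if x.2 = Nat.digitAt (bigBase S Y k (X x.1).length) (c x.1) (3 + M.tapes + (i - 3)) then
        Y.code ((observe S Y k (X x.1) (mem x.1).tape (c x.1)).action.writeWork ⟨i - 3, h3⟩)
      else Nat.digitAt (base Y) (Nat.digitAt (bigBase S Y k (X x.1).length) (c x.1) i) x.2) *
      Min.min (base Y ^ x.2) (cap Y k (X x.1).length))
      (((LSP.eq LS.var (ls_digit S Y k hX hc _).wk).ite hw.wk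
        (LS.digitAt (LS.const _) (ls_digit S Y k hX hc _).wk LS.var)).mul
        (LS.pow_min (LS.const _) LS.var (ls_cap Y k hX).wk)) (ls_space k hX)).congr fun a => ?_
    refine Finset.sum_congr rfl fun p hp => ?_
    rw [min_eq_left]
    exact (Nat.pow_le_pow_right (Nat.two_pow_pos _) (Finset.mem_range.1 hp).le).trans
      (base_pow_le Y k _)
  by_cases h4 : i - 3 - M.tapes < M.tapes
  · simp only [h0, h1, h2, h3, h4, if_false, dif_pos, dif_neg, not_false_eq_true]
    exact LS.headMove (ho.map fun o => o.action.moveWork ⟨i - 3 - M.tapes, h4⟩)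
      (ls_digit S Y k hX hc i)
  · simp only [h0, h1, h2, h3, h4, if_false, dif_neg, not_false_eq_true]
    exact LS.zero

theorem ls_next {X : α → List Bool} (hX : LSS X) {c : α → ℕ} (hc : LS c) :
    LS (fun a => next S Y k (X a) (mem a).tape (c a)) :=
  (LS.finset_sum (Finset.range (3 + 2 * M.tapes)) fun i =>
    (ls_nextDigit S Y k hX hc i).mul ((ls_bigBase S Y k hX).pow_const i)).congr fun _ => rfl

end Computability

/-- Digits of a configuration. -/
def configDigit (n : ℕ) (C : MachineConfig M) (i : ℕ) : ℕ :=
  if i = 0 then S.code C.state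
  else if i = 1 then C.inputPos
  else if i = 2 then C.catalyticPos
  else if h : i - 3 < M.tapes then
    Nat.pack (base Y) (space k n) (fun p => Y.code (C.work ⟨i - 3, h⟩ p))
  else if h : i - 3 - M.tapes < M.tapes then C.workPos ⟨i - 3 - M.tapes, h⟩
  else 0

def code (n : ℕ) (C : MachineConfig M) : ℕ :=
  Nat.pack (bigBase S Y k n) (3 + 2 * M.tapes) (configDigit S Y k n C)

/-- The configuration respects the space bounds on inputs of length `n`. -/
structure Good (n : ℕ) (C : MachineConfig M) : Prop where
  inputPos : C.inputPos ≤ n + 1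
  catalyticPos : C.catalyticPos ≤ n ^ k + 1
  catalytic : C.catalytic.length = n ^ k
  workPos : ∀ j, C.workPos j < space k n

variable {S Y k}

theorem Good.digit_lt {n : ℕ} {C : MachineConfig M} (h : Good k n C) (i : ℕ) :
    configDigit S Y k n C i < bigBase S Y k n := by
  unfold configDigit bigBase
  split_ifs with h0 h1 h2 h3 h4
  · have := S.code_lt C.state; omega
  · have := h.inputPos; omega
  · have := h.catalyticPos; omega
  · have := (Nat.pack_lt (b := base Y) (s := space k n)
      (v := fun p => Y.code (C.work ⟨i - 3, h3⟩ p)) fun p _ => code_lt_base Y _).trans_le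
      (base_pow_le Y k n)
    omega
  · have := h.workPos ⟨i - 3 - M.tapes, h4⟩; omega
  · omega

theorem Good.digitAt_code {n : ℕ} {C : MachineConfig M} (h : Good k n C) {i : ℕ}
    (hi : i < 3 + 2 * M.tapes) :
    Nat.digitAt (bigBase S Y k n) (code S Y k n C) i = configDigit S Y k n C i :=
  Nat.digitAt_pack (fun i _ => h.digit_lt i) hi

theorem Good.digitAt_work {n : ℕ} {C : MachineConfig M} (h : Good k n C) (j : Fin M.tapes) :
    Nat.digitAt (bigBase S Y k n) (code S Y k n C) (3 + j) =
      Nat.pack (base Y) (space k n) (fun p => Y.code (C.work j p)) := by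
  rw [h.digitAt_code (by omega)]
  simp [configDigit, show 3 + (j : ℕ) ≠ 1 by omega,
    show 3 + (j : ℕ) ≠ 2 by omega]

theorem Good.digitAt_workPos {n : ℕ} {C : MachineConfig M} (h : Good k n C) (j : Fin M.tapes) :
    Nat.digitAt (bigBase S Y k n) (code S Y k n C) (3 + M.tapes + j) = C.workPos j := by
  rw [h.digitAt_code (by omega)]
  simp [configDigit, show 3 + M.tapes + (j : ℕ) ≠ 1 by omega, show 3 + M.tapes + (j : ℕ) ≠ 2 by omega,
    show 3 + M.tapes + (j : ℕ) - 3 = M.tapes + j by omega]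

theorem Good.observe_code {X : List Bool} {C : MachineConfig M} (h : Good k X.length C)
    (rest : List Bool) :
    observe S Y k X (C.catalytic ++ rest) (code S Y k X.length C) =
      (C.state, readTape X C.inputPos, readTape C.catalytic C.catalyticPos,
        fun j => C.work j (C.workPos j)) := by
  unfold observe
  refine Prod.ext ?_ (Prod.ext ?_ (Prod.ext ?_ (funext fun j => ?_)))
  · dsimp only
    rw [h.digitAt_code (by omega)]
    simp [configDigit, S.decode_code]
  · dsimp only
    rw [h.digitAt_code (by omega)]
    simp [configDigit]
  · dsimp only
    rw [h.digitAt_code (by omega), List.take_left' h.catalytic]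
    simp [configDigit]
  · dsimp only
    rw [h.digitAt_work, h.digitAt_workPos,
      Nat.digitAt_pack (fun p _ => code_lt_base Y _) (h.workPos j), Y.decode_code]

/-- The cells in `rest` lie beyond the simulated catalytic tape and are invisible: `observe` looks
only at the prefix of length `X.length ^ k`, so the simulated head meets its right end marker where
it should. -/
theorem Good.next_code {X : List Bool} {C : MachineConfig M} (h : Good k X.length C)
    (rest : List Bool) (hv : M.verdict C.state = none) :
    next S Y k X (C.catalytic ++ rest) (code S Y k X.length C) =
      code S Y k X.length (M.step X C) := by
  refine Nat.pack_congr fun i hi => ?_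
  simp only [nextDigit, h.observe_code, configDigit, CatalyticMachine.step, hv,
    Observation.action]
  by_cases h0 : i = 0
  · simp [h0]
  by_cases h1 : i = 1
  · have := h.digitAt_code (S := S) (Y := Y) (i := 1) (by omega)
    simp [h1, this, configDigit]
  by_cases h2 : i = 2
  · have := h.digitAt_code (S := S) (Y := Y) (i := 2) (by omega)
    simp [h2, this, configDigit, h.catalytic]
  simp only [h0, h1, h2, if_false]
  by_cases h3 : i - 3 < M.tapes
  · simp only [h3, dif_pos]
    refine Nat.pack_congr fun p hp => ?_
    have e1 := h.digitAt_workPos (S := S) (Y := Y) ⟨i - 3, h3⟩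
    have e2 := h.digitAt_work (S := S) (Y := Y) ⟨i - 3, h3⟩
    simp only [show 3 + (i - 3) = i by omega] at e1 e2
    rw [e1, e2]
    by_cases hp' : p = C.workPos ⟨i - 3, h3⟩
    · simp [hp']
    · rw [if_neg hp', Nat.digitAt_pack (fun p _ => code_lt_base Y _) hp,
        Function.update_of_ne hp']
  · have h4 : i - 3 - M.tapes < M.tapes := by omega
    simp only [h3, h4, dif_pos, dif_neg, not_false_eq_true]
    have e1 := h.digitAt_workPos (S := S) (Y := Y) ⟨i - 3 - M.tapes, h4⟩
    simp only [show 3 + M.tapes + (i - 3 - M.tapes) = i by omega] at e1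
    rw [e1]

theorem length_step (X : List Bool) (C : MachineConfig M) :
    (M.step X C).catalytic.length = C.catalytic.length := by
  unfold CatalyticMachine.step
  split
  · rfl
  · simp [length_writeTape]

theorem good_run {X τ : List Bool} (hτ : τ.length = X.length ^ k)
    (hs : ∀ t j, (M.run X τ t).workPos j < space k X.length) (t : ℕ) :
    Good k X.length (M.run X τ t) := by
  have key : (M.run X τ t).inputPos ≤ X.length + 1 ∧
      (M.run X τ t).catalyticPos ≤ X.length ^ k + 1 ∧
      (M.run X τ t).catalytic.length = X.length ^ k := by
    induction t with
    | zero => exact ⟨Nat.zero_le _, Nat.zero_le _, hτ⟩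
    | succ t ih =>
      have e : M.run X τ (t + 1) = M.step X (M.run X τ t) := Function.iterate_succ_apply' _ _ _
      rw [e]
      refine ⟨?_, ?_, by rw [length_step]; exact ih.2.2⟩
      · unfold CatalyticMachine.step
        split
        · exact ih.1
        · exact min_le_right _ _
      · unfold CatalyticMachine.step
        split
        · exact ih.2.1
        · rw [← ih.2.2]
          exact min_le_right _ _
  exact ⟨key.1, key.2.1, key.2.2, hs t⟩

/-- All digits vanish because the start state and the blank have code 0. The simulation can start
from a cleared register. -/
theorem code_init (n : ℕ) (τ : List Bool) : code S Y k n (M.init τ) = 0 := by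
  rw [code, ← Nat.pack_zero (bigBase S Y k n) (3 + 2 * M.tapes)]
  refine Nat.pack_congr fun i _ => ?_
  unfold configDigit
  split_ifs
  · exact S.code_base
  · rfl
  · rfl
  · rw [← Nat.pack_zero (base Y) (space k n)]
    exact Nat.pack_congr fun p _ => Y.code_base
  · rfl
  · rfl

end Simulation


/-! ### The simulation loop and its effect on the tape -/

namespace Simulation

open Ctx

variable {M : CatalyticMachine} (S : Coding M.State M.start) (Y : Coding M.Symbol M.blank) (k : ℕ)

section Loop

variable {α : Type} [Ctx α] (F : α → List Bool)

/-- The observation made from the loop variables of the simulation. -/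
def look (y : (α × ℕ) × ℕ) : Observation M := observe S Y k (F y.1.1) (mem y).tape y.1.2

/-- The position of the simulated catalytic head. -/
def catPos (y : (α × ℕ) × ℕ) : ℕ :=
  Nat.digitAt (bigBase S Y k (F y.1.1).length) y.1.2 2

/-- The tapes after a round of the simulation. -/
def newMem (y : (α × ℕ) × ℕ) : Mem :=
  if 1 ≤ catPos S Y k F y ∧ catPos S Y k F y ≤ (F y.1.1).length ^ k then
    ⟨(mem y).tape.set (catPos S Y k F y - 1)
      (decide ((if (look S Y k F y).action.writeCatalytic = true then 1 else 0) ≠ 0)), (mem y).out⟩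
  else mem y

def body (y : (α × ℕ) × ℕ) : Mem × ℕ := (newMem S Y k F y, next S Y k (F y.1.1) (mem y).tape y.1.2)

/-- The simulation goes on. -/
def goesOn (y : (α × ℕ) × ℕ) : Prop :=
  (F y.1.1).length ^ k ≤ (mem y).tape.length ∧ M.verdict (look S Y k F y).1 = none

variable {F}

theorem lsf_look (hF : LSS F) : LSF (look S Y k F) := lsf_observe S Y k hF.wk.wk LS.var.wk

theorem impl_body (hF : LSS F) : Impl (body S Y k F) := by
  have := M.finite_state
  have := M.finite_symbol
  have hl := lsf_look S Y k hF
  have hc : LS (catPos S Y k F) := ls_digit S Y k hF.wk.wk LS.var.wk 2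
  have hw : LS fun y => if (look S Y k F y).action.writeCatalytic = true then 1 else 0 :=
    hl.nat fun o => if o.action.writeCatalytic = true then 1 else 0
  have hm : Impl fun y => (newMem S Y k F y, 0) := by
    classical
    refine (Impl.iteP ((LSP.le (LS.const 1) hc).and
      (LSP.le hc (hF.wk.wk.length.pow_const k))) (Impl.write hc.pred hw)
      (G := fun y => (mem y, 0)) LS.zero).congr fun y => ?_
    unfold newMem
    split_ifs <;> rfl
  have hv : LS fun t : (((α × ℕ) × ℕ) × ℕ) × ℕ => t.1.2 := LS.var.wk
  refine (LS.bind (ls_next S Y k hF.wk.wk LS.var.wk) (Impl.bind hm.wk hv)).congr fun y => ?_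
  simp [body]

theorem lsp_goesOn (hF : LSS F) : LSP (goesOn S Y k F) := by
  have := M.finite_state
  have := M.finite_symbol
  exact (LSP.le_tape_length (hF.wk.wk.length.pow_const k)).and
    ((lsf_look S Y k hF).map (fun o => M.verdict o.1) none)

end Loop

variable {S Y k}

/-- The range test on the head position is essential. A write at the simulated right end marker has
no effect for the machine but would hit the first cell of `rest` on the longer real tape. -/
theorem Good.newMem_eq {X : List Bool} {C : MachineConfig M} (h : Good k X.length C)
    (rest out : List Bool) (hv : M.verdict C.state = none) :
    (if 1 ≤ C.catalyticPos ∧ C.catalyticPos ≤ X.length ^ k then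
      (⟨(C.catalytic ++ rest).set (C.catalyticPos - 1)
        (decide ((if (M.transition C.state (readTape X C.inputPos)
          (readTape C.catalytic C.catalyticPos)
          (fun j => C.work j (C.workPos j))).writeCatalytic = true then 1 else 0) ≠ 0)), out⟩ : Mem)
      else ⟨C.catalytic ++ rest, out⟩) = ⟨(M.step X C).catalytic ++ rest, out⟩ := by
  simp only [CatalyticMachine.step, hv]
  generalize (M.transition C.state (readTape X C.inputPos)
          (readTape C.catalytic C.catalyticPos)
          (fun j => C.work j (C.workPos j))).writeCatalytic = b
  have hb : decide ((if b = true then 1 else 0) ≠ 0) = b := by cases b <;> rfl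
  rw [hb]
  have hl := h.catalytic
  rcases C.catalyticPos with _ | i
  · simp [writeTape]
  · simp only [writeTape, Nat.add_sub_cancel]
    split_ifs with h1
    · rw [List.set_append_left _ _ (by omega)]
    · rw [List.set_eq_of_length_le (by omega)]

theorem verdict_iterate {X τ : List Bool} {t t' : ℕ} (h : t ≤ t') {b : Bool}
    (hv : M.verdict (M.run X τ t).state = some b) : M.run X τ t' = M.run X τ t := by
  obtain ⟨d, rfl⟩ := Nat.exists_eq_add_of_le h
  rw [add_comm, CatalyticMachine.run, Function.iterate_add_apply]
  refine Function.iterate_fixed ?_ d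
  change M.step X (M.run X τ t) = _
  simp only [CatalyticMachine.step, hv]
  rfl

end Simulation

open Ctx Simulation in
/-- A language in catalytic logspace is decided within a context, as long as the catalytic tape is
long enough and the string in question does not depend on the part of the tape that is used. -/
theorem exists_oracle {A : Language Bool} (hA : decisionProblem A ∈ CL) :
    ∃ k, ∀ {α : Type} [Ctx α] (F : α → List Bool), LSS F →
      (∀ a p, p.length = (F a).length ^ k → (F a).length ^ k ≤ (mem a).tape.length →
        F (setMem a ⟨p ++ (mem a).tape.drop ((F a).length ^ k), (mem a).out⟩) = F a) →
      LSP (fun a => (F a).length ^ k ≤ (mem a).tape.length ∧ F a ∈ A) := by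
  classical
  obtain ⟨k, M, hM⟩ := hA
  have := M.finite_state
  have := M.finite_symbol
  obtain ⟨S⟩ := Coding.nonempty M.State M.start
  obtain ⟨Y⟩ := Coding.nonempty M.Symbol M.blank
  refine ⟨k, fun {α} _ F hF hcond => ?_⟩
  obtain ⟨h, hh, hgo⟩ := lsp_goesOn S Y k hF
  have hC : LS (fun a => bigBase S Y k (F a).length ^ (3 + 2 * M.tapes)) :=
    (ls_bigBase S Y k hF).pow_const _
  have key : ∀ a : α, ∃ N,
      (∀ j < N, goesOn S Y k F (loopCtx a
        (loopState (body S Y k F) (fun _ => 0) (fun _ => 0) (fun _ => 0) a j))) ∧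
      (¬ goesOn S Y k F (loopCtx a
        (loopState (body S Y k F) (fun _ => 0) (fun _ => 0) (fun _ => 0) a N))) ∧
      (∀ j ≤ N,
        (loopState (body S Y k F) (fun _ => 0) (fun _ => 0) (fun _ => 0) a j).2.1 ≤
          bigBase S Y k (F a).length ^ (3 + 2 * M.tapes) ∧
        (loopState (body S Y k F) (fun _ => 0) (fun _ => 0) (fun _ => 0) a j).2.2 ≤
          bigBase S Y k (F a).length ^ (3 + 2 * M.tapes)) ∧
      (loopState (body S Y k F) (fun _ => 0) (fun _ => 0) (fun _ => 0) a N).1 = mem a ∧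
      ((F a).length ^ k ≤ (mem a).tape.length →
        (M.verdict (S.decode (Nat.digitAt (bigBase S Y k (F a).length)
          (loopState (body S Y k F) (fun _ => 0) (fun _ => 0) (fun _ => 0) a N).2.1 0)) = some true ↔
          F a ∈ A)) := by
    intro a
    by_cases hg : (F a).length ^ k ≤ (mem a).tape.length
    -- The prefix of the tape serves as the initial catalytic tape of the simulated machine, which
    -- works for every content.
    · have hτ : ((mem a).tape.take ((F a).length ^ k)).length = (F a).length ^ k := by simpa using hg
      obtain ⟨hs, t, b, hv, hP, hr⟩ := hM (F a) _ hτ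
      have hgood := good_run hτ hs
      have hex : ∃ t, ∃ b, M.verdict (M.run (F a) ((mem a).tape.take ((F a).length ^ k)) t).state =
        some b := ⟨t, b, hv⟩
      obtain ⟨b', hv'⟩ := Nat.find_spec hex
      have hmin : ∀ j < Nat.find hex,
          M.verdict (M.run (F a) ((mem a).tape.take ((F a).length ^ k)) j).state = none := by
        intro j hj
        have := Nat.find_min hex hj
        rw [Option.eq_none_iff_forall_ne_some]
        exact fun b hb => this ⟨b, hb⟩
      -- The loop stops at the first halting time, whereas the hypothesis speaks of some halting
      -- time `t`. Halted configurations are frozen, so verdict and restored tape are the same at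
      -- both.
      have hle : Nat.find hex ≤ t := Nat.find_min' hex ⟨b, hv⟩
      have heq := verdict_iterate hle hv'
      rw [heq] at hv hr
      generalize hN : Nat.find hex = N at *
      -- The query is recomputed in every round, on a tape whose prefix has been altered meanwhile.
      -- The hypothesis on `F` guarantees that it is still the same string.
      have hF' : ∀ j, F (setMem a ⟨(M.run (F a) ((mem a).tape.take ((F a).length ^ k)) j).catalytic ++
          (mem a).tape.drop ((F a).length ^ k), (mem a).out⟩) = F a :=
        fun j => hcond a _ (hgood j).catalytic hg
      have state : ∀ j ≤ N,
          loopState (body S Y k F) (fun _ => 0) (fun _ => 0) (fun _ => 0) a j =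
          (⟨(M.run (F a) ((mem a).tape.take ((F a).length ^ k)) j).catalytic ++
            (mem a).tape.drop ((F a).length ^ k), (mem a).out⟩,
          code S Y k (F a).length (M.run (F a) ((mem a).tape.take ((F a).length ^ k)) j), 0) := by
        intro j
        induction j with
        | zero =>
          intro _
          refine Prod.ext ?_ (Prod.ext (code_init _ _).symm rfl)
          change mem a = ⟨(mem a).tape.take _ ++ (mem a).tape.drop _, (mem a).out⟩
          rw [List.take_append_drop]
        | succ j ih =>
          intro hj
          rw [loopState_succ, ih (by omega)]
          have e : M.run (F a) ((mem a).tape.take ((F a).length ^ k)) (j + 1) =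
            M.step (F a) (M.run (F a) ((mem a).tape.take ((F a).length ^ k)) j) :=
            Function.iterate_succ_apply' _ _ _
          have hn := hmin j (by omega)
          have hj' := hgood j
          have hFj := hF' j
          rw [e]
          generalize M.run (F a) ((mem a).tape.take ((F a).length ^ k)) j = C at *
          simp only [loopStep, body, loopCtx, mem_prod, mem_setMem]
          refine Prod.ext ?_ (Prod.ext ?_ rfl)
          · dsimp only
            simp only [newMem, catPos, look, mem_prod, mem_setMem]
            rw [hFj, hj'.observe_code, hj'.digitAt_code (by omega)]
            exact hj'.newMem_eq _ _ hn
          · dsimp only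
            rw [hFj]
            exact hj'.next_code _ hn
      have look_eq : ∀ j ≤ N, (look S Y k F (loopCtx a
          (loopState (body S Y k F) (fun _ => 0) (fun _ => 0) (fun _ => 0) a j))).1 =
          (M.run (F a) ((mem a).tape.take ((F a).length ^ k)) j).state := by
        intro j hj
        rw [state j hj]
        simp only [look, loopCtx, mem_prod, mem_setMem, hF' j]
        rw [(hgood j).observe_code]
      refine ⟨N, fun j hj => ⟨?_, ?_⟩, ?_, ?_, ?_, ?_⟩
      · rw [state j hj.le]
        simp only [loopCtx, mem_prod, mem_setMem, hF' j]
        rw [List.length_append, (hgood j).catalytic]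
        omega
      · rw [look_eq j hj.le]
        exact hmin j hj
      · rintro ⟨-, h2⟩
        rw [look_eq N le_rfl, hv'] at h2
        cases h2
      · intro j hj
        rw [state j hj]
        exact ⟨(Nat.pack_lt fun i _ => (hgood j).digit_lt i).le, Nat.zero_le _⟩
      · rw [state N le_rfl, hr, List.take_append_drop]
      · intro _
        rw [state N le_rfl, (hgood N).digitAt_code (by omega)]
        simp only [configDigit, if_true, S.decode_code]
        rw [hv, Option.some_inj]
        exact hP
    -- On a tape that is too short the loop performs no round and leaves everything unchanged.
    · refine ⟨0, fun j hj => absurd hj (Nat.not_lt_zero _), ?_, ?_, rfl, fun h => absurd h hg⟩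
      · rintro ⟨h1, -⟩
        simp only [loopState, Function.iterate_zero, id, loopCtx, mem_prod, setMem_mem] at h1
        exact hg h1
      · intro j hj
        obtain rfl : j = 0 := by omega
        exact ⟨Nat.zero_le _, Nat.zero_le _⟩
  choose N h1 h2 h3 h4 h5 using key
  have hloop : LS (fun a =>
      (loopState (body S Y k F) (fun _ => 0) (fun _ => 0) (fun _ => 0) a (N a)).2.1) := by
    refine (Impl.while (impl_body S Y k hF) LS.zero hh LS.zero LS.zero N
      (fun a => bigBase S Y k (F a).length ^ (3 + 2 * M.tapes)) hC.polyBdd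
      (fun a j hj => (hgo _).1 (h1 a j hj)) (fun a => ?_) h3).congr fun a => ?_
    · by_contra h0
      exact h2 a ((hgo _).2 h0)
    · rw [h4]
  refine ((LSP.le_tape_length (hF.length.pow_const k)).and
    ((LSF.of_nat S.decode_eq (ls_digit S Y k hF hloop 0)).map M.verdict (some true))).congr
    fun a => ?_
  exact and_congr_right fun hg => (h5 a hg).symm


/-! ### Decoding -/

theorem length_encodeString (w : List Bool) : (encodeString w).length = 2 * w.length + 2 := by
  induction w with
  | nil => rfl
  | cons b w ih =>
    simp only [encodeString, List.flatMap_cons, List.append_assoc, List.length_append] at ih ⊢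
    simp only [List.length_cons, List.length_nil] at ih ⊢
    omega

theorem encodeString_getElem?_even (w : List Bool) (q : ℕ) (v : List Bool) :
    (encodeString w ++ v)[2 * q]? =
      if q < w.length then some true else if q = w.length then some false
      else v[2 * (q - (w.length + 1))]? := by
  induction w generalizing q with
  | nil =>
    rcases q with _ | q
    · simp [encodeString]
    · simp [encodeString, Nat.mul_succ]
  | cons b w ih =>
    rcases q with _ | q
    · simp [encodeString]
    · have := ih q
      simp only [encodeString, List.flatMap_cons, List.append_assoc, List.cons_append,
        List.nil_append, Nat.mul_succ, List.getElem?_cons_succ, List.length_cons,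
        Nat.succ_lt_succ_iff, Nat.succ_inj] at this ⊢
      rw [this, Nat.add_sub_add_right]

theorem encodeString_getElem?_odd (w : List Bool) (q : ℕ) (v : List Bool) :
    (encodeString w ++ v)[2 * q + 1]? =
      if q < w.length then w[q]? else if q = w.length then some false
      else v[2 * (q - (w.length + 1)) + 1]? := by
  induction w generalizing q with
  | nil =>
    rcases q with _ | q
    · simp [encodeString]
    · simp [encodeString, Nat.mul_succ]
  | cons b w ih =>
    rcases q with _ | q
    · simp [encodeString]
    · have := ih q
      simp only [encodeString, List.flatMap_cons, List.append_assoc, List.cons_append,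
        List.nil_append, Nat.mul_succ, List.getElem?_cons_succ, List.length_cons,
        Nat.succ_lt_succ_iff, Nat.succ_inj] at this ⊢
      rw [this, Nat.add_sub_add_right]

theorem encodeString_even_lt (w v : List Bool) {q : ℕ} (hq : q < w.length) :
    (encodeString w ++ v)[2 * q]? = some true := by
  rw [encodeString_getElem?_even, if_pos hq]

theorem encodeString_even_length (w v : List Bool) :
    (encodeString w ++ v)[2 * w.length]? = some false := by
  rw [encodeString_getElem?_even, if_neg (lt_irrefl _), if_pos rfl]

theorem encodeString_even_add (w v : List Bool) (q : ℕ) :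
    (encodeString w ++ v)[2 * (w.length + 1 + q)]? = v[2 * q]? := by
  rw [encodeString_getElem?_even, if_neg (by omega), if_neg (by omega), Nat.add_sub_cancel_left]

theorem encodeString_odd_add (w v : List Bool) (q : ℕ) :
    (encodeString w ++ v)[2 * (w.length + 1 + q) + 1]? = v[2 * q + 1]? := by
  rw [encodeString_getElem?_odd, if_neg (by omega), if_neg (by omega), Nat.add_sub_cancel_left]

/-- The number of strings closed within the first `p` pairs of symbols of a code. -/
def closedCount (u : List Bool) (p : ℕ) : ℕ :=
  ∑ q ∈ Finset.range p, if u[2 * q]? = some true then 0 else 1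

/-- The `j`-th string of a code. -/
def nthString (u : List Bool) (j : ℕ) : List Bool :=
  (List.range (u.length / 2)).flatMap fun q =>
    if u[2 * q]? = some true ∧ closedCount u q = j then [decide (u[2 * q + 1]? = some true)] else []

theorem closedCount_encodeString_of_le (w v : List Bool) {p : ℕ} (hp : p ≤ w.length) :
    closedCount (encodeString w ++ v) p = 0 := by
  refine Finset.sum_eq_zero fun q hq => ?_
  rw [Finset.mem_range] at hq
  rw [encodeString_even_lt w v (by omega), if_pos rfl]

theorem closedCount_encodeString_add (w v : List Bool) (p : ℕ) :
    closedCount (encodeString w ++ v) (w.length + 1 + p) = closedCount v p + 1 := by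
  have h := closedCount_encodeString_of_le w v le_rfl
  unfold closedCount at *
  rw [Finset.sum_range_add, Finset.sum_range_succ, h, encodeString_even_length,
    zero_add, if_neg (by simp), add_comm]
  congr 1
  exact Finset.sum_congr rfl fun q _ => by rw [encodeString_even_add]

theorem length_encodeString_append_div (w v : List Bool) :
    (encodeString w ++ v).length / 2 = w.length + 1 + v.length / 2 := by
  rw [List.length_append, length_encodeString]
  omega

theorem flatMap_range_getElem? (w : List Bool) :
    ((List.range w.length).flatMap fun q => [decide (w[q]? = some true)]) = w := by
  refine List.ext_getElem? fun i => ?_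
  rw [← List.map_eq_flatMap, List.getElem?_map]
  by_cases h : i < w.length
  · rw [List.getElem?_range h, Option.map_some, List.getElem?_eq_getElem h]
    cases w[i] <;> rfl
  · rw [List.getElem?_eq_none (by simpa using h), List.getElem?_eq_none (by simpa using h)]
    rfl

theorem nthString_zero (w v : List Bool) : nthString (encodeString w ++ v) 0 = w := by
  unfold nthString
  rw [length_encodeString_append_div, List.range_add, List.flatMap_append, List.range_succ,
    List.flatMap_append]
  have h1 : ∀ q ∈ List.range w.length,
      (if (encodeString w ++ v)[2 * q]? = some true ∧ closedCount (encodeString w ++ v) q = 0 then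
        [decide ((encodeString w ++ v)[2 * q + 1]? = some true)] else []) =
      [decide (w[q]? = some true)] := by
    intro q hq
    rw [List.mem_range] at hq
    rw [encodeString_getElem?_even, encodeString_getElem?_odd,
      closedCount_encodeString_of_le _ _ hq.le]
    simp [hq]
  rw [List.flatMap_congr h1, flatMap_range_getElem?]
  simp only [List.flatMap_cons, List.flatMap_nil, List.append_nil, List.flatMap_map,
    encodeString_even_length]
  rw [if_neg (by simp), List.append_nil,
    List.flatMap_eq_nil_iff.2, List.append_nil]
  intro q _
  rw [if_neg]
  rw [closedCount_encodeString_add]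
  simp

theorem nthString_succ (w v : List Bool) (j : ℕ) :
    nthString (encodeString w ++ v) (j + 1) = nthString v j := by
  unfold nthString
  rw [length_encodeString_append_div, List.range_add, List.flatMap_append, List.range_succ,
    List.flatMap_append]
  have h1 : (List.range w.length).flatMap (fun q =>
      (if (encodeString w ++ v)[2 * q]? = some true ∧ closedCount (encodeString w ++ v) q = j + 1
        then [decide ((encodeString w ++ v)[2 * q + 1]? = some true)] else [])) = [] := by
    rw [List.flatMap_eq_nil_iff]
    intro q hq
    rw [List.mem_range] at hq
    rw [closedCount_encodeString_of_le _ _ hq.le]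
    simp
  rw [h1]
  simp only [List.flatMap_cons, List.flatMap_nil, List.append_nil, List.flatMap_map,
    encodeString_even_length]
  rw [if_neg (by simp), List.nil_append, List.nil_append]
  refine List.flatMap_congr fun q _ => ?_
  rw [encodeString_even_add, encodeString_odd_add, closedCount_encodeString_add]
  simp only [Nat.add_right_cancel_iff]

theorem nthString_encodeStrings (l : List (List Bool)) (j : ℕ) (hj : j < l.length) :
    nthString (encodeStrings l) j = l[j] := by
  induction l generalizing j with
  | nil => simp at hj
  | cons w l ih =>
    rw [encodeStrings_cons]
    rcases j with _ | j
    · rw [nthString_zero]; rfl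
    · rw [nthString_succ, ih j (by simpa using hj)]; rfl

theorem closedCount_encodeStrings (l : List (List Bool)) :
    closedCount (encodeStrings l) ((encodeStrings l).length / 2) = l.length := by
  induction l with
  | nil => rfl
  | cons w l ih =>
    rw [encodeStrings_cons, length_encodeString_append_div, closedCount_encodeString_add, ih]
    rfl

theorem encodeStrings_injective : Function.Injective encodeStrings := by
  intro l l' h
  have hl : l.length = l'.length := by
    rw [← closedCount_encodeStrings l, h, closedCount_encodeStrings]
  refine List.ext_getElem hl fun j h1 h2 => ?_
  rw [← nthString_encodeStrings l j h1, h, nthString_encodeStrings]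

theorem length_le_length_encodeStrings (l : List (List Bool)) :
    2 * l.length ≤ (encodeStrings l).length := by
  induction l with
  | nil => rfl
  | cons w l ih =>
    rw [encodeStrings_cons, List.length_append, length_encodeString, List.length_cons]
    omega

/-- Read from the right, the last string consists of pairs `1b`, and the first pair `00` met marks
its left border. Nothing is assumed about `u` and `v`, whose own pairing may be out of step. -/
theorem append_encodeString_inj {u v w w' : List Bool}
    (h : u ++ [false, false] ++ encodeString w = v ++ [false, false] ++ encodeString w') :
    u = v ∧ w = w' := by
  unfold encodeString at h
  rw [← List.append_assoc, ← List.append_assoc, List.append_left_inj] at h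
  induction w using List.reverseRecOn generalizing w' with
  | nil =>
    rcases List.eq_nil_or_concat w' with rfl | ⟨z, b, rfl⟩
    · exact ⟨by simpa using h, rfl⟩
    · have := congrArg List.reverse h
      simp at this
  | append_singleton w a ih =>
    rcases List.eq_nil_or_concat w' with rfl | ⟨z, b, rfl⟩
    · have := congrArg List.reverse h
      simp at this
    · rw [List.concat_eq_append, List.flatMap_append, List.flatMap_append, ← List.append_assoc,
        ← List.append_assoc] at h
      obtain ⟨h1, h2⟩ := List.append_inj' h rfl
      obtain ⟨h3, h4⟩ := ih h1
      simp only [List.flatMap_cons, List.flatMap_nil, List.cons.injEq, List.append_nil] at h2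
      exact ⟨h3, by rw [List.concat_eq_append, h4, h2.2.1]⟩


/-! ### Minimum weights -/

section MinWeight

variable {M : ℕ} (S : Set (Fin M → Bool))

/-- The weight of `y` when the weights are listed by a function on the natural numbers. -/
def listWeight (w : ℕ → ℕ) (y : Fin M → Bool) : ℕ := witnessWeight (fun i => w i) y

/-- The members of minimum weight. -/
def minimizers (w : ℕ → ℕ) : Set (Fin M → Bool) :=
  {y | y ∈ S ∧ ∀ z ∈ S, listWeight w y ≤ listWeight w z}

/-- The minimum weight, counted from the thresholds below it. -/
noncomputable def optWeight (B : ℕ) (w : ℕ → ℕ) : ℕ :=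
  open Classical in
  ∑ t ∈ Finset.range B, if ∃ y ∈ S, listWeight w y ≤ t then 0 else 1

/-- The weights after raising the one at position `i`. -/
def raise (w : ℕ → ℕ) (i : ℕ) : ℕ → ℕ := fun j => if j = i then w j + 1 else w j

variable {S}

theorem minimizers_nonempty (hS : S.Nonempty) (w : ℕ → ℕ) : (minimizers S w).Nonempty := by
  obtain ⟨y, hy, h⟩ := Set.exists_min_image S (listWeight w) S.toFinite hS
  exact ⟨y, hy, h⟩

theorem optWeight_eq {B : ℕ} {w : ℕ → ℕ} {y : Fin M → Bool} (hy : y ∈ minimizers S w)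
    (hB : listWeight w y ≤ B) : optWeight S B w = listWeight w y := by
  classical
  unfold optWeight
  obtain ⟨d, rfl⟩ := Nat.exists_eq_add_of_le hB
  rw [Finset.sum_range_add, Finset.sum_congr rfl (g := fun _ => 1),
    Finset.sum_eq_zero (s := Finset.range d)]
  · simp
  · intro t _
    exact if_pos ⟨y, hy.1, by omega⟩
  · intro t ht
    rw [Finset.mem_range] at ht
    refine if_neg ?_
    rintro ⟨z, hz, h⟩
    have := hy.2 z hz
    omega

theorem listWeight_raise (w : ℕ → ℕ) (i : Fin M) (y : Fin M → Bool) :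
    listWeight (raise w i) y = listWeight w y + if y i = true then 1 else 0 := by
  unfold listWeight witnessWeight raise
  rw [← (Finset.sum_ite_eq' Finset.univ i (fun i => if y i = true then 1 else 0)).trans
    (if_pos (Finset.mem_univ _)), ← Finset.sum_add_distrib]
  refine Finset.sum_congr rfl fun j _ => ?_
  by_cases h : j = i
  · subst h; split_ifs <;> simp_all
  · have : (j : ℕ) ≠ i := fun h' => h (Fin.ext h')
    simp [h, this]

/-- Raising adds 1 to the members containing `i` and nothing to the others, so the optimum survives
exactly when an old minimizer avoids `i`. The bound is strict so that the raised optimum is also at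
most `B` and is counted correctly. -/
theorem optWeight_raise_eq_iff (hS : S.Nonempty) {B : ℕ} {w : ℕ → ℕ} (i : Fin M)
    (hB : ∀ y : Fin M → Bool, listWeight w y < B) :
    optWeight S B (raise w i) = optWeight S B w ↔ ∃ y ∈ minimizers S w, y i = false := by
  obtain ⟨y, hy⟩ := minimizers_nonempty hS w
  obtain ⟨z, hz⟩ := minimizers_nonempty hS (raise w i)
  have hz2 := listWeight_raise w i z
  have hy2 := listWeight_raise w i y
  have hzB : listWeight (raise w i) z ≤ B := by
    have := hB z
    split_ifs at hz2 <;> omega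
  rw [optWeight_eq hy (hB y).le, optWeight_eq hz hzB]
  have hzy := hz.2 y hy.1
  have hyz := hy.2 z hz.1
  constructor
  · intro h
    refine ⟨z, ⟨hz.1, fun t ht => ?_⟩, ?_⟩
    · have := hy.2 t ht
      omega
    · by_contra h0
      rw [Bool.not_eq_false] at h0
      rw [if_pos h0] at hz2
      omega
  · rintro ⟨t, ht, h0⟩
    have ht2 := listWeight_raise w i t
    rw [h0, if_neg (by simp)] at ht2
    have h1 := hz.2 t ht.1
    have h2 := ht.2 y hy.1
    have h3 := ht.2 z hz.1
    omega

/-- The optimum is unchanged, being attained by a minimizer that avoids `i`. A minimizer containing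
`i` now lies above it, and no new member can descend to it. -/
theorem minimizers_raise (w : ℕ → ℕ) (i : Fin M) (h : ∃ y ∈ minimizers S w, y i = false) :
    minimizers S (raise w i) = {y ∈ minimizers S w | y i = false} := by
  obtain ⟨y, hy, h0⟩ := h
  ext z
  have hy2 := listWeight_raise w i y
  have hz2 := listWeight_raise w i z
  rw [h0, if_neg (by simp)] at hy2
  constructor
  · intro hz
    have h1 := hz.2 y hy.1
    have h2 := hy.2 z hz.1
    refine ⟨⟨hz.1, fun t ht => ?_⟩, ?_⟩
    · have := hy.2 t ht
      omega
    · by_contra h0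
      rw [Bool.not_eq_false] at h0
      rw [if_pos h0] at hz2
      omega
  · rintro ⟨hz, hz0⟩
    rw [hz0, if_neg (by simp)] at hz2
    refine ⟨hz.1, fun t ht => ?_⟩
    have := hz.2 t ht
    have := listWeight_raise w i t
    omega

/-- If no minimizer avoids `i`, then this was so before raising the weight at `i`. -/
theorem forall_minimizers_of_raise {w : ℕ → ℕ} {i : Fin M}
    (h : ¬ ∃ y ∈ minimizers S (raise w i), y i = false) :
    ¬ ∃ y ∈ minimizers S w, y i = false := by
  intro h'
  obtain ⟨y, hy⟩ := h'
  refine h ⟨y, ?_, hy.2⟩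
  rw [minimizers_raise w i ⟨y, hy⟩]
  exact hy

/-- A difference of at least 1 in `w` becomes at least `B` after scaling, which the perturbation
cannot make up for. So `v` only breaks ties. -/
theorem minimizers_subset_of_perturbed {w v : ℕ → ℕ} {B : ℕ}
    (hv : ∀ y : Fin M → Bool, listWeight v y < B) :
    minimizers S (fun i => w i * B + v i) ⊆ minimizers S w := by
  intro y hy
  refine ⟨hy.1, fun z hz => ?_⟩
  have key : ∀ t : Fin M → Bool,
      listWeight (fun i => w i * B + v i) t = listWeight w t * B + listWeight v t := by
    intro t
    unfold listWeight witnessWeight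
    rw [Finset.sum_mul, ← Finset.sum_add_distrib]
    refine Finset.sum_congr rfl fun i _ => ?_
    split_ifs <;> simp
  by_contra h
  have h1 := hy.2 z hz
  rw [key, key] at h1
  have h2 := hv z
  have h3 : (listWeight w z + 1) * B ≤ listWeight w y * B := Nat.mul_le_mul_right _ (by omega)
  rw [add_mul, one_mul] at h3
  omega

theorem listWeight_le {w : ℕ → ℕ} {B : ℕ} (hw : ∀ i < M, w i ≤ B) (y : Fin M → Bool) :
    listWeight w y ≤ M * B := by
  unfold listWeight witnessWeight
  refine (Finset.sum_le_card_nsmul _ _ B fun i _ => ?_).trans (by simp)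
  split_ifs
  · exact hw i i.2
  · exact Nat.zero_le _

end MinWeight

/-- Each `i` spoils exactly one residue `s`. If all `q` shifts were spoiled, choosing a culprit for
each would inject `q` shifts into `M < q` positions. -/
theorem exists_shift {M q : ℕ} (h : M < q) (f : ℕ → ℕ) :
    ∃ s < q, ∀ i < M, (f i + s) % q ≠ q - 1 := by
  by_contra hc
  push Not at hc
  choose! g hg using hc
  have hinj : Set.InjOn g (Finset.range q : Finset ℕ) := by
    intro s hs t ht he
    rw [Finset.coe_range, Set.mem_Iio] at hs ht
    have h1 := (hg s hs).2
    have h2 := (hg t ht).2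
    rw [he, ← h2] at h1
    have h3 : s ≡ t [MOD q] := Nat.ModEq.add_left_cancel' _ h1
    rwa [Nat.ModEq, Nat.mod_eq_of_lt hs, Nat.mod_eq_of_lt ht] at h3
  have := Finset.card_le_card_of_injOn g (s := Finset.range q) (t := Finset.range M)
    (fun s hs => by simpa using (hg s (by simpa using hs)).1) hinj
  simp at this
  omega

/-- The least number with a given property, counted from the numbers below it. -/
theorem sum_forall_not_eq_find {p : ℕ → Prop} [DecidablePred p] {q : ℕ} (h : ∃ s, s < q ∧ p s) :
    ∃ s < q, p s ∧ (open Classical in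
      ∑ j ∈ Finset.range q, if ∀ i < j + 1, ¬ p i then 1 else 0) = s := by
  classical
  have h' : ∃ s, p s := h.imp fun s hs => hs.2
  have hq : Nat.find h' < q := by
    obtain ⟨s, hs, hp⟩ := h
    exact (Nat.find_min' h' hp).trans_lt hs
  refine ⟨Nat.find h', hq, Nat.find_spec h', ?_⟩
  obtain ⟨d, hd⟩ := Nat.exists_eq_add_of_le hq.le
  rw [hd, Finset.sum_range_add, Finset.sum_congr rfl (g := fun _ => 1),
    Finset.sum_eq_zero (s := Finset.range d)]
  · simp
  · intro t _
    exact if_neg fun hf => hf (Nat.find h') (by omega) (Nat.find_spec h')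
  · intro t ht
    rw [Finset.mem_range] at ht
    exact if_pos fun i hi => Nat.find_min h' (by omega)

/-- The stored number may wrap around modulo `q` when raised; its shifted value, which is what
enters the weights, does not. -/
theorem shift_raise_mod {x s q : ℕ} (h : (x + s) % q ≠ q - 1) (hq : 0 < q) :
    ((x + 1) % q + s) % q = (x + s) % q + 1 := by
  rw [Nat.mod_add_mod, add_right_comm, Nat.add_mod]
  have := Nat.mod_lt (x + s) hq
  rcases Nat.lt_or_ge 1 q with h1 | h1
  · rw [Nat.mod_eq_of_lt h1, Nat.mod_eq_of_lt (by omega)]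
  · obtain rfl : q = 1 := by omega
    omega

theorem mod_raise_lower {x q : ℕ} (hx : x < q) : ((x + 1) % q + (q - 1)) % q = x := by
  rw [Nat.mod_add_mod, show x + 1 + (q - 1) = x + q by omega, Nat.add_mod_right,
    Nat.mod_eq_of_lt hx]


/-! ### Numbers stored on a tape -/

/-- The number stored in the `l` cells from position `p` on. -/
def slotBits (p l : ℕ) (t : List Bool) : ℕ :=
  ∑ k ∈ Finset.range l, if t[p + k]? = some true then 2 ^ k else 0

/-- Store the low bits of `v` in the `j` cells from position `p` on. -/
def writeBits (p v : ℕ) (t : List Bool) : ℕ → List Bool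
  | 0 => t
  | j + 1 => (writeBits p v t j).set (p + j) (v.testBit j)

theorem length_writeBits (p v : ℕ) (t : List Bool) (j : ℕ) :
    (writeBits p v t j).length = t.length := by
  induction j with
  | zero => rfl
  | succ j ih => simp [writeBits, ih]

theorem getElem?_writeBits (p v : ℕ) (t : List Bool) (l j : ℕ) :
    (writeBits p v t l)[j]? =
      if p ≤ j ∧ j < p + l then t[j]?.map (fun _ => v.testBit (j - p)) else t[j]? := by
  induction l with
  | zero => rw [if_neg (by omega)]; rfl
  | succ l ih =>
    rw [writeBits, List.getElem?_set, length_writeBits, ih]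
    by_cases h : p + l = j
    · subst h
      rw [if_pos rfl, if_pos (by omega : p ≤ p + l ∧ p + l < p + (l + 1)), Nat.add_sub_cancel_left]
      by_cases h1 : p + l < t.length <;> simp [h1]
    · rw [if_neg h]
      by_cases h2 : p ≤ j ∧ j < p + l
      · rw [if_pos h2, if_pos (by omega)]
      · rw [if_neg h2, if_neg (by omega)]

theorem Nat.testBit_sum (b : ℕ → Bool) (l j : ℕ) :
    (∑ k ∈ Finset.range l, if b k = true then 2 ^ k else 0) < 2 ^ l ∧
    (∑ k ∈ Finset.range l, if b k = true then 2 ^ k else 0).testBit j =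
      (decide (j < l) && b j) := by
  induction l with
  | zero => simp
  | succ l ih =>
    obtain ⟨h1, h2⟩ := ih
    rw [Finset.sum_range_succ]
    generalize (∑ k ∈ Finset.range l, if b k = true then 2 ^ k else 0) = S at *
    have h3 : (if b l = true then 2 ^ l else 0) = 2 ^ l * (b l).toNat := by cases b l <;> simp
    rw [h3, add_comm]
    constructor
    · have := Bool.toNat_le (b l)
      have : 2 ^ l * (b l).toNat ≤ 2 ^ l * 1 := Nat.mul_le_mul_left _ this
      rw [pow_succ]
      omega
    · rw [Nat.testBit_two_pow_mul_add _ h1]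
      split_ifs with h4
      · simp [h2, h4, Nat.lt_succ_of_lt h4]
      · rcases Nat.eq_or_lt_of_le (not_lt.1 h4) with rfl | h5
        · cases b l <;> simp
        · rw [show j - l = (j - l - 1) + 1 by omega, Nat.testBit_succ]
          have : (b l).toNat / 2 = 0 := by cases b l <;> rfl
          simp [this, show ¬ j < l + 1 by omega]

theorem Nat.sum_testBit {v l : ℕ} (hv : v < 2 ^ l) :
    (∑ k ∈ Finset.range l, if v.testBit k = true then 2 ^ k else 0) = v := by
  refine Nat.eq_of_testBit_eq fun j => ?_
  rw [(Nat.testBit_sum _ l j).2]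
  by_cases h : j < l
  · simp [h]
  · rw [Nat.testBit_lt_two_pow (hv.trans_le (Nat.pow_le_pow_right (by omega) (not_lt.1 h)))]
    simp [h]

theorem slotBits_lt (p l : ℕ) (t : List Bool) : slotBits p l t < 2 ^ l := by
  have := (Nat.testBit_sum (fun k => decide (t[p + k]? = some true)) l 0).1
  simpa [slotBits] using this

theorem testBit_slotBits (p l : ℕ) (t : List Bool) {j : ℕ} (hj : j < l) :
    (slotBits p l t).testBit j = decide (t[p + j]? = some true) := by
  have := (Nat.testBit_sum (fun k => decide (t[p + k]? = some true)) l j).2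
  simpa [slotBits, hj] using this

theorem slotBits_writeBits {p l v : ℕ} {t : List Bool} (hv : v < 2 ^ l) (ht : p + l ≤ t.length) :
    slotBits p l (writeBits p v t l) = v := by
  refine Eq.trans ?_ (Nat.sum_testBit hv)
  refine Finset.sum_congr rfl fun k hk => ?_
  rw [Finset.mem_range] at hk
  rw [getElem?_writeBits, List.getElem?_eq_getElem (by omega : p + k < t.length),
    Nat.add_sub_cancel_left, if_pos (show p ≤ p + k ∧ p + k < p + l by omega)]
  simp

theorem slotBits_congr {p l : ℕ} {t t' : List Bool} (h : ∀ k < l, t[p + k]? = t'[p + k]?) :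
    slotBits p l t = slotBits p l t' :=
  Finset.sum_congr rfl fun k hk => by rw [h k (by simpa using hk)]

theorem slotBits_writeBits_of_disjoint {p p' l v : ℕ} {t : List Bool}
    (h : p + l ≤ p' ∨ p' + l ≤ p) : slotBits p l (writeBits p' v t l) = slotBits p l t :=
  slotBits_congr fun k hk => by rw [getElem?_writeBits, if_neg (by omega)]

theorem slotBits_of_drop {p l o : ℕ} {t t' : List Bool} (hp : o ≤ p) (h : t'.drop o = t.drop o) :
    slotBits p l t' = slotBits p l t := by
  refine slotBits_congr fun k _ => ?_
  have := congrArg (fun w : List Bool => w[p - o + k]?) h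
  simp only [List.getElem?_drop] at this
  rwa [show o + (p - o + k) = p + k by omega] at this

theorem writeBits_writeBits_slotBits (p v l : ℕ) (t : List Bool) :
    writeBits p (slotBits p l t) (writeBits p v t l) l = t := by
  refine List.ext_getElem? fun j => ?_
  rw [getElem?_writeBits, getElem?_writeBits]
  split_ifs with h
  · rw [testBit_slotBits _ _ _ (by omega), Option.map_map, show p + (j - p) = j by omega]
    rcases t[j]? with _ | b
    · rfl
    · cases b <;> rfl
  · rfl

/-- Apply `f · 0`, `f · 1`, …, `f · (n - 1)` one after the other. -/
def iterTape (f : List Bool → ℕ → List Bool) (t : List Bool) : ℕ → List Bool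
  | 0 => t
  | n + 1 => f (iterTape f t n) n

/-- Undoing steps in reverse order. -/
theorem iterTape_reverse {f g : List Bool → ℕ → List Bool} {t : List Bool} {n : ℕ}
    (h : ∀ i < n, g (iterTape f t (i + 1)) i = iterTape f t i) :
    iterTape (fun w j => g w (n - 1 - j)) (iterTape f t n) n = t := by
  have : ∀ j ≤ n, iterTape (fun w j => g w (n - 1 - j)) (iterTape f t n) j =
      iterTape f t (n - j) := by
    intro j
    induction j with
    | zero => intro _; rfl
    | succ j ih =>
      intro hj
      rw [iterTape, ih (by omega), show n - j = n - 1 - j + 1 by omega, h _ (by omega),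
        show n - (j + 1) = n - 1 - j by omega]
  rw [this n le_rfl, Nat.sub_self]
  rfl

/-! ### Loops that rewrite the tape or emit a string -/

section Loops

open Ctx

variable {α : Type} [Ctx α]

theorem Impl.iterTape {f : α → List Bool → ℕ → List Bool} {n : α → ℕ}
    (hf : Impl fun x : (α × ℕ) × ℕ => (⟨f x.1.1 (mem x).tape x.1.2, (mem x).out⟩, 0))
    (hn : LS n) (hm : ∀ a r, f (setMem a r) = f a) :
    Impl fun a => (⟨iterTape (f a) (mem a).tape (n a), (mem a).out⟩, 0) := by
  have key : ∀ a j, forLoop (fun x : (α × ℕ) × ℕ =>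
      ((⟨f x.1.1 (mem x).tape x.1.2, (mem x).out⟩ : Mem), 0)) a 0 j =
      (⟨_root_.iterTape (f a) (mem a).tape j, (mem a).out⟩, 0) := by
    intro a j
    induction j with
    | zero => rfl
    | succ j ih =>
      rw [forLoop, ih]
      simp [hm, _root_.iterTape]
  refine (Impl.for hf LS.zero hn (fun _ => 0) (polyBdd_const 0) fun a j _ => ?_).congr
    fun a => (key a _).symm
  rw [key]

theorem Impl.emitAll {g : α × ℕ → Prop} {n : α → ℕ} [DecidablePred g] (hg : LSP g) (hn : LS n)
    (hm : ∀ a o i, g (setMem a ⟨(mem a).tape, o⟩, i) ↔ g (a, i)) :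
    Impl fun a => (⟨(mem a).tape, (mem a).out ++ (List.range (n a)).map fun i => decide (g (a, i))⟩,
      0) := by
  classical
  have he : Impl fun x : (α × ℕ) × ℕ =>
      ((⟨(mem x).tape, (mem x).out ++ [decide ((if g x.1 then 1 else 0) ≠ 0)]⟩ : Mem), 0) :=
    Impl.emit (LSP.ite hg.wk (LS.const 1) LS.zero)
  have key : ∀ a j, forLoop (fun x : (α × ℕ) × ℕ =>
      ((⟨(mem x).tape, (mem x).out ++ [decide ((if g x.1 then 1 else 0) ≠ 0)]⟩ : Mem), 0)) a 0 j =
      (⟨(mem a).tape, (mem a).out ++ (List.range j).map fun i => decide (g (a, i))⟩, 0) := by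
    intro a j
    induction j with
    | zero => simp [forLoop]
    | succ j ih =>
      rw [forLoop, ih]
      simp [hm, List.range_succ]
  refine (Impl.for he LS.zero hn (fun _ => 0) (polyBdd_const 0) fun a j _ => ?_).congr
    fun a => (key a _).symm
  rw [key]

theorem Impl.writeBits {p v l : α → ℕ} (hp : LS p) (hv : LS v) (hl : LS l) :
    Impl fun a => (⟨writeBits (p a) (v a) (mem a).tape (l a), (mem a).out⟩, 0) := by
  have h1 : Impl fun x : (((α × ℕ) × ℕ) × ℕ) × ℕ =>
      ((⟨(mem x).tape.set (x.1.1.1.2 + x.1.2) ((x.1.1.2).testBit x.1.2), (mem x).out⟩ : Mem), 0) := by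
    classical
    refine (Impl.write (LS.add LS.var.wk.wk.wk LS.var.wk)
      (LSP.ite (LSP.testBit LS.var.wk.wk LS.var.wk) (LS.const 1) LS.zero)).congr fun x => ?_
    simp
  have h2 := Impl.iterTape (α := (α × ℕ) × ℕ) (n := fun y => l y.1.1)
    (f := fun y t j => t.set (y.1.2 + j) (y.2.testBit j)) h1 hl.wk.wk (fun _ _ => rfl)
  refine (LS.bind hp (LS.bind hv.wk h2)).congr fun a => ?_
  refine Prod.ext (congrArg₂ Mem.mk ?_ rfl) rfl
  generalize l a = j
  induction j with
  | zero => rfl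
  | succ j ih => rw [_root_.writeBits, ih]; rfl

end Loops


/-! ### The search algorithm -/

/-- The number of weights in the code of a search instance. -/
def numWeights (u : List Bool) : ℕ := closedCount u (u.length / 2) - 1

/-- The number of tape cells that hold the perturbation of one weight. -/
def slotWidth (u : List Bool) : ℕ := Nat.size (numWeights u)

/-- The modulus of the perturbations. -/
def slotRange (u : List Bool) : ℕ := 2 ^ slotWidth u

/-- The `i`-th weight in the code of a search instance. -/
def parsedWeight (c : ℕ) (u : List Bool) (i : ℕ) : ℕ :=
  min (∑ v ∈ Finset.range (u.length ^ c + 1), if v.bits = nthString u (i + 1) then v else 0)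
    (u.length ^ c)

/-- The factor by which the weights are scaled. -/
def weightScale (u : List Bool) : ℕ := numWeights u * slotRange u + 1

/-- A bound for the perturbed weights. -/
def weightCap (c : ℕ) (u : List Bool) : ℕ := u.length ^ c * weightScale u + slotRange u

/-- A bound for the thresholds. -/
def thresholdCap (c : ℕ) (u : List Bool) : ℕ := numWeights u * weightCap c u + 1

/-- The code of a decision instance with the same string and with other weights. -/
def decisionQuery (c : ℕ) (u : List Bool) (w : ℕ → ℕ) (t : ℕ) : List Bool :=
  encodeString (nthString u 0) ++
    ((List.range (numWeights u)).flatMap fun i => encodeString (min (w i) (weightCap c u)).bits) ++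
    encodeString (min t (thresholdCap c u)).bits

/-- The length of the part of the tape that is left to the machine for the decision problem. -/
def reserved (c k : ℕ) (u : List Bool) : ℕ :=
  (2 * (nthString u 0).length + 2 + numWeights u * (2 * weightCap c u + 2) +
    (2 * thresholdCap c u + 2)) ^ k

theorem Nat.length_bits_le (v : ℕ) : v.bits.length ≤ v := by
  rw [Nat.length_bits, Nat.size_le]
  exact Nat.lt_two_pow_self

/-- The cutoffs in `decisionQuery` serve this unconditional bound. For every input, valid or not,
the oracle machine stays within the reserved cells and cannot touch the slots. -/
theorem length_decisionQuery_pow_le (c k : ℕ) (u : List Bool) (w : ℕ → ℕ) (t : ℕ) :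
    (decisionQuery c u w t).length ^ k ≤ reserved c k u := by
  refine Nat.pow_le_pow_left ?_ k
  simp only [decisionQuery, List.length_append, length_encodeString, List.length_flatMap]
  have h1 := Nat.length_bits_le (min t (thresholdCap c u))
  have h2 : ((List.range (numWeights u)).map fun i =>
      2 * (min (w i) (weightCap c u)).bits.length + 2).sum ≤
      numWeights u * (2 * weightCap c u + 2) := by
    refine (List.sum_le_card_nsmul _ (2 * weightCap c u + 2) fun x hx => ?_).trans (by simp)
    obtain ⟨i, -, rfl⟩ := List.mem_map.1 hx
    have := Nat.length_bits_le (min (w i) (weightCap c u))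
    omega
  omega

/-- The perturbation of the `i`-th weight, read from the tape and shifted by `s`. -/
def perturbation (c k : ℕ) (u t : List Bool) (s i : ℕ) : ℕ :=
  (slotBits (reserved c k u + i * slotWidth u) (slotWidth u) t + s) % slotRange u

/-- The perturbed weights. -/
def perturbedWeight (c k : ℕ) (u t : List Bool) (s i : ℕ) : ℕ :=
  parsedWeight c u i * weightScale u + perturbation c k u t s i

/-- The weights after lowering the one at position `i`. -/
def lower (w : ℕ → ℕ) (i : ℕ) : ℕ → ℕ := fun j => if j = i then w j - 1 else w j

section Algorithm

variable (A : Language Bool) (c k : ℕ)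

/-- A decision instance is accepted, and the tape is long enough to find this out. -/
def Accepted (u t : List Bool) (w : ℕ → ℕ) (t₀ : ℕ) : Prop :=
  (decisionQuery c u w t₀).length ^ k ≤ t.length ∧ decisionQuery c u w t₀ ∈ A

open Classical in
/-- The minimum weight, as found with the help of the decision problem. -/
noncomputable def foundOpt (u t : List Bool) (w : ℕ → ℕ) : ℕ :=
  ∑ t₀ ∈ Finset.range (thresholdCap c u), if Accepted A c k u t w t₀ then 0 else 1

/-- Raising the `i`-th weight does not raise the minimum. -/
def RaiseTest (u t : List Bool) (s i : ℕ) : Prop :=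
  foundOpt A c k u t (raise (perturbedWeight c k u t s) i) =
    foundOpt A c k u t (perturbedWeight c k u t s)

/-- The `i`-th weight has been raised. -/
def LowerTest (u t : List Bool) (s i : ℕ) : Prop :=
  1 ≤ perturbation c k u t s i ∧
    foundOpt A c k u t (perturbedWeight c k u t s) =
      foundOpt A c k u t (lower (perturbedWeight c k u t s) i)

/-- Replace the number `x` in slot `i` by `x + d`. -/
def addToSlot (u t : List Bool) (i d : ℕ) : List Bool :=
  writeBits (reserved c k u + i * slotWidth u)
    ((slotBits (reserved c k u + i * slotWidth u) (slotWidth u) t + d) % slotRange u) t (slotWidth u)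

open Classical in
/-- One step of the isolation of a minimizer. -/
noncomputable def raiseStep (u : List Bool) (s : ℕ) (t : List Bool) (i : ℕ) : List Bool :=
  if RaiseTest A c k u t s i then addToSlot c k u t i 1 else t

open Classical in
/-- The inverse of a step of the isolation of a minimizer. -/
noncomputable def lowerStep (u : List Bool) (s : ℕ) (t : List Bool) (i : ℕ) : List Bool :=
  if LowerTest A c k u t s i then addToSlot c k u t i (slotRange u - 1) else t

/-- The `i`-th bit of the output. -/
def OutputBit (u t : List Bool) (s i : ℕ) : Prop :=
  (numWeights u ≤ 1 ∧ ¬ Accepted A c k u t (fun j => if j = i then 1 else 0) 0) ∨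
    (¬ numWeights u ≤ 1 ∧ ¬ RaiseTest A c k u t s i)

open Classical in
/-- A shift for which all perturbations can be raised. -/
noncomputable def slotShift (u t : List Bool) : ℕ :=
  ∑ j ∈ Finset.range (slotRange u),
    if ∀ s < j + 1, ¬ ∀ i < numWeights u, perturbation c k u t s i ≠ slotRange u - 1 then 1 else 0

/-- The number of steps for the isolation of a minimizer. -/
def isolationSteps (u : List Bool) : ℕ := if numWeights u ≤ 1 then 0 else numWeights u

/-- The tape when a minimizer has been isolated. -/
noncomputable def isolatedTape (u : List Bool) (s : ℕ) (t : List Bool) : List Bool :=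
  iterTape (raiseStep A c k u s) t (isolationSteps u)

open Classical in
/-- The output of the search. -/
noncomputable def searchOutput (u : List Bool) (s : ℕ) (t : List Bool) : List Bool :=
  (List.range (numWeights u)).map fun i => decide (OutputBit A c k u t s i)

/-- The tape at the end of the search. -/
noncomputable def restoredTape (u : List Bool) (s : ℕ) (t : List Bool) : List Bool :=
  iterTape (fun w j => lowerStep A c k u s w (isolationSteps u - 1 - j)) t (isolationSteps u)

end Algorithm

/-! ### The search stays within polynomially bounded registers -/

section Space

open Ctx

variable {α : Type} [Ctx α]

theorem LS.closedCount {F : α → List Bool} (hF : LSS F) {p : α → ℕ} (hp : LS p) :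
    LS fun a => closedCount (F a) (p a) :=
  LS.sum (f := fun x => if (F x.1)[2 * x.2]? = some true then 0 else 1)
    (LSP.ite (hF.wk.getElem (LS.mul (LS.const 2) LS.var)) LS.zero (LS.const 1)) hp

theorem LSS.nthString {F : α → List Bool} (hF : LSS F) {j : α → ℕ} (hj : LS j) :
    LSS fun a => nthString (F a) (j a) :=
  LSS.flatMap (G := fun x => if (F x.1)[2 * x.2]? = some true ∧ _root_.closedCount (F x.1) x.2 = j x.1
      then [decide ((F x.1)[2 * x.2 + 1]? = some true)] else [])
    (LSS.ite ((hF.wk.getElem (LS.mul (LS.const 2) LS.var)).and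
        (LSP.eq (LS.closedCount hF.wk LS.var) hj.wk))
      (LSS.singleton (hF.wk.getElem (LS.mul (LS.const 2) LS.var).succ)) LSS.nil)
    (LS.div hF.length (LS.const 2))

theorem ls_numWeights : LS fun a : α => numWeights (inp a) :=
  (LS.closedCount LSS.inp (LS.div LS.inp_length (LS.const 2))).pred

theorem ls_slotWidth : LS fun a : α => slotWidth (inp a) := ls_numWeights.natSize

/-- The next power of two above a positive number is at most its double. A power of two is used so
that the residues are exactly the contents of a slot. -/
theorem slotRange_le (u : List Bool) : slotRange u ≤ 2 * numWeights u + 1 := by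
  unfold slotRange slotWidth
  rcases Nat.eq_zero_or_pos (numWeights u) with h | h
  · simp [h]
  · have h1 : 0 < (numWeights u).size := Nat.size_pos.2 h
    have h2 : 2 ^ ((numWeights u).size - 1) ≤ numWeights u := Nat.lt_size.1 (by omega)
    rw [show (numWeights u).size = (numWeights u).size - 1 + 1 by omega, pow_succ]
    omega

theorem ls_slotRange : LS fun a : α => slotRange (inp a) :=
  (LS.pow_min (LS.const 2) ls_slotWidth (LS.mul (LS.const 2) ls_numWeights).succ).congr
    fun a => (min_eq_left (slotRange_le (inp a))).symm

theorem ls_parsedWeight (c : ℕ) {i : α → ℕ} (hi : LS i) :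
    LS fun a => parsedWeight c (inp a) (i a) :=
  LS.min (LS.sum (f := fun x : α × ℕ => if x.2.bits = nthString (inp x.1) (i x.1 + 1) then x.2 else 0)
    (LSP.ite (LSS.eq (LSS.bits LS.var) (LSS.nthString LSS.inp hi.wk.succ)) LS.var LS.zero)
    (LS.inp_length.pow_const c).succ) (LS.inp_length.pow_const c)

theorem ls_weightScale : LS fun a : α => weightScale (inp a) :=
  (LS.mul ls_numWeights ls_slotRange).succ

theorem ls_weightCap (c : ℕ) : LS fun a : α => weightCap c (inp a) :=
  LS.add (LS.mul (LS.inp_length.pow_const c) ls_weightScale) ls_slotRange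

theorem ls_thresholdCap (c : ℕ) : LS fun a : α => thresholdCap c (inp a) :=
  (LS.mul ls_numWeights (ls_weightCap c)).succ

theorem ls_reserved (c k : ℕ) : LS fun a : α => reserved c k (inp a) := by
  refine LS.pow_const ?_ k
  exact LS.add (LS.add (LS.mul (LS.const 2) (LSS.nthString LSS.inp LS.zero).length).succ.succ
    (LS.mul ls_numWeights (LS.mul (LS.const 2) (ls_weightCap c)).succ.succ))
    (LS.mul (LS.const 2) (ls_thresholdCap c)).succ.succ

theorem lss_decisionQuery (c : ℕ) {w : α × ℕ → ℕ} (hw : LS w) {t : α → ℕ} (ht : LS t) :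
    LSS fun a => decisionQuery c (inp a) (fun i => w (a, i)) (t a) :=
  LSS.append (LSS.append (LSS.encodeString (LSS.nthString LSS.inp LS.zero))
    (LSS.flatMap (G := fun x => encodeString (min (w x) (weightCap c (inp x))).bits)
      (LSS.encodeString (LSS.bits (LS.min hw (ls_weightCap c)))) ls_numWeights))
    (LSS.encodeString (LSS.bits (LS.min ht (ls_thresholdCap c))))

/-- Membership in `A` is decided within any context by a procedure that uses the first `n ^ k` cells
of the tape. -/
def IsOracle (A : Language Bool) (k : ℕ) : Prop :=
  ∀ {α : Type} [Ctx α] (F : α → List Bool), LSS F →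
    (∀ a p, p.length = (F a).length ^ k → (F a).length ^ k ≤ (mem a).tape.length →
      F (setMem a ⟨p ++ (mem a).tape.drop ((F a).length ^ k), (mem a).out⟩) = F a) →
    LSP (fun a => (F a).length ^ k ≤ (mem a).tape.length ∧ F a ∈ A)

/-- Weights that depend on the tape only outside of the reserved part. -/
def TapeLocal (o : α → ℕ) (w : α × ℕ → ℕ) : Prop :=
  ∀ a m, m.tape.drop (o a) = (mem a).tape.drop (o a) → ∀ i, w (setMem a m, i) = w (a, i)

variable {A : Language Bool} {c k : ℕ}

/-- The query depends on the tape through the slots, but the oracle machine alters at most the first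
`reserved` cells. The query is thus stable while it is being answered, as `IsOracle` demands. -/
theorem lsp_accepted (hA : IsOracle A k) {w : α × ℕ → ℕ} (hw : LS w)
    (hl : TapeLocal (fun a => reserved c k (inp a)) w) {t : α → ℕ} (ht : LS t)
    (hm : ∀ a m, t (setMem a m) = t a) :
    LSP fun a => Accepted A c k (inp a) (mem a).tape (fun i => w (a, i)) (t a) := by
  refine hA _ (lss_decisionQuery c hw ht) fun a p hp _ => ?_
  have hle := length_decisionQuery_pow_le c k (inp a) (fun i => w (a, i)) (t a)
  generalize (decisionQuery c (inp a) (fun i => w (a, i)) (t a)).length ^ k = K at *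
  have h1 : ∀ i, w (setMem a ⟨p ++ (mem a).tape.drop K, (mem a).out⟩, i) = w (a, i) := by
    refine hl a _ ?_
    dsimp only
    rw [List.drop_append, List.drop_eq_nil_of_le (by omega), List.nil_append, List.drop_drop, hp]
    congr 1
    omega
  simp only [h1, hm, inp_setMem]

theorem ls_foundOpt (hA : IsOracle A k) {w : α × ℕ → ℕ} (hw : LS w)
    (hl : TapeLocal (fun a => reserved c k (inp a)) w) :
    LS fun a => foundOpt A c k (inp a) (mem a).tape (fun i => w (a, i)) := by
  classical
  have hT : CMap fun x : (α × ℕ) × ℕ => (x.1.1, x.2) := CMap.id.wk.wk.pair LS.var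
  exact LS.sum (LSP.ite (lsp_accepted (α := α × ℕ) (w := fun x => w (x.1.1, x.2)) (t := fun x => x.2)
    hA (hw.comp hT) (fun a m h i => hl a.1 m h i) LS.var (fun _ _ => rfl)) LS.zero (LS.const 1))
    (ls_thresholdCap c)

theorem LS.slotBits {p l : α → ℕ} (hp : LS p) (hl : LS l) (hq : LS fun a => 2 ^ l a) :
    LS fun a => slotBits (p a) (l a) (mem a).tape := by
  refine (LS.sum (f := fun x : α × ℕ => if (mem x).tape[p x.1 + x.2]? = some true then
    Min.min (2 ^ x.2) (2 ^ l x.1) else 0) (LSP.ite ?_ (LS.pow_min (LS.const 2) LS.var hq.wk) LS.zero)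
    hl).congr fun a => ?_
  · exact LSP.comp (T := fun x : α × ℕ => (x, p x.1 + x.2)) (LSP.content_bit true)
      (CMap.id.pair (LS.add hp.wk LS.var))
  · refine Finset.sum_congr rfl fun j hj => ?_
    rw [Finset.mem_range] at hj
    rw [min_eq_left (Nat.pow_le_pow_right (by omega) hj.le)]
    rfl

theorem ls_slotStart {i : α → ℕ} (hi : LS i) :
    LS fun a => reserved c k (inp a) + i a * slotWidth (inp a) :=
  LS.add (ls_reserved c k) (LS.mul hi ls_slotWidth)

theorem ls_slot {i : α → ℕ} (hi : LS i) : LS fun a =>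
    slotBits (reserved c k (inp a) + i a * slotWidth (inp a)) (slotWidth (inp a)) (mem a).tape :=
  LS.slotBits (ls_slotStart hi) ls_slotWidth ls_slotRange

theorem ls_perturbation {s i : α → ℕ} (hs : LS s) (hi : LS i) :
    LS fun a => perturbation c k (inp a) (mem a).tape (s a) (i a) :=
  LS.mod (LS.add (ls_slot hi) hs) ls_slotRange

theorem ls_perturbedWeight {s i : α → ℕ} (hs : LS s) (hi : LS i) :
    LS fun a => perturbedWeight c k (inp a) (mem a).tape (s a) (i a) :=
  LS.add (LS.mul (ls_parsedWeight c hi) ls_weightScale) (ls_perturbation hs hi)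

theorem perturbedWeight_of_drop {u t t' : List Bool}
    (h : t'.drop (reserved c k u) = t.drop (reserved c k u)) (s i : ℕ) :
    perturbedWeight c k u t' s i = perturbedWeight c k u t s i := by
  unfold perturbedWeight perturbation
  rw [slotBits_of_drop (Nat.le_add_right _ _) h]

variable {s i : α → ℕ}

theorem ls_perturbedWeight_var (hs : LS s) :
    LS fun x : α × ℕ => perturbedWeight c k (inp x.1) (mem x.1).tape (s x.1) x.2 :=
  ls_perturbedWeight hs.wk LS.var

theorem tapeLocal_perturbedWeight (hs' : ∀ a m, s (setMem a m) = s a) :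
    TapeLocal (fun a => reserved c k (inp a))
      (fun x : α × ℕ => perturbedWeight c k (inp x.1) (mem x.1).tape (s x.1) x.2) := by
  intro a m hd j
  simp only [hs', inp_setMem, mem_setMem, perturbedWeight_of_drop hd]

theorem ls_foundOpt_raise (hA : IsOracle A k) {w : α × ℕ → ℕ} (hw : LS w)
    (hl : TapeLocal (fun a => reserved c k (inp a)) w) (hi : LS i)
    (hi' : ∀ a m, i (setMem a m) = i a) :
    LS fun a => foundOpt A c k (inp a) (mem a).tape (raise (fun j => w (a, j)) (i a)) := by
  refine ls_foundOpt (w := fun x => if x.2 = i x.1 then w x + 1 else w x) hA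
    (LSP.ite (LSP.eq LS.var hi.wk) hw.succ hw) ?_
  intro a m hd j
  simp only [hi', hl a m hd j]

theorem ls_foundOpt_lower (hA : IsOracle A k) {w : α × ℕ → ℕ} (hw : LS w)
    (hl : TapeLocal (fun a => reserved c k (inp a)) w) (hi : LS i)
    (hi' : ∀ a m, i (setMem a m) = i a) :
    LS fun a => foundOpt A c k (inp a) (mem a).tape (lower (fun j => w (a, j)) (i a)) := by
  refine ls_foundOpt (w := fun x => if x.2 = i x.1 then w x - 1 else w x) hA
    (LSP.ite (LSP.eq LS.var hi.wk) hw.pred hw) ?_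
  intro a m hd j
  simp only [hi', hl a m hd j]

theorem lsp_raiseTest (hA : IsOracle A k) (hs : LS s) (hi : LS i)
    (hs' : ∀ a m, s (setMem a m) = s a) (hi' : ∀ a m, i (setMem a m) = i a) :
    LSP fun a => RaiseTest A c k (inp a) (mem a).tape (s a) (i a) := by
  have hw := ls_perturbedWeight_var (c := c) (k := k) hs
  have hl := tapeLocal_perturbedWeight (c := c) (k := k) hs'
  have h1 := ls_foundOpt_raise hA hw hl hi hi'
  have h2 := ls_foundOpt hA hw hl
  dsimp only at h1 h2
  exact (LSP.eq h1 h2).congr fun a => Iff.rfl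

theorem lsp_lowerTest (hA : IsOracle A k) (hs : LS s) (hi : LS i)
    (hs' : ∀ a m, s (setMem a m) = s a) (hi' : ∀ a m, i (setMem a m) = i a) :
    LSP fun a => LowerTest A c k (inp a) (mem a).tape (s a) (i a) := by
  have hw := ls_perturbedWeight_var (c := c) (k := k) hs
  have hl := tapeLocal_perturbedWeight (c := c) (k := k) hs'
  have h1 := ls_foundOpt_lower hA hw hl hi hi'
  have h2 := ls_foundOpt hA hw hl
  dsimp only at h1 h2
  exact ((LSP.le (LS.const 1) (ls_perturbation hs hi)).and (LSP.eq h2 h1)).congr fun a => Iff.rfl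

theorem impl_addToSlot (hi : LS i) {d : α → ℕ} (hd : LS d) :
    Impl fun a => (⟨addToSlot c k (inp a) (mem a).tape (i a) (d a), (mem a).out⟩, 0) :=
  Impl.writeBits (ls_slotStart hi) (LS.mod (LS.add (ls_slot hi) hd) ls_slotRange) ls_slotWidth

theorem impl_raiseStep (hA : IsOracle A k) (hs : LS s) (hi : LS i)
    (hs' : ∀ a m, s (setMem a m) = s a) (hi' : ∀ a m, i (setMem a m) = i a) :
    Impl fun a => (⟨raiseStep A c k (inp a) (s a) (mem a).tape (i a), (mem a).out⟩, 0) := by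
  classical
  refine (Impl.iteP (lsp_raiseTest (c := c) hA hs hi hs' hi')
    (impl_addToSlot (c := c) (k := k) hi (LS.const 1)) (G := fun a => (mem a, 0)) LS.zero).congr
    fun a => ?_
  unfold raiseStep
  split_ifs <;> rfl

theorem impl_lowerStep (hA : IsOracle A k) (hs : LS s) (hi : LS i)
    (hs' : ∀ a m, s (setMem a m) = s a) (hi' : ∀ a m, i (setMem a m) = i a) :
    Impl fun a => (⟨lowerStep A c k (inp a) (s a) (mem a).tape (i a), (mem a).out⟩, 0) := by
  classical
  refine (Impl.iteP (lsp_lowerTest (c := c) hA hs hi hs' hi')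
    (impl_addToSlot (c := c) (k := k) hi ls_slotRange.pred) (G := fun a => (mem a, 0)) LS.zero).congr
    fun a => ?_
  unfold lowerStep
  split_ifs <;> rfl

theorem lsp_outputBit (hA : IsOracle A k) (hs : LS s) (hi : LS i)
    (hs' : ∀ a m, s (setMem a m) = s a) (hi' : ∀ a m, i (setMem a m) = i a) :
    LSP fun a => OutputBit A c k (inp a) (mem a).tape (s a) (i a) := by
  have h1 : LSP fun a : α => numWeights (inp a) ≤ 1 := LSP.le ls_numWeights (LS.const 1)
  refine (h1.and (lsp_accepted (w := fun x => if x.2 = i x.1 then 1 else 0) hA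
    (LSP.ite (LSP.eq LS.var hi.wk) (LS.const 1) LS.zero) ?_ LS.zero fun _ _ => rfl).not).or
    (h1.not.and (lsp_raiseTest hA hs hi hs' hi').not)
  intro a m _ j
  simp [hi']

theorem ls_slotShift : LS fun a : α => slotShift c k (inp a) (mem a).tape := by
  classical
  have h : LSP fun x : ((α × ℕ) × ℕ) × ℕ =>
      perturbation c k (inp x) (mem x).tape x.1.2 x.2 ≠ slotRange (inp x) - 1 :=
    (LSP.eq (ls_perturbation LS.var.wk LS.var) ls_slotRange.pred).not
  exact LS.sum (LSP.ite (LSP.forall_lt (LSP.forall_lt h ls_numWeights).not LS.var.succ)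
    (LS.const 1) LS.zero) ls_slotRange

theorem ls_isolationSteps : LS fun a : α => isolationSteps (inp a) :=
  LSP.ite (LSP.le ls_numWeights (LS.const 1)) LS.zero ls_numWeights

/-- The search, once it is known that there is something to be found. -/
noncomputable def search (A : Language Bool) (c k : ℕ) (a : α) : Mem :=
  let u := inp a
  let s := slotShift c k u (mem a).tape
  let t := isolatedTape A c k u s (mem a).tape
  ⟨restoredTape A c k u s t, (mem a).out ++ searchOutput A c k u s t⟩

theorem impl_search (hA : IsOracle A k) : Impl fun a : α => (search A c k a, 0) := by
  classical
  have h1 : Impl fun x : α × ℕ =>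
      ((⟨isolatedTape A c k (inp x) x.2 (mem x).tape, (mem x).out⟩ : Mem), 0) :=
    Impl.iterTape (f := fun x : α × ℕ => raiseStep A c k (inp x) x.2) (n := fun x => isolationSteps (inp x))
      (impl_raiseStep (α := ((α × ℕ) × ℕ) × ℕ) (s := fun x => x.1.1.2) (i := fun x => x.1.2) hA
        LS.var.wk.wk LS.var.wk (fun _ _ => rfl) (fun _ _ => rfl)) ls_isolationSteps
      (fun _ _ => by simp only [inp_setMem]; rfl)
  have h2 : Impl fun x : α × ℕ =>
      ((⟨(mem x).tape, (mem x).out ++ searchOutput A c k (inp x) x.2 (mem x).tape⟩ : Mem), 0) :=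
    Impl.emitAll (g := fun y : (α × ℕ) × ℕ => OutputBit A c k (inp y) (mem y).tape y.1.2 y.2)
      (n := fun x => numWeights (inp x))
      (lsp_outputBit hA LS.var.wk LS.var (fun _ _ => rfl) (fun _ _ => rfl)) ls_numWeights
      (fun _ _ _ => by simp only [inp_prod, mem_prod, inp_setMem, mem_setMem]; rfl)
  have h3 : Impl fun x : α × ℕ =>
      ((⟨restoredTape A c k (inp x) x.2 (mem x).tape, (mem x).out⟩ : Mem), 0) :=
    Impl.iterTape (f := fun (x : α × ℕ) w j => lowerStep A c k (inp x) x.2 w (isolationSteps (inp x) - 1 - j))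
      (n := fun x => isolationSteps (inp x))
      (impl_lowerStep (α := ((α × ℕ) × ℕ) × ℕ) (s := fun x => x.1.1.2)
        (i := fun x => isolationSteps (inp x) - 1 - x.1.2) hA
        LS.var.wk.wk (LS.sub ls_isolationSteps.pred LS.var.wk) (fun _ _ => rfl)
        (fun _ _ => by simp only [inp_setMem]; rfl)) ls_isolationSteps
      (fun _ _ => by simp only [inp_setMem]; rfl)
  -- The shift is computed from the original tape and then kept as a variable, so that isolation,
  -- output and restoration all use the same one.
  have h4 := LS.bind (ls_slotShift (c := c) (k := k)) (Impl.bind h1 (Impl.bind h2.wk h3.wk.wk))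
  exact h4.congr fun a => by simp [search]

end Space


/-! ### Correctness of the search -/

/-- The code `u` belongs to a string whose set `S` of witnesses is not empty, and `A` is the
weighted decision problem. -/
structure Searchable {M : ℕ} (A : Language Bool) (c k : ℕ) (u : List Bool)
    (S : Set (Fin M → Bool)) : Prop where
  num : numWeights u = M
  nonempty : S.Nonempty
  weight_le : ∀ i < M, parsedWeight c u i ≤ M ^ c
  accepted : ∀ (w : ℕ → ℕ) (t₀ : ℕ) (t : List Bool), reserved c k u ≤ t.length →
    (∀ i < M, w i ≤ weightCap c u) → (∀ i < M, w i ≤ M ^ (c + 5)) → t₀ ≤ thresholdCap c u →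
    (Accepted A c k u t w t₀ ↔ ∃ y ∈ S, listWeight w y ≤ t₀)

theorem slotRange_pos (u : List Bool) : 0 < slotRange u := Nat.two_pow_pos _

theorem lt_slotRange (u : List Bool) : numWeights u < slotRange u := Nat.lt_size_self _

theorem perturbation_lt (c k : ℕ) (u t : List Bool) (s i : ℕ) :
    perturbation c k u t s i < slotRange u := Nat.mod_lt _ (slotRange_pos u)

theorem raise_lower {w : ℕ → ℕ} {i : ℕ} (h : 1 ≤ w i) : raise (lower w i) i = w := by
  funext j
  unfold raise lower
  split_ifs with hj
  · subst hj; omega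
  · rfl

theorem lower_raise (w : ℕ → ℕ) (i : ℕ) : lower (raise w i) i = w := by
  funext j
  unfold raise lower
  by_cases hj : j = i <;> simp [hj]

theorem length_addToSlot (c k : ℕ) (u t : List Bool) (i d : ℕ) :
    (addToSlot c k u t i d).length = t.length := length_writeBits _ _ _ _

theorem slot_fits {c k : ℕ} {u t : List Bool}
    (ht : reserved c k u + numWeights u * slotWidth u ≤ t.length) {i : ℕ} (hi : i < numWeights u) :
    reserved c k u + i * slotWidth u + slotWidth u ≤ t.length := by
  have : (i + 1) * slotWidth u ≤ numWeights u * slotWidth u := Nat.mul_le_mul_right _ hi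
  rw [add_mul, one_mul] at this
  omega

theorem perturbation_addToSlot_of_ne {c k : ℕ} {u t : List Bool} {s i j d : ℕ} (h : j ≠ i) :
    perturbation c k u (addToSlot c k u t i d) s j = perturbation c k u t s j := by
  unfold perturbation addToSlot
  rw [slotBits_writeBits_of_disjoint]
  rcases Nat.lt_or_gt_of_ne h with h | h
  · left
    have : (j + 1) * slotWidth u ≤ i * slotWidth u := Nat.mul_le_mul_right _ h
    rw [add_mul, one_mul] at this
    omega
  · right
    have : (i + 1) * slotWidth u ≤ j * slotWidth u := Nat.mul_le_mul_right _ h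
    rw [add_mul, one_mul] at this
    omega

theorem perturbation_addToSlot {c k : ℕ} {u t : List Bool}
    (ht : reserved c k u + numWeights u * slotWidth u ≤ t.length) {s i : ℕ} (hi : i < numWeights u)
    (h : perturbation c k u t s i ≠ slotRange u - 1) :
    perturbation c k u (addToSlot c k u t i 1) s i = perturbation c k u t s i + 1 := by
  unfold perturbation addToSlot at *
  rw [slotBits_writeBits (v := _ % slotRange u) (Nat.mod_lt _ (slotRange_pos u)) (slot_fits ht hi)]
  exact shift_raise_mod h (slotRange_pos u)

theorem perturbedWeight_addToSlot {c k : ℕ} {u t : List Bool}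
    (ht : reserved c k u + numWeights u * slotWidth u ≤ t.length) {s i : ℕ} (hi : i < numWeights u)
    (h : perturbation c k u t s i ≠ slotRange u - 1) :
    perturbedWeight c k u (addToSlot c k u t i 1) s = raise (perturbedWeight c k u t s) i := by
  funext j
  unfold perturbedWeight raise
  split_ifs with hj
  · subst hj
    rw [perturbation_addToSlot ht hi h, add_assoc]
  · rw [perturbation_addToSlot_of_ne hj]

/-- Adding `slotRange u - 1` is subtracting 1 modulo the range. No overflow condition is needed,
since the stored numbers are residues. -/
theorem addToSlot_addToSlot {c k : ℕ} {u t : List Bool}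
    (ht : reserved c k u + numWeights u * slotWidth u ≤ t.length) {i : ℕ} (hi : i < numWeights u) :
    addToSlot c k u (addToSlot c k u t i 1) i (slotRange u - 1) = t := by
  unfold addToSlot
  rw [slotBits_writeBits (v := _ % slotRange u) (Nat.mod_lt _ (slotRange_pos u)) (slot_fits ht hi),
    mod_raise_lower (q := slotRange u) (slotBits_lt _ _ _),
    writeBits_writeBits_slotBits]

/-- This is the origin of the exponent `c + 5`. Scaling and perturbation cost a factor quadratic in
`M`, whose constants are absorbed by further powers of `M` only if `M ≥ 2`. -/
theorem weight_bound {M c a q : ℕ} (hM : 2 ≤ M) (ha : a ≤ M ^ c) (hq : q ≤ 2 * M + 1) :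
    a * (M * q + 1) + q ≤ M ^ (c + 5) := by
  have h1 : 1 ≤ M ^ c := Nat.one_le_pow _ _ (by omega)
  have h2 : M * q + 1 + q ≤ M ^ 5 := by
    have e1 : M * q ≤ M * (2 * M + 1) := Nat.mul_le_mul_left _ hq
    have e2 : 2 * M ≤ M * M := Nat.mul_le_mul_right _ hM
    have e3 : 2 * (M * M) ≤ M * (M * M) := Nat.mul_le_mul_right _ hM
    have e4 : 2 * (M * (M * M)) ≤ M * (M * (M * M)) := Nat.mul_le_mul_right _ hM
    have e5 : 2 * (M * (M * (M * M))) ≤ M * (M * (M * (M * M))) := Nat.mul_le_mul_right _ hM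
    have e6 : M ^ 5 = M * (M * (M * (M * M))) := by ring
    have e7 : M * (2 * M + 1) = 2 * (M * M) + M := by ring
    omega
  calc a * (M * q + 1) + q ≤ M ^ c * (M * q + 1) + M ^ c * q :=
        Nat.add_le_add (Nat.mul_le_mul_right _ ha) (Nat.le_mul_of_pos_left _ h1)
    _ = M ^ c * (M * q + 1 + q) := by ring
    _ ≤ M ^ c * M ^ 5 := Nat.mul_le_mul_left _ h2
    _ = M ^ (c + 5) := (pow_add _ _ _).symm

namespace Searchable

variable {M : ℕ} {A : Language Bool} {c k : ℕ} {u : List Bool} {S : Set (Fin M → Bool)}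

theorem foundOpt_eq (h : Searchable A c k u S) {t : List Bool} {w : ℕ → ℕ} (ht : reserved c k u ≤ t.length)
    (h1 : ∀ i < M, w i ≤ weightCap c u) (h2 : ∀ i < M, w i ≤ M ^ (c + 5)) :
    foundOpt A c k u t w = optWeight S (thresholdCap c u) w := by
  classical
  unfold foundOpt optWeight
  refine Finset.sum_congr rfl fun t₀ ht₀ => ?_
  rw [Finset.mem_range] at ht₀
  simp only [h.accepted w t₀ t ht h1 h2 ht₀.le]

theorem succ_perturbedWeight_le_cap {t : List Bool} {s i : ℕ} :
    parsedWeight c u i * weightScale u + perturbation c k u t s i + 1 ≤ weightCap c u := by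
  have h1 := perturbation_lt c k u t s i
  have h2 : parsedWeight c u i * weightScale u ≤ u.length ^ c * weightScale u :=
    Nat.mul_le_mul_right _ (min_le_right _ _)
  unfold weightCap
  omega

theorem succ_perturbedWeight_le_pow (h : Searchable A c k u S) (hM : 2 ≤ M) {t : List Bool}
    {s i : ℕ} (hi : i < M) :
    parsedWeight c u i * weightScale u + perturbation c k u t s i + 1 ≤ M ^ (c + 5) := by
  have h1 := perturbation_lt c k u t s i
  have h2 := weight_bound hM (h.weight_le i hi) (h.num ▸ slotRange_le u)
  have h3 : weightScale u = M * slotRange u + 1 := by rw [weightScale, h.num]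
  rw [h3]
  omega

/-- The caps leave room for one increment, so the oracle answers correctly for the raised weights
too and `foundOpt` is the true optimum on both sides. -/
theorem raiseTest_iff (h : Searchable A c k u S) (hM : 2 ≤ M) {t : List Bool} (ht : reserved c k u ≤ t.length) (s : ℕ)
    (i : Fin M) : RaiseTest A c k u t s i ↔
      ∃ y ∈ minimizers S (perturbedWeight c k u t s), y i = false := by
  unfold RaiseTest
  have e1 : ∀ j < M, perturbedWeight c k u t s j + 1 ≤ weightCap c u := fun j _ => succ_perturbedWeight_le_cap
  have e2 : ∀ j < M, perturbedWeight c k u t s j + 1 ≤ M ^ (c + 5) := fun j => h.succ_perturbedWeight_le_pow hM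
  have e3 : ∀ j, raise (perturbedWeight c k u t s) i j ≤ perturbedWeight c k u t s j + 1 := by
    intro j
    unfold raise
    split_ifs <;> omega
  rw [h.foundOpt_eq ht (fun j hj => (e3 j).trans (e1 j hj)) (fun j hj => (e3 j).trans (e2 j hj)),
    h.foundOpt_eq ht (fun j hj => (Nat.le_succ _).trans (e1 j hj))
      (fun j hj => (Nat.le_succ _).trans (e2 j hj))]
  refine optWeight_raise_eq_iff h.nonempty i fun y => ?_
  have := listWeight_le (fun j hj => (Nat.le_succ _).trans (e1 j hj)) y
  unfold thresholdCap
  rw [h.num]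
  omega

theorem lowerTest_iff (h : Searchable A c k u S) (hM : 2 ≤ M) {t : List Bool} (ht : reserved c k u ≤ t.length) (s : ℕ)
    (i : Fin M) : LowerTest A c k u t s i ↔ 1 ≤ perturbation c k u t s i ∧
      ∃ y ∈ minimizers S (lower (perturbedWeight c k u t s) i), y i = false := by
  unfold LowerTest
  refine and_congr_right fun hp => ?_
  have e1 : ∀ j < M, perturbedWeight c k u t s j ≤ weightCap c u :=
    fun j _ => (Nat.le_succ _).trans succ_perturbedWeight_le_cap
  have e2 : ∀ j < M, perturbedWeight c k u t s j ≤ M ^ (c + 5) :=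
    fun j hj => (Nat.le_succ _).trans (h.succ_perturbedWeight_le_pow hM hj)
  have e3 : ∀ j, lower (perturbedWeight c k u t s) i j ≤ perturbedWeight c k u t s j := by
    intro j
    unfold lower
    split_ifs <;> omega
  have e4 : 1 ≤ perturbedWeight c k u t s i := hp.trans (Nat.le_add_left _ _)
  rw [h.foundOpt_eq ht (fun j hj => (e3 j).trans (e1 j hj)) (fun j hj => (e3 j).trans (e2 j hj)),
    h.foundOpt_eq ht e1 e2]
  have key := optWeight_raise_eq_iff (B := thresholdCap c u)
    (w := lower (perturbedWeight c k u t s) i) h.nonempty i fun y => ?_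
  · rwa [raise_lower e4] at key
  · have := listWeight_le (fun j hj => (e3 j).trans (e1 j hj)) y
    unfold thresholdCap
    rw [h.num]
    omega

/-- If the slot was raised, the lowered weights are the old ones and the test that led to raising
succeeds again. If not, all minimizers contain `i`, and by `forall_minimizers_of_raise` this is
still so after lowering, so the test fails and nothing is undone. -/
theorem lowerStep_raiseStep (h : Searchable A c k u S) (hM : 2 ≤ M) {t : List Bool}
    (ht : reserved c k u + numWeights u * slotWidth u ≤ t.length) {s : ℕ} (i : Fin M)
    (hp : perturbation c k u t s i ≠ slotRange u - 1) :
    lowerStep A c k u s (raiseStep A c k u s t i) i = t := by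
  have hi : (i : ℕ) < numWeights u := h.num ▸ i.2
  have ht' : reserved c k u ≤ t.length := by omega
  have hr := h.raiseTest_iff hM ht' s i
  unfold raiseStep
  split_ifs with h1
  · have h2 : LowerTest A c k u (addToSlot c k u t i 1) s i := by
      rw [h.lowerTest_iff hM (by rwa [length_addToSlot]), perturbation_addToSlot ht hi hp,
        perturbedWeight_addToSlot ht hi hp, lower_raise]
      exact ⟨by omega, hr.1 h1⟩
    rw [lowerStep, if_pos h2, addToSlot_addToSlot ht hi]
  · rw [lowerStep, if_neg]
    rw [h.lowerTest_iff hM ht']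
    rintro ⟨h2, h3⟩
    have e4 : 1 ≤ perturbedWeight c k u t s i := h2.trans (Nat.le_add_left _ _)
    refine forall_minimizers_of_raise ?_ h3
    rw [raise_lower e4]
    exact fun h4 => h1 (hr.2 h4)

/-- Three invariants of the isolation. The slots not yet visited are untouched and still avoid
overflow, and the minimizers agree at all visited positions; this agreement persists because the set
of minimizers only shrinks. -/
theorem iterTape_raiseStep (h : Searchable A c k u S) (hM : 2 ≤ M) {t : List Bool}
    (ht : reserved c k u + numWeights u * slotWidth u ≤ t.length) {s : ℕ}
    (hp : ∀ i < numWeights u, perturbation c k u t s i ≠ slotRange u - 1) {j : ℕ} (hj : j ≤ M) :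
    (iterTape (raiseStep A c k u s) t j).length = t.length ∧
    (∀ i, j ≤ i → i < numWeights u →
      perturbation c k u (iterTape (raiseStep A c k u s) t j) s i ≠ slotRange u - 1) ∧
    ∀ i : Fin M, (i : ℕ) < j →
      ∀ y ∈ minimizers S (perturbedWeight c k u (iterTape (raiseStep A c k u s) t j) s),
      ∀ z ∈ minimizers S (perturbedWeight c k u (iterTape (raiseStep A c k u s) t j) s),
        y i = z i := by
  induction j with
  | zero => exact ⟨rfl, fun i _ => hp i, fun i hi => absurd hi (Nat.not_lt_zero _)⟩
  | succ j ih =>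
    obtain ⟨h1, h2, h3⟩ := ih (by omega)
    rw [iterTape]
    generalize iterTape (raiseStep A c k u s) t j = T at *
    have hjn : j < numWeights u := by rw [h.num]; omega
    have hT : reserved c k u + numWeights u * slotWidth u ≤ T.length := by rwa [h1]
    have hr := h.raiseTest_iff hM (t := T) (by omega) s ⟨j, by omega⟩
    dsimp only at hr
    unfold raiseStep
    split_ifs with h4
    · refine ⟨by rw [length_addToSlot, h1], fun i hi => ?_, ?_⟩
      · rw [perturbation_addToSlot_of_ne (by omega)]
        exact h2 i (by omega)
      · rw [perturbedWeight_addToSlot hT hjn (h2 j le_rfl hjn),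
          minimizers_raise _ ⟨j, by omega⟩ (hr.1 h4)]
        rintro i hi y ⟨hy, hy0⟩ z ⟨hz, hz0⟩
        rcases Nat.lt_succ_iff_lt_or_eq.1 hi with hi | hi
        · exact h3 i hi y hy z hz
        · have hij : i = ⟨j, by omega⟩ := Fin.ext hi
          rw [hij, hy0, hz0]
    · refine ⟨h1, fun i hi => h2 i (by omega), fun i hi y hy z hz => ?_⟩
      rcases Nat.lt_succ_iff_lt_or_eq.1 hi with hi | hi
      · exact h3 i hi y hy z hz
      · have hij : i = ⟨j, by omega⟩ := Fin.ext hi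
        have key : ∀ y ∈ minimizers S (perturbedWeight c k u T s), y ⟨j, by omega⟩ = true := by
          intro y hy
          by_contra h5
          exact h4 (hr.2 ⟨y, hy, by simpa using h5⟩)
        rw [hij, key y hy, key z hz]

theorem isolationSteps_eq (h : Searchable A c k u S) (hM : 2 ≤ M) : isolationSteps u = M := by
  rw [isolationSteps, h.num, if_neg (by omega)]

theorem restoredTape_eq (h : Searchable A c k u S) (hM : 2 ≤ M) {t : List Bool}
    (ht : reserved c k u + numWeights u * slotWidth u ≤ t.length) {s : ℕ}
    (hp : ∀ i < numWeights u, perturbation c k u t s i ≠ slotRange u - 1) :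
    restoredTape A c k u s (isolatedTape A c k u s t) = t := by
  unfold restoredTape isolatedTape
  refine iterTape_reverse fun i hi => ?_
  rw [h.isolationSteps_eq hM] at hi
  obtain ⟨h1, h2, -⟩ := h.iterTape_raiseStep hM ht hp hi.le
  exact h.lowerStep_raiseStep hM (by rwa [h1]) ⟨i, hi⟩ (h2 i le_rfl (by rwa [h.num]))

theorem searchOutput_eq_of (h : Searchable A c k u S) {s : ℕ} {t : List Bool} {y : Fin M → Bool}
    (hy : ∀ i : Fin M, OutputBit A c k u t s i ↔ y i = true) :
    searchOutput A c k u s t = List.ofFn y := by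
  refine List.ext_getElem (by simp [searchOutput, h.num]) fun i h1 h2 => ?_
  have := hy ⟨i, by simpa using h2⟩
  dsimp only at this
  simp [searchOutput, this]

theorem exists_searchOutput_of_two_le (h : Searchable A c k u S) (hM : 2 ≤ M) {t : List Bool}
    (ht : reserved c k u + numWeights u * slotWidth u ≤ t.length) {s : ℕ}
    (hp : ∀ i < numWeights u, perturbation c k u t s i ≠ slotRange u - 1) :
    ∃ y ∈ minimizers S (parsedWeight c u),
      searchOutput A c k u s (isolatedTape A c k u s t) = List.ofFn y := by
  obtain ⟨h1, -, h3⟩ := h.iterTape_raiseStep hM ht hp le_rfl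
  unfold isolatedTape
  rw [h.isolationSteps_eq hM]
  generalize iterTape (raiseStep A c k u s) t M = T at *
  obtain ⟨y, hy⟩ := minimizers_nonempty h.nonempty (perturbedWeight c k u T s)
  -- `M` perturbations below `slotRange u` sum to less than the scale `M * slotRange u + 1`.
  refine ⟨y, minimizers_subset_of_perturbed (v := perturbation c k u T s) (fun z => ?_) hy,
    h.searchOutput_eq_of fun i => ?_⟩
  · refine (listWeight_le (fun i _ => (perturbation_lt c k u T s i).le) z).trans_lt ?_
    rw [weightScale, h.num]
    exact Nat.lt_succ_self _
  · unfold OutputBit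
    rw [h.num, h.raiseTest_iff hM (by omega)]
    constructor
    · rintro (⟨h4, -⟩ | ⟨-, h4⟩)
      · omega
      · by_contra h5
        exact h4 ⟨y, hy, by simpa using h5⟩
    · intro h4
      refine Or.inr ⟨by omega, ?_⟩
      rintro ⟨z, hz, h5⟩
      rw [h3 i i.2 z hz y hy, h4] at h5
      cases h5

/-- Here `M ^ (c + 5) ≤ 1` leaves no room for perturbed weights, but none are needed. With at most
one position, a witness with bit 0 is optimal whenever there is one. Weight 1 at that position and
threshold 0 ask for such a witness. -/
theorem exists_searchOutput_of_le_one (h : Searchable A c k u S) (hM : M ≤ 1) {t : List Bool}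
    (ht : reserved c k u ≤ t.length) {s : ℕ} :
    ∃ y ∈ minimizers S (parsedWeight c u), searchOutput A c k u s t = List.ofFn y := by
  have hi : ∀ i : Fin M, OutputBit A c k u t s i ↔ ¬ ∃ y ∈ S, y i = false := by
    intro i
    have e1 : (fun j => if j = (i : ℕ) then 1 else 0) = raise (fun _ => 0) i := rfl
    have e2 : ∀ j, (if j = (i : ℕ) then 1 else 0) ≤ 1 := fun j => by split_ifs <;> omega
    have e3 : ∀ y : Fin M → Bool, listWeight (fun _ => 0) y = 0 := fun y => by
      simp [listWeight, witnessWeight]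
    unfold OutputBit
    rw [h.num, h.accepted _ _ _ ht (fun j _ => (e2 j).trans
      (Nat.one_le_iff_ne_zero.2 (by have := slotRange_pos u; unfold weightCap; omega)))
      (fun j hj => (e2 j).trans (Nat.one_le_pow _ _ (by omega))) (Nat.zero_le _), e1]
    simp only [hM, true_and, not_true, false_and, or_false, listWeight_raise, e3, zero_add]
    refine not_congr (exists_congr fun y => and_congr_right fun _ => ?_)
    cases y i <;> simp
  have hw : ∀ w : ℕ → ℕ, ∀ y z : Fin M → Bool, (∀ i, y i = true → z i = true) →
      listWeight w y ≤ listWeight w z := by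
    intro w y z hyz
    unfold listWeight witnessWeight
    refine Finset.sum_le_sum fun i _ => ?_
    by_cases h1 : y i = true
    · rw [if_pos h1, if_pos (hyz i h1)]
    · rw [if_neg h1]
      exact Nat.zero_le _
  have hsub : ∀ i j : Fin M, i = j := fun i j => Fin.ext (by omega)
  by_cases h1 : ∃ i : Fin M, ∃ y ∈ S, y i = false
  · obtain ⟨i, y, hy, h0⟩ := h1
    refine ⟨y, ⟨hy, fun z _ => hw _ _ _ fun j hj => ?_⟩, h.searchOutput_eq_of fun j => ?_⟩
    · rw [hsub j i, h0] at hj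
      cases hj
    · rw [hi, hsub j i, h0]
      simp only [Bool.false_eq_true, iff_false, not_not]
      exact ⟨y, hy, h0⟩
  · push Not at h1
    obtain ⟨y, hy⟩ := h.nonempty
    have h2 : ∀ z ∈ S, ∀ i, z i = true := fun z hz i => by simpa using h1 i z hz
    refine ⟨y, ⟨hy, fun z hz => hw _ _ _ fun j _ => h2 z hz j⟩, h.searchOutput_eq_of fun j => ?_⟩
    rw [hi, h2 y hy]
    simp only [iff_true]
    rintro ⟨z, hz, h3⟩
    rw [h2 z hz] at h3
    cases h3

theorem correct (h : Searchable A c k u S) {t : List Bool} (ht : reserved c k u + numWeights u * slotWidth u ≤ t.length) :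
    restoredTape A c k u (slotShift c k u t) (isolatedTape A c k u (slotShift c k u t) t) = t ∧
    ∃ y ∈ minimizers S (parsedWeight c u),
      searchOutput A c k u (slotShift c k u t) (isolatedTape A c k u (slotShift c k u t) t) =
        List.ofFn y := by
  classical
  rcases Nat.lt_or_ge 1 M with hM | hM
  · have hp : ∀ i < numWeights u, perturbation c k u t (slotShift c k u t) i ≠ slotRange u - 1 := by
      -- `slotShift` counts the numbers below the least good shift, and `exists_shift` ensures that
      -- a good one exists below `slotRange u`.
      obtain ⟨s, -, hs, he⟩ := sum_forall_not_eq_find (p := fun s => ∀ i < numWeights u,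
        perturbation c k u t s i ≠ slotRange u - 1) (exists_shift (lt_slotRange u) _)
      rw [show slotShift c k u t = s by rw [← he]; rfl]
      exact hs
    exact ⟨h.restoredTape_eq hM ht hp, h.exists_searchOutput_of_two_le hM ht hp⟩
  · have h0 : isolationSteps u = 0 := by rw [isolationSteps, h.num, if_pos hM]
    unfold restoredTape isolatedTape
    rw [h0]
    exact ⟨rfl, h.exists_searchOutput_of_le_one hM (by simp only [iterTape]; omega)⟩

end Searchable


/-! ### Instances -/

theorem encodeStrings_eq_append {l : List (List Bool)} (hl : l ≠ []) :
    ∃ v, encodeStrings l = v ++ [false, false] := by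
  rcases List.eq_nil_or_concat l with rfl | ⟨l', w, rfl⟩
  · exact absurd rfl hl
  · rw [List.concat_eq_append, encodeStrings_append, encodeStrings_cons]
    exact ⟨encodeStrings l' ++ (w.flatMap fun b => [true, b]), by simp [encodeString, encodeStrings]⟩

/-- The last two symbols are zeros. -/
def EndsInZeros (u : List Bool) : Prop :=
  2 ≤ u.length ∧ ¬ u[u.length - 2]? = some true ∧ ¬ u[u.length - 1]? = some true

theorem endsInZeros_iff (u : List Bool) : EndsInZeros u ↔ ∃ v, u = v ++ [false, false] := by
  constructor
  · rintro ⟨h1, h2, h3⟩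
    rcases List.eq_nil_or_concat u with rfl | ⟨u, a, rfl⟩
    · simp at h1
    rcases List.eq_nil_or_concat u with rfl | ⟨u, b, rfl⟩
    · simp at h1
    refine ⟨u, ?_⟩
    simp only [List.concat_eq_append, List.append_assoc, List.length_append, List.length_cons,
      List.length_nil] at h2 h3 ⊢
    cases a <;> cases b <;> simp_all
  · rintro ⟨v, rfl⟩
    simp [EndsInZeros]

/-- The decision instance that shows whether a string is a search instance with a solution. -/
def validityQuery (c : ℕ) (u : List Bool) : List Bool :=
  u ++ encodeString (u.length ^ (c + 1)).bits

theorem encodeDecisionInstance_eq (x : List Bool) {M : ℕ} (W : Fin M → ℕ) (w₀ : ℕ) :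
    encodeDecisionInstance x W w₀ = encodeSearchInstance x W ++ encodeString w₀.bits := by
  unfold encodeDecisionInstance encodeSearchInstance
  rw [encodeStrings_append, encodeStrings_cons w₀.bits]
  simp [encodeStrings]

theorem length_le_of_encodeSearchInstance (x : List Bool) {M : ℕ} (W : Fin M → ℕ) :
    2 * (M + 1) ≤ (encodeSearchInstance x W).length := by
  have := length_le_length_encodeStrings (x :: List.ofFn fun i => (W i).bits)
  simpa [encodeSearchInstance] using this

section Instances

variable {m : ℕ → ℕ} {R : (x : List Bool) → (Fin (m x.length) → Bool) → Prop}

/-- The threshold `u.length ^ (c + 1)` is at least the weight of any witness, so the query only asks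
for existence. Ending in `00` makes the cut before the threshold unambiguous: otherwise the last
string of `u` could run on into the appended code. -/
theorem valid_iff (c : ℕ) (u : List Bool) :
    (EndsInZeros u ∧ validityQuery c u ∈ weightedDecision m R c) ↔
    ∃ (x : List Bool) (W : Fin (m x.length) → ℕ), u = encodeSearchInstance x W ∧
      (∀ i, W i ≤ m x.length ^ c) ∧ ∃ y, R x y := by
  rw [endsInZeros_iff]
  constructor
  · rintro ⟨⟨v, rfl⟩, x, W, w₀, he, hW, y, hy, -⟩
    refine ⟨x, W, ?_, hW, y, hy⟩
    rw [validityQuery, encodeDecisionInstance_eq] at he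
    obtain ⟨v', hv'⟩ := encodeStrings_eq_append (l := x :: List.ofFn fun i => (W i).bits) (by simp)
    rw [encodeSearchInstance, hv'] at he ⊢
    rw [(append_encodeString_inj he).1]
  · rintro ⟨x, W, rfl, hW, y, hy⟩
    refine ⟨encodeStrings_eq_append (by simp), x, W, _, (encodeDecisionInstance_eq x W _).symm, hW,
      y, hy, ?_⟩
    have hM := length_le_of_encodeSearchInstance x W
    calc witnessWeight W y ≤ ∑ _i : Fin (m x.length), m x.length ^ c :=
          Finset.sum_le_sum fun i _ => by
            split_ifs
            · exact hW i
            · exact Nat.zero_le _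
      _ = m x.length ^ (c + 1) := by simp [pow_succ']
      _ ≤ _ := Nat.pow_le_pow_left (by omega) _

theorem numWeights_encode (x : List Bool) {M : ℕ} (W : Fin M → ℕ) :
    numWeights (encodeSearchInstance x W) = M := by
  unfold numWeights encodeSearchInstance
  rw [closedCount_encodeStrings]
  simp

theorem nthString_encode_zero (x : List Bool) {M : ℕ} (W : Fin M → ℕ) :
    nthString (encodeSearchInstance x W) 0 = x := by
  unfold encodeSearchInstance
  rw [nthString_encodeStrings _ _ (by simp)]
  rfl

theorem Nat.bits_inj' {v w : ℕ} (h : v.bits = w.bits) : v = w := by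
  refine Nat.eq_of_testBit_eq fun j => ?_
  rw [Bool.eq_iff_iff, ← Nat.getElem?_bits, ← Nat.getElem?_bits, h]

/-- Binary expansions are injective, so a single term of the defining sum survives. It lies in the
range of summation because `M` is at most the length of the code. -/
theorem parsedWeight_encode (x : List Bool) {M c : ℕ} (W : Fin M → ℕ) (hW : ∀ i, W i ≤ M ^ c)
    (i : Fin M) : parsedWeight c (encodeSearchInstance x W) i = W i := by
  have h1 : nthString (encodeSearchInstance x W) (i + 1) = (W i).bits := by
    unfold encodeSearchInstance
    rw [nthString_encodeStrings _ _ (by simp)]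
    simp
  have h2 : W i ≤ (encodeSearchInstance x W).length ^ c := (hW i).trans
    (Nat.pow_le_pow_left (by have := length_le_of_encodeSearchInstance x W; omega) c)
  unfold parsedWeight
  rw [h1, Finset.sum_eq_single (W i), if_pos rfl, min_eq_left h2]
  · exact fun v _ hv => if_neg fun h => hv (Nat.bits_inj' h)
  · intro h
    rw [Finset.mem_range] at h
    omega

theorem mem_weightedDecision_iff {c : ℕ} (x : List Bool) (W : Fin (m x.length) → ℕ)
    (hW : ∀ i, W i ≤ m x.length ^ c) (w₀ : ℕ) :
    encodeDecisionInstance x W w₀ ∈ weightedDecision m R c ↔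
      ∃ y, R x y ∧ witnessWeight W y ≤ w₀ := by
  constructor
  · rintro ⟨x', W', w₀', he, -, h⟩
    have h1 := encodeStrings_injective he
    rw [List.cons_append, List.cons_append, List.cons.injEq] at h1
    obtain ⟨rfl, h2⟩ := h1
    obtain ⟨h3, h4⟩ := List.append_inj h2 (by simp)
    obtain rfl : w₀ = w₀' := Nat.bits_inj' (by simpa using h4)
    obtain rfl : W = W' := funext fun i => Nat.bits_inj' (congrFun (List.ofFn_injective h3) i)
    exact h
  · exact fun h => ⟨x, W, w₀, rfl, hW, h⟩

theorem decisionQuery_encode (x : List Bool) {M c : ℕ} (W : Fin M → ℕ) {w : ℕ → ℕ} {t₀ : ℕ}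
    (hw : ∀ i < M, w i ≤ weightCap c (encodeSearchInstance x W))
    (ht : t₀ ≤ thresholdCap c (encodeSearchInstance x W)) :
    decisionQuery c (encodeSearchInstance x W) w t₀ =
      encodeDecisionInstance x (fun i : Fin M => w i) t₀ := by
  unfold decisionQuery
  rw [encodeDecisionInstance_eq, nthString_encode_zero, numWeights_encode, min_eq_left ht]
  generalize weightCap c (encodeSearchInstance x W) = K at hw
  rw [encodeSearchInstance, encodeStrings_cons, encodeStrings_eq]
  congr 2
  rw [List.flatMap_eq_range (List.ofFn fun i : Fin M => (w i).bits) encodeString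
    fun i => encodeString (min (w i) K).bits, List.length_ofFn]
  intro i hi
  rw [List.length_ofFn] at hi
  rw [min_eq_left (hw i hi)]
  simp

/-- Under the stated bounds the cutoffs are inactive, the query is a legal instance for the exponent
`c + 5`, and the tape is long enough for the oracle. -/
theorem searchable_encode {c k : ℕ} (x : List Bool) (W : Fin (m x.length) → ℕ)
    (hW : ∀ i, W i ≤ m x.length ^ c) (hR : ∃ y, R x y) :
    Searchable (weightedDecision m R (c + 5)) c k (encodeSearchInstance x W) {y | R x y} where
  num := numWeights_encode x W
  nonempty := hR
  weight_le i hi := by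
    rw [parsedWeight_encode x W hW ⟨i, hi⟩]
    exact hW _
  accepted w t₀ t ht h1 h2 h3 := by
    have h4 := length_decisionQuery_pow_le c k (encodeSearchInstance x W) w t₀
    unfold Accepted
    rw [decisionQuery_encode x W h1 h3, mem_weightedDecision_iff _ _ fun i => h2 i i.2]
    rw [decisionQuery_encode x W h1 h3] at h4
    exact and_iff_right (h4.trans ht)

theorem minimizers_parsedWeight {c : ℕ} (x : List Bool) (W : Fin (m x.length) → ℕ)
    (hW : ∀ i, W i ≤ m x.length ^ c) :
    minimizers {y | R x y} (parsedWeight c (encodeSearchInstance x W)) =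
      minWeightSearchSet m R x W := by
  have : (fun i : Fin (m x.length) => parsedWeight c (encodeSearchInstance x W) i) = W :=
    funext fun i => parsedWeight_encode x W hW i
  unfold minimizers minWeightSearchSet listWeight
  rw [this]
  rfl

end Instances

/-! ### From programs to catalytic machines -/

theorem mem_CL_of_impl {P : CompProblem} {T : Env → Mem × ℕ} (hT : Impl T) (k₀ : ℕ)
    (h : ∀ x τ : List Bool, (∃ k, k₀ ≤ k ∧ τ.length = x.length ^ k) →
      (T ⟨x, ⟨τ, []⟩⟩).1.tape = τ ∧
        P x (decide ((T ⟨x, ⟨τ, []⟩⟩).2 ≠ 0)) (T ⟨x, ⟨τ, []⟩⟩).1.out) : P ∈ CL := by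
  obtain ⟨B, ⟨j, hj⟩, -, hp⟩ := hT
  obtain ⟨p, hp⟩ := hp (fun _ => 0) 0 (fun i hi => absurd hi (Nat.not_lt_zero _))
  -- The registers are below `(n + 2) ^ j`, and `n + 2 ≤ 2 ^ (2 * (log n + 1))`, which accounts for
  -- `2 * j`. Of the summand 3, two cells are the overhead of the counters and one makes the bound
  -- strict. The summand `k₀` makes the catalytic tape long enough.
  let k := k₀ + 2 * j + 3
  have hk : ∀ n, 2 * j * (Nat.log 2 n + 1) + 3 ≤ k * (Nat.log 2 n + 1) := by
    intro n
    have : (2 * j + 3) * (Nat.log 2 n + 1) ≤ k * (Nat.log 2 n + 1) :=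
      Nat.mul_le_mul_right _ (by simp only [k]; omega)
    rw [add_mul] at this
    omega
  refine ⟨k, ?_⟩
  have key := mem_CSPACE_of_prog (P := P) (p := p) (v := 0) (B := fun n => (n + 2) ^ j)
    (L := fun n => k * (Nat.log 2 n + 1) - 2) (c := fun n => n ^ k) (fun n => ?_) (fun x τ hτ => ?_)
  · rwa [show (fun n => k * (Nat.log 2 n + 1)) = fun n => k * (Nat.log 2 n + 1) - 2 + 2 from
      funext fun n => by have := hk n; omega]
  · have h1 : n + 2 ≤ 2 ^ (2 * (Nat.log 2 n + 1)) := by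
      have h2 := Nat.lt_pow_succ_log_self (b := 2) (by omega) n
      have h3 : 2 ≤ 2 ^ (Nat.log 2 n + 1) := by
        rw [pow_succ]
        have := Nat.two_pow_pos (Nat.log 2 n)
        omega
      rw [two_mul, pow_add]
      have := Nat.mul_le_mul_right (2 ^ (Nat.log 2 n + 1)) h3
      rw [Nat.succ_eq_add_one] at h2
      omega
    calc (n + 2) ^ j ≤ (2 ^ (2 * (Nat.log 2 n + 1))) ^ j := Nat.pow_le_pow_left h1 j
      _ = 2 ^ (2 * j * (Nat.log 2 n + 1)) := by rw [← pow_mul]; congr 1; ring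
      _ < _ := Nat.pow_lt_pow_right (by omega) (by have := hk n; omega)
  · obtain ⟨s', he, -, hm, hr⟩ := (hp ⟨x, ⟨τ, []⟩⟩ ⟨fun _ => 0, fun _ => 0, τ, []⟩
      ⟨rfl, fun i hi => absurd hi (Nat.not_lt_zero _)⟩).mono (hj _)
    obtain ⟨h1, h2⟩ := h x τ ⟨k, by simp only [k]; omega, hτ⟩
    refine ⟨s', he, ?_, ?_⟩
    · rw [← h1, ← hm]; rfl
    · rw [hr]
      rw [← hm] at h2
      exact h2

open Ctx in
theorem lsp_valid {A : Language Bool} {k : ℕ} (hA : IsOracle A k) (c : ℕ) {α : Type} [Ctx α] :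
    LSP fun a : α => EndsInZeros (inp a) ∧
      ((validityQuery c (inp a)).length ^ k ≤ (mem a).tape.length ∧ validityQuery c (inp a) ∈ A) := by
  have hn : LS fun a : α => (inp a).length := LS.inp_length
  have hq : LSS fun a : α => validityQuery c (inp a) :=
    LSS.append LSS.inp (LSS.encodeString (LSS.bits (hn.pow_const (c + 1))))
  refine ((LSP.le (LS.const 2) hn).and ((LSS.inp.getElem (LS.sub hn (LS.const 2))).not.and
    (LSS.inp.getElem hn.pred).not)).and (hA _ hq fun a p _ _ => ?_)
  simp only [inp_setMem]


theorem mainTheorem9 (m : ℕ → ℕ) (hm : ∃ p : Polynomial ℕ, ∀ n, m n ≤ p.eval n)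
    (R : (x : List Bool) → (Fin (m x.length) → Bool) → Prop)
    (hR : witnessLanguage m R ∈ PSPACE)
    (hdec : ∀ c : ℕ, 0 < c → decisionProblem (weightedDecision m R c) ∈ CL) :
    ∀ c : ℕ, 0 < c → minWeightSearch m R c ∈ CL := by
  classical
  intro c hc
  obtain ⟨k₁, h₁⟩ := exists_oracle (hdec c hc)
  obtain ⟨k₂, h₂⟩ := exists_oracle (hdec (c + 5) (by omega))
  have hv := lsp_valid (α := Env) h₁ c
  have hs := Impl.bind (impl_search (α := Env) (c := c) h₂) (LS.const 1)
  -- The tape has to hold the reserved part and the slots, and separately to be long enough for the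
  -- validity query. The sum covers both, and being computable it is polynomially bounded.
  have hneed : LS fun a : Env => reserved c k₂ (Ctx.inp a) + numWeights (Ctx.inp a) * slotWidth (Ctx.inp a) +
      (validityQuery c (Ctx.inp a)).length ^ k₁ :=
    LS.add (LS.add (ls_reserved c k₂) (LS.mul ls_numWeights ls_slotWidth))
      ((LSS.append LSS.inp (LSS.encodeString
        (LSS.bits (LS.inp_length.pow_const (c + 1))))).length.pow_const k₁)
  obtain ⟨j, hj⟩ := hneed.polyBdd
  refine mem_CL_of_impl (Impl.iteP hv hs (G := fun a => (Ctx.mem a, 0)) LS.zero) (2 * j) ?_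
  rintro u τ ⟨k, hk, hτ⟩
  have hneed' : 2 ≤ u.length → reserved c k₂ u + numWeights u * slotWidth u +
      (validityQuery c u).length ^ k₁ ≤ τ.length := by
    intro hn
    -- Sizes are measured by `n + 2` but the tape by powers of `n`, hence the exponent `2 * j`.
    -- Inputs shorter than 2 do not end in `00` and are rejected whatever the tape length.
    have h3 : u.length + 2 ≤ u.length ^ 2 := by nlinarith
    calc _ ≤ (u.length + 2) ^ j := hj ⟨u, ⟨τ, []⟩⟩
      _ ≤ (u.length ^ 2) ^ j := Nat.pow_le_pow_left h3 j
      _ = u.length ^ (2 * j) := (pow_mul _ _ _).symm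
      _ ≤ u.length ^ k := Nat.pow_le_pow_right (by omega) hk
      _ = τ.length := hτ.symm
  have hvalid := valid_iff (m := m) (R := R) c u
  by_cases hu : EndsInZeros u ∧ validityQuery c u ∈ weightedDecision m R c
  · have hlen := hneed' hu.1.1
    rw [if_pos]
    · obtain ⟨x, W, rfl, hW, hy⟩ := hvalid.1 hu
      have hsearch := searchable_encode (k := k₂) x W hW hy
      obtain ⟨h3, y, hy', h4⟩ := hsearch.correct (t := τ) (by omega)
      refine ⟨h3, Or.inl ⟨by simp, x, W, rfl, hW, y, ?_, ?_⟩⟩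
      · rwa [← minimizers_parsedWeight x W hW]
      · exact h4
    · exact ⟨hu.1, Nat.le_trans (Nat.le_add_left _ _) hlen, hu.2⟩
  · rw [if_neg]
    · exact ⟨rfl, Or.inr ⟨rfl, fun h => hu (hvalid.2 h)⟩⟩
    · exact fun h => hu ⟨h.1, h.2.2⟩
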